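/- Conventions. Let $p$ be a prime, $q$ a power of $p$, and $m,n$ positive integers with $$q>\max\{2mn+3,\;mn+3n+1,\;n(n+1)+2\},$$ and let $M=\operatorname{lcm}(2,3,\ldots,mn)$ (with $M=1$ if $mn=1$). For a field $\mathbb F$ and $f_2,f_3\in\mathbb F[x,y]$, let $\Gamma_{\mathbb F}(f_2,f_3)$ be the bipartite graph whose vertex set is the disjoint union of two copies $P,L$ of $\mathbb F^3$, where $(p_1,p_2,p_3)\in P$ is adjacent to $[l_1,l_2,l_3]\in L$ if and only if $p_2+l_2=f_2(p_1,l_1)$ and $p_3+l_3=f_3(p_1,l_1)$. Put $\Gamma_3(\mathbb F)=\Gamma_{\mathbb F}(xy,x^2y)$ and $\Gamma_{q^M}=\Gamma_{\mathbb F_{q^M}}$. Let $K_p=\{p^j: j\ge 0\}$, $\Phi_p(u,v)=\{(i,j)\in K_p^2: iv=ju\}$ and $\rho_a(x)=x(x-a)$. For $h=\sum h_{i,j}x^iy^j\in\mathbb F_q[x,y]$, $a\in\mathbb F_q$ and $u,v\in K_p$, put $$\mu_{a,u,v}(h)=h-\sum_{(i,j)\in\Phi_p(u,v)}h_{2i,j}\,\rho_a(x)^i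 y^j,\qquad \nu_{a,u,v}(h)=h-\sum_{(i,j)\in\Phi_p(v,u)}h_{i,2j}\,x^i\rho_a(y)^j,$$ $$\pi_{u,v}(h)=h-\sum_{(i,j)\in\Phi_p(u,v)}h_{i,j}\,x^iy^j .$$ Theorem. Let $f,g\in\mathbb F_q[x]$ be monic polynomials of degree at most $m$ with $f(0)=g(0)=0$, and let $h=\sum_{1\le i,j\le n}h_{i,j}x^iy^j\in\mathbb F_q[x,y]$ be nonzero. Let $G=\Gamma_{q^M}(f(x)g(y),h(x,y))$. If $G$ has girth at least eight, then $G$ is isomorphic to $\Gamma_3(\mathbb F_{q^M})$. Furthermore, $G$ has girth at least eight if and only if there are $a\in\mathbb F_q$, $\zeta\in\mathbb F_q\setminus\{0\}$, $u,v\in K_p\cap[1,m]$ and $s\in K_p\cap[1,n]$ such that one of the following holds (where an equation with a monomial whose exponent is written as a fraction includes the requirement that this exponent be an integer): (i) $f(x)=\rho_a(x)^u$, $g(y)=y^v$ and $\mu_{a,u,v}(h)=\zeta x^{su/v}y^s$; (ii) $f(x)=x^v$, $g(y)=\rho_a(y)^u$ and $\nu_{a,u,v}(h)=\zeta x^sy^{su/v}$;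 (iii) $f(x)=x^u$, $g(y)=y^v$ and $\pi_{u,v}(h)=\zeta x^{2su/v}y^s$ or $\pi_{u,v}(h)=\zeta x^sy^{2sv/u}$; (iv) $p=2$, $a\ne 0$ and either (a) $f(x)=\rho_a(x)^u$, $g(y)=y^{2su}$ and $\mu_{a,u,2su}(h)=\zeta xy^s$, or (b) $f(x)=x^{2su}$, $g(y)=\rho_a(y)^u$ and $\nu_{a,u,2su}(h)=\zeta x^sy$. -/

import Mathlib

open Polynomial
open scoped Polynomial.Bivariate

noncomputable section

namespace AlgGraph

/-- The graph `Γ_K(f₂, f₃)`: the vertices are two disjoint copies of `K³` (the points, tagged `inl`,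
and the lines, tagged `inr`); the point `(p₁, p₂, p₃)` is adjacent to the line `[l₁, l₂, l₃]` iff
`p₂ + l₂ = f₂(p₁, l₁)` and `p₃ + l₃ = f₃(p₁, l₁)`.
Here `K[X][Y]` is the ring of polynomials in `x, y`, and `evalEval x₀ y₀` evaluates at
`x = x₀`, `y = y₀`. -/
def Gam {K : Type*} [Field K] (f₂ f₃ : K[X][Y]) : SimpleGraph ((K × K × K) ⊕ (K × K × K)) where
  Adj
    | .inl (p₁, p₂, p₃), .inr (l₁, l₂, l₃) =>
        p₂ + l₂ = f₂.evalEval p₁ l₁ ∧ p₃ + l₃ = f₃.evalEval p₁ l₁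
    | .inr (l₁, l₂, l₃), .inl (p₁, p₂, p₃) =>
        p₂ + l₂ = f₂.evalEval p₁ l₁ ∧ p₃ + l₃ = f₃.evalEval p₁ l₁
    | _, _ => False
  symm := ⟨by
    rintro (⟨a, b, c⟩ | ⟨a, b, c⟩) (⟨d, e, f⟩ | ⟨d, e, f⟩) h <;> exact h⟩
  loopless := ⟨by
    rintro (⟨a, b, c⟩ | ⟨a, b, c⟩) h <;> exact h⟩

section Polynomials

variable {F : Type*} [Field F]

/-- The coefficient `h_{i,j}` of `x ^ i * y ^ j` in `h`. -/
def cf (h : F[X][Y]) (i j : ℕ) : F := (h.coeff j).coeff i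

/-- The polynomial `P(x)`, for a univariate `P`, as a polynomial in `x, y`. -/
def inX (P : F[X]) : F[X][Y] := C P

/-- The polynomial `P(y)`, for a univariate `P`, as a polynomial in `x, y`. -/
def inY (P : F[X]) : F[X][Y] := P.map C

/-- The monomial `c * x ^ i * y ^ j`. -/
def mono (c : F) (i j : ℕ) : F[X][Y] := inX (C c * X ^ i) * inY (X ^ j)

/-- The graph `Γ_3(K) = Γ_K(x y, x² y)`. -/
def Gam3 (K : Type*) [Field K] : SimpleGraph ((K × K × K) ⊕ (K × K × K)) :=
  Gam (mono (1 : K) 1 1) (mono (1 : K) 2 1)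

/-- The polynomial `h ∈ F[x, y]` regarded as a polynomial over the extension field `K`. -/
def baseChange (K : Type*) [Field K] [Algebra F K] (h : F[X][Y]) : K[X][Y] :=
  h.map (mapRingHom (algebraMap F K))

/-- `ρ_a = x (x - a)`. -/
def rho (a : F) : F[X] := X * (X - C a)

/-- `K_p = {p ^ j | j ≥ 0}`. -/
def Kp (p : ℕ) : Set ℕ := {k | ∃ j : ℕ, k = p ^ j}

/-- `Φ_p(u, v) = {(i, j) ∈ K_p × K_p | i v = j u}`. -/
def Phi (p u v : ℕ) : Set (ℕ × ℕ) := {ij | ij.1 ∈ Kp p ∧ ij.2 ∈ Kp p ∧ ij.1 * v = ij.2 * u}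

/-- Only finitely many coefficients of a polynomial are nonzero; this makes the sums below over
`Φ_p(u, v)` genuine finite sums. -/
theorem finite_cf_ne_zero (h : F[X][Y]) {c d : ℕ} (hc : c ≠ 0) (hd : d ≠ 0) :
    {ij : ℕ × ℕ | cf h (c * ij.1) (d * ij.2) ≠ 0}.Finite := by
  have hfin : (⋃ j ∈ h.support, (fun i => (i, j)) '' ((h.coeff j).support : Set ℕ)).Finite :=
    Set.Finite.biUnion (Finset.finite_toSet _) fun j _ => (Finset.finite_toSet _).image _
  refine Set.Finite.of_finite_image (f := fun ij : ℕ × ℕ => (c * ij.1, d * ij.2))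
    (hfin.subset ?_) ?_
  · rintro _ ⟨⟨i, j⟩, hij, rfl⟩
    have hij' : (h.coeff (d * j)).coeff (c * i) ≠ 0 := hij
    simp only [Set.mem_iUnion]
    refine ⟨d * j, ?_, c * i, ?_, rfl⟩
    · rw [mem_support_iff]
      intro h0
      simp [h0] at hij'
    · simpa using hij'
  · rintro ⟨i, j⟩ _ ⟨i', j'⟩ _ he
    simp only [Prod.mk.injEq, mul_eq_mul_left_iff, hc, hd, or_false] at he
    simp [he.1, he.2]

/-- `μ_{a,u,v}(h) = h - ∑_{(i,j) ∈ Φ_p(u,v)} h_{2i,j} ρ_a(x)^i y^j`. -/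
def mu (p : ℕ) (a : F) (u v : ℕ) (h : F[X][Y]) : F[X][Y] :=
  h - ∑ᶠ ij ∈ Phi p u v, inX (C (cf h (2 * ij.1) ij.2) * rho a ^ ij.1) * inY (X ^ ij.2)

/-- `ν_{a,u,v}(h) = h - ∑_{(i,j) ∈ Φ_p(v,u)} h_{i,2j} x^i ρ_a(y)^j`. -/
def nu (p : ℕ) (a : F) (u v : ℕ) (h : F[X][Y]) : F[X][Y] :=
  h - ∑ᶠ ij ∈ Phi p v u, inX (C (cf h ij.1 (2 * ij.2)) * X ^ ij.1) * inY (rho a ^ ij.2)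

/-- `π_{u,v}(h) = h - ∑_{(i,j) ∈ Φ_p(u,v)} h_{i,j} x^i y^j`. -/
def pi (p : ℕ) (u v : ℕ) (h : F[X][Y]) : F[X][Y] :=
  h - ∑ᶠ ij ∈ Phi p u v, mono (cf h ij.1 ij.2) ij.1 ij.2

end Polynomials

end AlgGraph

end

/-! Write F = F_q and K = F_{q^M}. The choice of M makes every polynomial over F of degree at most
mn split in K. Hence, whenever a missing cycle says that some polynomial over F of small degree has
no roots in K apart from one or two known points, that polynomial is determined up to exponents
(`SplitsUpTo.two_root`, `SplitsUpTo.monomial`, `SplitsUpTo.injective`). Most hexagons used pass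
through x = 0 and y = 0, where f g and h vanish; such a hexagon closes exactly when f g and h each
take the same value at two points (x, y) and (x', y').

Without 4-cycles and 6-cycles, f and g take each value at most twice (`Girth8.not_three`). Counting
a generic fibre, after extracting a Frobenius power, leaves only x^u and ρ_a(x)^u for each factor.
Two quadratic factors are excluded by a hexagon built from the two reflections
(`Girth8.not_rho_rho`). For the remaining shapes the main tool is `Girth8.row_pow_eq`: with h = ∑
h_j(x) y^j, all rows h_j but one are, up to Frobenius, powers of the reduced factor f₀.

If f = x^u and g = y^v, this holds in both variables, so exactly one monomial x^k y^l of h lies off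
the line v i = u j. Comparing h with its translates by 1 yields the exponents
(`OffDiag.of_translates`, `exponent_eq`). If f = ρ_a^u and g = y^v, the exceptional row gives an
arc: in the pencil spanned by ρ_a^(ul) and h_l^v, the member vanishing at e has no zeros other than
0 and e. This forces h_l^v = ζ x^(ul) + κ ρ_a^(ul) (`pencil_eq`).

Conversely, the terms indexed by Φ_p are additive functions of f(x)g(y), so a change of coordinates
removes them. In X = x^u, Y = y^v and up to a field automorphism, the remaining monomial and f g are
independent combinations of X²Y and XY (in the second form of (iii), after exchanging the
variables). The graph is therefore Γ_3, whose girth is at least eight (`egirth_Gam3`). -/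

namespace AlgGraph

/-! ### Powers of the characteristic and binomial coefficients. -/

section PrimePowers

variable {p : ℕ}

theorem one_mem_Kp : 1 ∈ Kp p := ⟨0, by simp⟩

theorem Kp_pos [hp : Fact p.Prime] {k : ℕ} (hk : k ∈ Kp p) : 0 < k := by
  obtain ⟨j, rfl⟩ := hk
  exact pow_pos hp.out.pos j

theorem Kp_mul {k l : ℕ} (hk : k ∈ Kp p) (hl : l ∈ Kp p) : k * l ∈ Kp p := by
  obtain ⟨i, rfl⟩ := hk
  obtain ⟨j, rfl⟩ := hl
  exact ⟨i + j, (pow_add p i j).symm⟩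

theorem Kp_of_dvd [hp : Fact p.Prime] {d k : ℕ} (hk : k ∈ Kp p) (h : d ∣ k) : d ∈ Kp p := by
  obtain ⟨i, rfl⟩ := hk
  obtain ⟨j, -, rfl⟩ := (Nat.dvd_prime_pow hp.out).1 h
  exact ⟨j, rfl⟩

theorem Kp_dvd_total {k l : ℕ} (hk : k ∈ Kp p) (hl : l ∈ Kp p) : k ∣ l ∨ l ∣ k := by
  obtain ⟨i, rfl⟩ := hk
  obtain ⟨j, rfl⟩ := hl
  rcases le_total i j with h | h
  · exact Or.inl (pow_dvd_pow p h)
  · exact Or.inr (pow_dvd_pow p h)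

/-- Two powers of `p` that differ by a power of `p`: then `p = 2` and one is twice the other. -/
theorem Kp_sub [hp : Fact p.Prime] {k l e : ℕ} (hk : k ∈ Kp p) (hl : l ∈ Kp p) (he : e ∈ Kp p)
    (h : k = l + e) : k = 2 * l := by
  have hl0 := Kp_pos hl
  have he0 := Kp_pos he
  obtain ⟨d, rfl⟩ : l ∣ k := by
    rcases Kp_dvd_total hl hk with h' | h'
    · exact h'
    · have := Nat.le_of_dvd hl0 h'
      omega
  obtain ⟨c, rfl⟩ : l ∣ e := (Nat.dvd_add_right (dvd_refl l)).1 (h ▸ dvd_mul_right l d)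
  have hdc : d = 1 + c := Nat.eq_of_mul_eq_mul_left hl0 (by rw [h]; ring)
  obtain ⟨i, rfl⟩ := Kp_of_dvd hk (dvd_mul_left d l)
  obtain ⟨j, rfl⟩ := Kp_of_dvd he (dvd_mul_left c l)
  rcases Nat.eq_zero_or_pos j with rfl | hj
  · simp at hdc
    rw [hdc]; ring
  · rcases Nat.eq_zero_or_pos i with rfl | hi
    · have := pow_pos hp.out.pos j
      rw [pow_zero] at hdc
      omega
    · have h1 : p ∣ p ^ i := dvd_pow_self p hi.ne'
      rw [hdc] at h1
      have h2 : p ∣ 1 := (Nat.dvd_add_left (dvd_pow_self p hj.ne')).1 h1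
      exact absurd (Nat.dvd_one.1 h2) hp.out.one_lt.ne'

/-- A positive number is a power of `p` times a number prime to `p`. -/
theorem exists_Kp_mul [hp : Fact p.Prime] {k : ℕ} (hk : k ≠ 0) :
    ∃ s r : ℕ, s ∈ Kp p ∧ ¬ p ∣ r ∧ k = s * r := by
  obtain ⟨e, r, hr, h⟩ := Nat.exists_eq_pow_mul_and_not_dvd hk p hp.out.ne_one
  exact ⟨p ^ e, r, ⟨e, rfl⟩, hr, h⟩

variable {R : Type*} [CommRing R] [Fact p.Prime] [CharP R p]

theorem add_pow_Kp {k : ℕ} (hk : k ∈ Kp p) (x y : R) : (x + y) ^ k = x ^ k + y ^ k := by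
  obtain ⟨j, rfl⟩ := hk
  exact add_pow_char_pow x y p j

theorem sub_pow_Kp {k : ℕ} (hk : k ∈ Kp p) (x y : R) : (x - y) ^ k = x ^ k - y ^ k := by
  obtain ⟨j, rfl⟩ := hk
  exact sub_pow_char_pow x y j

theorem pow_Kp_inj [IsReduced R] {k : ℕ} (hk : k ∈ Kp p) {x y : R} (h : x ^ k = y ^ k) :
    x = y := by
  have h1 : (x - y) ^ k = 0 := by rw [sub_pow_Kp hk, h, sub_self]
  exact sub_eq_zero.1 (eq_zero_of_pow_eq_zero h1)

theorem pow_Kp_surj {E : Type*} [Field E] [Finite E] [CharP E p] {k : ℕ} (hk : k ∈ Kp p) (x : E) :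
    ∃ y, y ^ k = x :=
  Finite.surjective_of_injective (f := fun y : E => y ^ k) (fun _ _ h => pow_Kp_inj hk h) x

/-- A number `k` with `(t + 1) ^ k` congruent to `t ^ k + 1` modulo `p` is a power of `p`. -/
theorem Kp_of_choose {k : ℕ} (hk : k ≠ 0)
    (h : ∀ a, 0 < a → a < k → ((k.choose a : ℕ) : R) = 0) : k ∈ Kp p := by
  obtain ⟨s, r, hs, hr, rfl⟩ := exists_Kp_mul (p := p) hk
  rcases Nat.lt_or_ge 1 r with h1 | h1
  · exfalso
    have hs0 := Kp_pos hs
    have h2 := h s hs0 (by nlinarith)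
    -- Since (X + 1)^(sr) = (X^s + 1)^r, the binomial coefficient of index s is r modulo p, which is
    -- nonzero.
    have h3 : ((X + 1 : R[X]) ^ (s * r)).coeff s = r := by
      rw [pow_mul, add_pow_Kp hs, one_pow,
        show (X ^ s + 1 : R[X]) ^ r = expand R s ((X + 1) ^ r) by simp,
        coeff_expand hs0, if_pos dvd_rfl, Nat.div_self hs0, coeff_X_add_one_pow,
        Nat.choose_one_right]
    rw [coeff_X_add_one_pow, h2] at h3
    exact hr ((CharP.cast_eq_zero_iff R p r).1 h3.symm)
  · have : r ≠ 0 := by rintro rfl; exact hr (dvd_zero p)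
    obtain rfl : r = 1 := by omega
    simpa using hs

theorem choose_Kp {k : ℕ} (hk : k ∈ Kp p) {a : ℕ} (h0 : 0 < a) (h1 : a < k) :
    ((k.choose a : ℕ) : R) = 0 := by
  rw [← coeff_X_add_one_pow, add_pow_Kp hk, one_pow, coeff_add, coeff_X_pow, coeff_one,
    if_neg h1.ne, if_neg h0.ne', add_zero]

theorem choose_add_Kp {k l : ℕ} (hk : k ∈ Kp p) (hl : l ∈ Kp p) (hkl : k ≠ l) :
    (((k + l).choose l : ℕ) : R) = 1 := by
  have h1 := (Kp_pos hk).ne'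
  have h2 := (Kp_pos hl).ne'
  rw [← coeff_X_add_one_pow, pow_add, add_pow_Kp hk, add_pow_Kp hl, one_pow, one_pow]
  have : ((X ^ k + 1) * (X ^ l + 1) : R[X]) = X ^ (k + l) + X ^ k + X ^ l + 1 := by ring
  rw [this]
  simp only [coeff_add, coeff_X_pow, coeff_one]
  simp [h1, h2, hkl.symm]

end PrimePowers

/-! ### Polynomials over the small field and their roots in the large field. -/

section Splitting

/-- All polynomials over `F` of degree at most `N` split in `K`. -/
def SplitsUpTo (F K : Type*) [Field F] [Field K] [Algebra F K] (N : ℕ) : Prop :=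
  ∀ P : F[X], P.natDegree ≤ N → (P.map (algebraMap F K)).Splits

variable {F K : Type*} [Field F] [Field K] [Algebra F K]

/-- An irreducible factor of degree d ≤ N acquires a root in an extension of degree d, which embeds
in K because d divides [K : F]. One root suffices, since K is normal over F. -/
theorem splitsUpTo_of_finrank [Finite F] [Finite K] {N : ℕ}
    (h : ∀ d, 0 < d → d ≤ N → d ∣ Module.finrank F K) : SplitsUpTo F K N := by
  have : ∀ d ≤ N, ∀ P : F[X], P.natDegree = d → (P.map (algebraMap F K)).Splits := by
    intro d
    induction d using Nat.strong_induction_on with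
    | _ d ih =>
      intro hd P hP
      by_cases hu : P.natDegree = 0
      · exact Splits.of_natDegree_eq_zero (by rw [natDegree_map, hu])
      · have hP0 : P ≠ 0 := by rintro rfl; simp at hu
        obtain ⟨g, hg, Q, rfl⟩ := exists_irreducible_of_natDegree_ne_zero hu
        have hg0 : g ≠ 0 := hg.ne_zero
        have hQ0 : Q ≠ 0 := by rintro rfl; simp at hP0
        rw [natDegree_mul hg0 hQ0] at hP
        have hgd := hg.natDegree_pos
        have := Fact.mk hg
        have : FiniteDimensional F (AdjoinRoot g) := (AdjoinRoot.powerBasis hg0).finite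
        have hfr : Module.finrank F (AdjoinRoot g) = g.natDegree := by
          rw [(AdjoinRoot.powerBasis hg0).finrank, AdjoinRoot.powerBasis_dim]
        have : Finite (AdjoinRoot g) := Module.finite_of_finite F
        obtain ⟨φ⟩ := FiniteField.nonempty_algHom_of_finrank_dvd (F := F) (K := AdjoinRoot g)
          (L := K) (hfr ▸ h _ hgd (by omega))
        have hroot : aeval (φ (AdjoinRoot.root g)) g = 0 := by
          rw [aeval_algHom_apply, AdjoinRoot.aeval_eq, AdjoinRoot.mk_self, map_zero]
        have hgm : (g.map (algebraMap F K)).Splits := by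
          have h1 := Normal.splits (F := F) (K := K) inferInstance (φ (AdjoinRoot.root g))
          have h2 := minpoly.eq_of_irreducible hg hroot
          rw [← h2, Polynomial.map_mul] at h1
          refine Splits.of_dvd h1 ?_ (dvd_mul_right _ _)
          have := leadingCoeff_ne_zero.2 hg0
          rw [← Polynomial.map_mul, Polynomial.map_ne_zero_iff (algebraMap F K).injective]
          exact mul_ne_zero hg0 (by simpa using hg0)
        rw [Polynomial.map_mul]
        exact hgm.mul (ih Q.natDegree (by omega) (by omega) Q rfl)
  exact fun P hP => this _ hP P rfl

variable {N : ℕ}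

theorem SplitsUpTo.mono {N' : ℕ} (hS : SplitsUpTo F K N) (h : N' ≤ N) : SplitsUpTo F K N' :=
  fun P hP => hS P (hP.trans h)

theorem SplitsUpTo.exists_root (hS : SplitsUpTo F K N) {P : F[X]} (hP : P.natDegree ≤ N)
    (h0 : P.natDegree ≠ 0) : ∃ z : K, aeval z P = 0 := by
  obtain ⟨z, hz⟩ := (hS P hP).exists_eval_eq_zero
    (by rw [degree_map]; exact fun h => h0 (natDegree_eq_of_degree_eq_some h))
  exact ⟨z, by rwa [aeval_def, ← eval_map]⟩

/-- A polynomial with at most the roots `0` and `e` in `K`. -/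
theorem SplitsUpTo.two_root (hS : SplitsUpTo F K N) {P : F[X]} (hP : P.natDegree ≤ N)
    (hP0 : P ≠ 0) {e : F} (h : ∀ z : K, aeval z P = 0 → z = 0 ∨ z = algebraMap F K e) :
    ∃ c i j, c ≠ 0 ∧ P = C c * X ^ i * (X - C e) ^ j := by
  obtain ⟨Q, hQ, hQ0⟩ := exists_eq_pow_rootMultiplicity_mul_and_not_dvd P hP0 0
  rw [C_0, sub_zero] at hQ hQ0
  have hQne : Q ≠ 0 := by rintro rfl; simp at hQ0
  obtain ⟨R, hR, hR0⟩ := exists_eq_pow_rootMultiplicity_mul_and_not_dvd Q hQne e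
  set i := rootMultiplicity 0 P
  set j := rootMultiplicity e Q
  have hRne : R ≠ 0 := by rintro rfl; simp at hR0
  -- A nonconstant cofactor would have a root in K, necessarily 0 or e, but the full multiplicities
  -- of both have been divided out.
  have hdeg : R.natDegree = 0 := by
    by_contra hd
    have hRP : R ∣ P := by rw [hQ, hR]; exact Dvd.intro_left _ (mul_assoc _ _ _)
    obtain ⟨z, hz⟩ := hS.exists_root ((natDegree_le_of_dvd hRP hP0).trans hP) hd
    have hzP : aeval z P = 0 := by
      obtain ⟨S, rfl⟩ := hRP
      simp [hz]
    rcases h z hzP with rfl | rfl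
    · have : R.coeff 0 = 0 := by
        have h2 : aeval (algebraMap F K 0) R = 0 := by simpa using hz
        rw [aeval_algebraMap_apply] at h2
        have := (map_eq_zero (algebraMap F K)).1 h2
        simpa [coeff_zero_eq_eval_zero] using this
      exact hQ0 (hR ▸ (X_dvd_iff.2 this).mul_left _)
    · rw [aeval_algebraMap_apply] at hz
      have := (map_eq_zero (algebraMap F K)).1 hz
      exact hR0 (dvd_iff_isRoot.2 (by simpa using this))
  obtain ⟨c, hc⟩ := natDegree_eq_zero.1 hdeg
  refine ⟨c, i, j, ?_, ?_⟩
  · rintro rfl; exact hRne (by rw [← hc, C_0])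
  · rw [hQ, hR, ← hc]; ring

theorem SplitsUpTo.monomial (hS : SplitsUpTo F K N) {P : F[X]} (hP : P.natDegree ≤ N)
    (h : ∀ z : K, z ≠ 0 → aeval z P ≠ 0) : ∃ c k, c ≠ 0 ∧ P = C c * X ^ k := by
  have hP0 : P ≠ 0 := by
    rintro rfl
    exact h 1 one_ne_zero (by simp)
  obtain ⟨c, i, j, hc, hP⟩ := hS.two_root (e := 0) hP hP0
    (fun z hz => Or.inl (by by_contra h0; exact h z h0 hz))
  exact ⟨c, i + j, hc, by rw [hP, C_0, sub_zero, pow_add, mul_assoc]⟩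

variable {p : ℕ} [Fact p.Prime] [CharP F p]

/-- Write s = t r with t a power of p and p ∤ r. Then 1 is the only root of X^r - 1 in K, so X^r - 1
= c (X - 1)^r. For r > 1 the derivatives at 1 are r ≠ 0 and 0, a contradiction; hence r = 1. -/
theorem SplitsUpTo.mem_Kp (hS : SplitsUpTo F K N) {s : ℕ} (hs0 : s ≠ 0) (hs : s ≤ N)
    (h : ∀ z : K, z ≠ 0 → z ^ s = 1 → z = 1) : s ∈ Kp p := by
  obtain ⟨t, r, ht, hr, rfl⟩ := exists_Kp_mul (p := p) hs0
  have hr0 : r ≠ 0 := by rintro rfl; exact hr (dvd_zero p)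
  have ht0 := Kp_pos ht
  have hdeg : (X ^ r - 1 : F[X]).natDegree = r := natDegree_X_pow_sub_C (r := (1 : F))
  have hne : (X ^ r - 1 : F[X]) ≠ 0 := by
    intro h0; rw [h0, natDegree_zero] at hdeg; exact hr0 hdeg.symm
  obtain ⟨c, i, j, hc, hP⟩ := hS.two_root (P := X ^ r - 1) (e := 1)
    (by rw [hdeg]; nlinarith) hne (fun z hz => by
      right
      have hz1 : z ^ r = 1 := by simpa [sub_eq_zero] using hz
      rw [map_one]
      refine h z ?_ ?_
      · rintro rfl
        simp [hr0] at hz1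
      · rw [mul_comm, pow_mul, hz1, one_pow])
  have hi : i = 0 := by
    by_contra hi
    have := congrArg (eval 0) hP
    simp [hr0, hi] at this
  subst hi
  have hj : j = r := by
    have := congrArg natDegree hP
    rw [hdeg, pow_zero, mul_one, natDegree_C_mul hc, natDegree_pow, natDegree_X_sub_C] at this
    omega
  subst hj
  have hd := congrArg (fun Q => eval 1 (derivative Q)) hP
  simp [derivative_pow] at hd
  rcases Nat.lt_or_ge 1 j with h1 | h1
  · rw [zero_pow (by omega)] at hd
    simp at hd
    exact absurd ((CharP.cast_eq_zero_iff F p j).1 hd) hr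
  · obtain rfl : j = 1 := by omega
    simpa using ht

/-- A polynomial that is injective on `K` is, up to a constant, a power of the Frobenius. -/
theorem SplitsUpTo.injective (hS : SplitsUpTo F K N) {P : F[X]} (hP : P.natDegree ≤ N)
    (h0 : P.eval 0 = 0) (h : Function.Injective fun z : K => aeval z P) :
    ∃ c k, c ≠ 0 ∧ k ∈ Kp p ∧ P = C c * X ^ k := by
  have h00 : aeval (0 : K) P = 0 := by
    rw [← map_zero (algebraMap F K), aeval_algebraMap_apply, coe_aeval_eq_eval, h0]
  obtain ⟨c, k, hc, hk⟩ := hS.monomial hP (fun z hz h1 => hz (h (by simp only [h1, h00])))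
  have hk0 : k ≠ 0 := by
    rintro rfl
    rw [hk] at h0
    simp [hc] at h0
  refine ⟨c, k, hc, hS.mem_Kp hk0 ?_ ?_, hk⟩
  · rwa [hk, natDegree_C_mul_X_pow k c hc] at hP
  · intro z hz0 hz
    apply h
    simp [hk, hz]

end Splitting

end AlgGraph

namespace AlgGraph

/-! ### Short cycles and girth. -/

section Cycles

variable {V : Type*} {G : SimpleGraph V}

theorem not_adj_square (hG : 8 ≤ G.egirth) {a b c d : V} (hac : a ≠ c) (hbd : b ≠ d)
    (hab : G.Adj a b) (hbc : G.Adj b c) (hcd : G.Adj c d) (hda : G.Adj d a) : False := by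
  have h := SimpleGraph.le_egirth.1 hG a
    (.cons hab (.cons hbc (.cons hcd (.cons hda .nil)))) (by
      rw [SimpleGraph.Walk.cons_isCycle_iff]
      have h1 := hab.ne; have h2 := hbc.ne; have h3 := hcd.ne; have h4 := hda.ne
      simp [SimpleGraph.Walk.isPath_def]
      tauto)
  simp at h
  norm_num at h

theorem not_adj_hexagon (hG : 8 ≤ G.egirth) {a b c d e f : V}
    (hac : a ≠ c) (hce : c ≠ e) (hea : e ≠ a) (hbd : b ≠ d) (hdf : d ≠ f) (hfb : f ≠ b)
    (had : a ≠ d) (hbe : b ≠ e) (hcf : c ≠ f)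
    (hab : G.Adj a b) (hbc : G.Adj b c) (hcd : G.Adj c d) (hde : G.Adj d e) (hef : G.Adj e f)
    (hfa : G.Adj f a) : False := by
  have h := SimpleGraph.le_egirth.1 hG a
    (.cons hab (.cons hbc (.cons hcd (.cons hde (.cons hef (.cons hfa .nil)))))) (by
      rw [SimpleGraph.Walk.cons_isCycle_iff]
      have h1 := hab.ne; have h2 := hbc.ne; have h3 := hcd.ne; have h4 := hde.ne
      have h5 := hef.ne; have h6 := hfa.ne
      simp [SimpleGraph.Walk.isPath_def]
      tauto)
  simp at h
  norm_num at h

theorem exists_eq_cons {u v : V} {w : G.Walk u v} {k : ℕ} (h : w.length = k + 1) :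
    ∃ (x : V) (hux : G.Adj u x) (w' : G.Walk x v), w'.length = k ∧ w = .cons hux w' := by
  cases w with
  | nil => simp at h
  | cons hux w' => exact ⟨_, hux, w', by simpa using h, rfl⟩

/-- In a bipartite graph all cycles are even, so only lengths four and six have to be excluded. -/
theorem egirth_ge_of_two_coloring (col : G.Coloring Bool)
    (h4 : ∀ a b c d : V, a ≠ c → b ≠ d → G.Adj a b → G.Adj b c → G.Adj c d → G.Adj d a → False)
    (h6 : ∀ a b c d e f : V, a ≠ c → c ≠ e → e ≠ a → b ≠ d → d ≠ f → f ≠ b →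
      G.Adj a b → G.Adj b c → G.Adj c d → G.Adj d e → G.Adj e f → G.Adj f a → False) :
    8 ≤ G.egirth := by
  rw [SimpleGraph.le_egirth]
  intro a w hw
  have h3 := hw.three_le_length
  have heven : Even w.length := (col.even_length_iff_congr w).2 Iff.rfl
  by_contra hlt
  have hlt : w.length < 8 := by
    rw [not_le] at hlt
    exact_mod_cast hlt
  obtain ⟨k, hk⟩ := heven
  have hnd := hw.support_nodup
  have : w.length = 4 ∨ w.length = 6 := by omega
  rcases this with h | h
  · obtain ⟨b, hab, w, l1, rfl⟩ := exists_eq_cons h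
    obtain ⟨c, hbc, w, l2, rfl⟩ := exists_eq_cons l1
    obtain ⟨d, hcd, w, l3, rfl⟩ := exists_eq_cons l2
    obtain ⟨e, hde, w, l4, rfl⟩ := exists_eq_cons l3
    obtain rfl := SimpleGraph.Walk.eq_of_length_eq_zero l4
    obtain rfl := SimpleGraph.Walk.eq_nil_iff_nil.2 (SimpleGraph.Walk.length_eq_zero_iff.1 l4)
    simp only [SimpleGraph.Walk.support_cons, SimpleGraph.Walk.support_nil, List.tail_cons,
      List.nodup_cons, List.mem_cons, not_or] at hnd
    exact h4 e b c d (fun h => hnd.2.1.2.1 h.symm) (fun h => hnd.1.2.1 h) hab hbc hcd hde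
  · obtain ⟨b, hab, w, l1, rfl⟩ := exists_eq_cons h
    obtain ⟨c, hbc, w, l2, rfl⟩ := exists_eq_cons l1
    obtain ⟨d, hcd, w, l3, rfl⟩ := exists_eq_cons l2
    obtain ⟨e, hde, w, l4, rfl⟩ := exists_eq_cons l3
    obtain ⟨f, hef, w, l5, rfl⟩ := exists_eq_cons l4
    obtain ⟨g, hfg, w, l6, rfl⟩ := exists_eq_cons l5
    obtain rfl := SimpleGraph.Walk.eq_of_length_eq_zero l6
    obtain rfl := SimpleGraph.Walk.eq_nil_iff_nil.2 (SimpleGraph.Walk.length_eq_zero_iff.1 l6)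
    simp only [SimpleGraph.Walk.support_cons, SimpleGraph.Walk.support_nil, List.tail_cons,
      List.nodup_cons, List.mem_cons, not_or] at hnd
    obtain ⟨hb, hc, hd, he, -⟩ := hnd
    exact h6 g b c d e f (fun h => hc.2.2.2.1 h.symm) hc.2.1 he.2.1 hb.2.1 hd.2.1
      (fun h => hb.2.2.2.1 h.symm) hab hbc hcd hde hef hfg

end Cycles

/-! ### Girth eight as a condition on functions; isomorphisms of algebraically defined graphs. -/

section Graphs

variable {K : Type*} [Field K]

theorem Gam_adj_inl_inr (f₂ f₃ : K[X][Y]) (p l : K × K × K) :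
    (Gam f₂ f₃).Adj (.inl p) (.inr l) ↔
      p.2.1 + l.2.1 = f₂.evalEval p.1 l.1 ∧ p.2.2 + l.2.2 = f₃.evalEval p.1 l.1 := Iff.rfl

theorem Gam_adj_inr_inl (f₂ f₃ : K[X][Y]) (p l : K × K × K) :
    (Gam f₂ f₃).Adj (.inr l) (.inl p) ↔
      p.2.1 + l.2.1 = f₂.evalEval p.1 l.1 ∧ p.2.2 + l.2.2 = f₃.evalEval p.1 l.1 := Iff.rfl

theorem Gam_not_adj_inl (f₂ f₃ : K[X][Y]) (p l : K × K × K) :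
    ¬ (Gam f₂ f₃).Adj (.inl p) (.inl l) := fun h => h

theorem Gam_not_adj_inr (f₂ f₃ : K[X][Y]) (p l : K × K × K) :
    ¬ (Gam f₂ f₃).Adj (.inr p) (.inr l) := fun h => h

/-- The absence of 4-cycles and 6-cycles in the graph `Γ(f(x) g(y), H(x, y))`. -/
structure Girth8 (f g : K → K) (H : K → K → K) : Prop where
  no4x : ∀ {x₁ x₂ : K}, x₁ ≠ x₂ → f x₁ = f x₂ → ∀ {y₁ y₂ : K},
    H x₁ y₁ - H x₂ y₁ = H x₁ y₂ - H x₂ y₂ → y₁ = y₂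
  no4y : ∀ {y₁ y₂ : K}, y₁ ≠ y₂ → g y₁ = g y₂ → ∀ {x₁ x₂ : K},
    H x₁ y₁ - H x₁ y₂ = H x₂ y₁ - H x₂ y₂ → x₁ = x₂
  no6 : ∀ {x₁ x₂ x₃ y₁ y₂ y₃ : K}, x₁ ≠ x₂ → x₂ ≠ x₃ → x₃ ≠ x₁ → y₁ ≠ y₂ → y₂ ≠ y₃ → y₃ ≠ y₁ →
    f x₁ * (g y₁ - g y₃) + f x₂ * (g y₂ - g y₁) + f x₃ * (g y₃ - g y₂) = 0 →
    H x₁ y₁ - H x₁ y₃ + H x₂ y₂ - H x₂ y₁ + H x₃ y₃ - H x₃ y₂ ≠ 0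

/-- Starting at the point (x₁, 0, 0), the adjacency equations determine the last two coordinates of
all other vertices from the first coordinates. The final adjacency holds exactly when the
alternating sums of f g and of H around the cycle vanish. -/
theorem Girth8.of_egirth {f₂ f₃ : K[X][Y]} {f g : K → K} {H : K → K → K}
    (h₂ : ∀ x y, f₂.evalEval x y = f x * g y) (h₃ : ∀ x y, f₃.evalEval x y = H x y)
    (h : 8 ≤ (Gam f₂ f₃).egirth) : Girth8 f g H := by
  have key4 : ∀ {x₁ x₂ y₁ y₂ : K}, x₁ ≠ x₂ → y₁ ≠ y₂ →
      f x₁ * g y₁ - f x₂ * g y₁ = f x₁ * g y₂ - f x₂ * g y₂ →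
      H x₁ y₁ - H x₂ y₁ = H x₁ y₂ - H x₂ y₂ → False := by
    intro x₁ x₂ y₁ y₂ hx hy e2 e3
    refine not_adj_square h (a := .inl (x₁, 0, 0))
      (b := .inr (y₁, f x₁ * g y₁, H x₁ y₁))
      (c := .inl (x₂, f x₂ * g y₁ - f x₁ * g y₁, H x₂ y₁ - H x₁ y₁))
      (d := .inr (y₂, f x₁ * g y₂, H x₁ y₂)) (by simp [hx]) (by simp [hy]) ?_ ?_ ?_ ?_
    all_goals simp only [Gam_adj_inl_inr, Gam_adj_inr_inl, h₂, h₃]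
    all_goals constructor <;> first | ring1 | linear_combination -e2 |
      linear_combination -e3
  refine ⟨fun {x₁ x₂} hx hf {y₁ y₂} he => ?_, fun {y₁ y₂} hy hg {x₁ x₂} he => ?_, ?_⟩
  · by_contra hy
    exact key4 hx hy (by rw [hf]; ring) he
  · by_contra hx
    exact key4 hx hy (by rw [hg]) (by linear_combination he)
  · intro x₁ x₂ x₃ y₁ y₂ y₃ hx12 hx23 hx31 hy12 hy23 hy31 e2 e3
    refine not_adj_hexagon h (a := .inl (x₁, 0, 0))
      (b := .inr (y₁, f x₁ * g y₁, H x₁ y₁))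
      (c := .inl (x₂, f x₂ * g y₁ - f x₁ * g y₁, H x₂ y₁ - H x₁ y₁))
      (d := .inr (y₂, f x₂ * g y₂ - f x₂ * g y₁ + f x₁ * g y₁,
        H x₂ y₂ - H x₂ y₁ + H x₁ y₁))
      (e := .inl (x₃, f x₃ * g y₂ - f x₂ * g y₂ + f x₂ * g y₁ - f x₁ * g y₁,
        H x₃ y₂ - H x₂ y₂ + H x₂ y₁ - H x₁ y₁))
      (f := .inr (y₃, f x₁ * g y₃, H x₁ y₃)) (by simp [hx12]) (by simp [hx23])
      (by simp [hx31]) (by simp [hy12]) (by simp [hy23]) (by simp [hy31]) (by simp) (by simp)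
      (by simp) ?_ ?_ ?_ ?_ ?_ ?_
    all_goals simp only [Gam_adj_inl_inr, Gam_adj_inr_inl, h₂, h₃]
    all_goals constructor <;> first | ring1 | linear_combination -e2 |
      linear_combination -e3

theorem Girth8.swap {f g : K → K} {H : K → K → K} (h : Girth8 f g H) :
    Girth8 g f (fun x y => H y x) := by
  refine ⟨fun {_ _} hx hg {_ _} he => h.no4y hx hg he,
    fun {_ _} hy hf {_ _} he => h.no4x hy hf he, ?_⟩
  intro x₁ x₂ x₃ y₁ y₂ y₃ hx12 hx23 hx31 hy12 hy23 hy31 e2 e3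
  exact h.no6 hy12.symm hy31.symm hy23.symm hx12.symm hx31.symm hx23.symm
    (by linear_combination e2) (by linear_combination e3)

/-- Terms depending on x alone or on y alone do not affect differences around a closed cycle.
Subtracting the values at c restores the normalisation that both functions vanish at x = 0. -/
theorem Girth8.translate {f g : K → K} {H : K → K → K} (h : Girth8 f g H) (c : K) :
    Girth8 (fun x => f (x + c) - f c) g (fun x y => H (x + c) y - H c y) := by
  refine ⟨fun {x₁ x₂} hx hg {y₁ y₂} he => ?_, fun {y₁ y₂} hy hf {x₁ x₂} he => ?_, ?_⟩
  · exact h.no4x (x₁ := x₁ + c) (x₂ := x₂ + c) (by simpa using hx) (by linear_combination hg)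
      (by linear_combination he)
  · have := h.no4y hy hf (x₁ := x₁ + c) (x₂ := x₂ + c) (by linear_combination he)
    simpa using this
  · intro x₁ x₂ x₃ y₁ y₂ y₃ hx12 hx23 hx31 hy12 hy23 hy31 e2 e3
    exact h.no6 (x₁ := x₁ + c) (x₂ := x₂ + c) (x₃ := x₃ + c) (by simpa using hx12)
      (by simpa using hx23) (by simpa using hx31) hy12 hy23 hy31
      (by linear_combination e2) (by linear_combination e3)

/-- The graph `Γ(f₂, f₃)` is properly coloured by the two sides. -/
def sideColoring (f₂ f₃ : K[X][Y]) : (Gam f₂ f₃).Coloring Bool :=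
  SimpleGraph.Coloring.mk Sum.isLeft (by
    rintro (a | a) (b | b) h
    · exact (Gam_not_adj_inl f₂ f₃ a b h).elim
    · simp
    · simp
    · exact (Gam_not_adj_inr f₂ f₃ a b h).elim)

theorem evalEval_mono (c : K) (i j : ℕ) (x y : K) :
    (mono c i j).evalEval x y = c * x ^ i * y ^ j := by
  simp [mono, inX, inY, evalEval_mul, evalEval_C]

theorem Gam_eq_of_adj {f₂ f₃ : K[X][Y]} {p p' l : K × K × K}
    (h : (Gam f₂ f₃).Adj (.inl p) (.inr l)) (h' : (Gam f₂ f₃).Adj (.inl p') (.inr l))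
    (hx : p.1 = p'.1) : p = p' := by
  obtain ⟨p1, p2, p3⟩ := p
  obtain ⟨q1, q2, q3⟩ := p'
  rw [Gam_adj_inl_inr] at h h'
  simp only at hx h h'
  subst hx
  ext <;> simp
  · linear_combination h.1 - h'.1
  · linear_combination h.2 - h'.2

theorem Gam_eq_of_adj' {f₂ f₃ : K[X][Y]} {p l l' : K × K × K}
    (h : (Gam f₂ f₃).Adj (.inl p) (.inr l)) (h' : (Gam f₂ f₃).Adj (.inl p) (.inr l'))
    (hx : l.1 = l'.1) : l = l' := by
  obtain ⟨p1, p2, p3⟩ := l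
  obtain ⟨q1, q2, q3⟩ := l'
  rw [Gam_adj_inl_inr] at h h'
  simp only at hx h h'
  subst hx
  ext <;> simp
  · linear_combination h.1 - h'.1
  · linear_combination h.2 - h'.2

/-- Around a 4-cycle the alternating sum of x y is (x₁ - x₂)(y₁ - y₂). Around a 6-cycle, combining
the sums of x² y and x y gives that of (x - x₂)(x - x₃) y, whose constant term in x cancels; only x₁
contributes, leaving (x₁ - x₂)(x₁ - x₃)(y₁ - y₃) = 0. -/
theorem egirth_Gam3 : 8 ≤ (Gam3 K).egirth := by
  have hadj : ∀ p l : K × K × K, (Gam3 K).Adj (.inl p) (.inr l) →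
      p.2.1 + l.2.1 = p.1 * l.1 ∧ p.2.2 + l.2.2 = p.1 ^ 2 * l.1 := by
    intro p l h
    have := (Gam_adj_inl_inr _ _ p l).1 h
    simpa [evalEval_mono] using this
  have h4 : ∀ a b c d : K × K × K, a ≠ c → b ≠ d → (Gam3 K).Adj (.inl a) (.inr b) →
      (Gam3 K).Adj (.inl c) (.inr b) → (Gam3 K).Adj (.inl c) (.inr d) →
      (Gam3 K).Adj (.inl a) (.inr d) → False := by
    intro a b c d hac hbd hab hcb hcd had
    have e1 := (hadj _ _ hab).1
    have e2 := (hadj _ _ hcb).1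
    have e3 := (hadj _ _ hcd).1
    have e4 := (hadj _ _ had).1
    have : (a.1 - c.1) * (b.1 - d.1) = 0 := by linear_combination -e1 + e2 - e3 + e4
    rcases mul_eq_zero.1 this with h | h
    · exact hac (Gam_eq_of_adj hab hcb (sub_eq_zero.1 h))
    · exact hbd (Gam_eq_of_adj' hab had (sub_eq_zero.1 h))
  have h6 : ∀ a b c d e f : K × K × K, a ≠ c → c ≠ e → e ≠ a → b ≠ d → d ≠ f → f ≠ b →
      (Gam3 K).Adj (.inl a) (.inr b) → (Gam3 K).Adj (.inl c) (.inr b) →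
      (Gam3 K).Adj (.inl c) (.inr d) → (Gam3 K).Adj (.inl e) (.inr d) →
      (Gam3 K).Adj (.inl e) (.inr f) → (Gam3 K).Adj (.inl a) (.inr f) → False := by
    intro a b c d e f hac hce hea hbd hdf hfb hab hcb hcd hed hef haf
    obtain ⟨e1, f1⟩ := hadj _ _ hab
    obtain ⟨e2, f2⟩ := hadj _ _ hcb
    obtain ⟨e3, f3⟩ := hadj _ _ hcd
    obtain ⟨e4, f4⟩ := hadj _ _ hed
    obtain ⟨e5, f5⟩ := hadj _ _ hef
    obtain ⟨e6, f6⟩ := hadj _ _ haf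
    have hy : (b.1 - f.1) ≠ 0 := fun h => hfb (Gam_eq_of_adj' haf hab (sub_eq_zero.1 h).symm)
    have hx : (a.1 - c.1) ≠ 0 := fun h => hac (Gam_eq_of_adj hab hcb (sub_eq_zero.1 h))
    have : (a.1 - c.1) * (a.1 - e.1) * (b.1 - f.1) = 0 := by
      linear_combination (-f1 + f2 - f3 + f4 - f5 + f6)
        - (c.1 + e.1) * (-e1 + e2 - e3 + e4 - e5 + e6)
    rcases mul_eq_zero.1 this with h | h
    · rcases mul_eq_zero.1 h with h | h
      · exact hx h
      · exact hea (Gam_eq_of_adj hef haf (sub_eq_zero.1 h).symm)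
    · exact hy h
  refine egirth_ge_of_two_coloring (sideColoring _ _) ?_ ?_
  · rintro (a | a) (b | b) (c | c) (d | d) hac hbd hab hbc hcd hda
    all_goals first
      | exact (Gam_not_adj_inl _ _ _ _ hab).elim
      | exact (Gam_not_adj_inr _ _ _ _ hab).elim
      | exact (Gam_not_adj_inl _ _ _ _ hbc).elim
      | exact (Gam_not_adj_inr _ _ _ _ hbc).elim
      | exact (Gam_not_adj_inl _ _ _ _ hcd).elim
      | exact (Gam_not_adj_inr _ _ _ _ hcd).elim
      | skip
    · exact h4 a b c d (by simpa using hac) (by simpa using hbd) hab hbc.symm hcd hda.symm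
    · exact h4 b c d a (by simpa using hbd) (by simpa using hac.symm) hbc hcd.symm hda hab.symm
  · rintro (a | a) (b | b)
    · exact fun _ _ _ _ _ _ _ _ _ _ hab => (Gam_not_adj_inl _ _ _ _ hab).elim
    · rintro (c | c)
      swap
      · exact fun _ _ _ _ _ _ _ _ _ _ hbc => (Gam_not_adj_inr _ _ _ _ hbc).elim
      rintro (d | d)
      · exact fun _ _ _ _ _ _ _ _ _ _ hcd => (Gam_not_adj_inl _ _ _ _ hcd).elim
      rintro (e | e)
      swap
      · exact fun _ _ _ _ _ _ _ _ _ _ hde => (Gam_not_adj_inr _ _ _ _ hde).elim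
      rintro (f | f)
      · exact fun _ _ _ _ _ _ _ _ _ _ hef => (Gam_not_adj_inl _ _ _ _ hef).elim
      intro hac hce hea hbd hdf hfb hab hbc hcd hde hef hfa
      exact h6 a b c d e f (by simpa using hac) (by simpa using hce) (by simpa using hea)
        (by simpa using hbd) (by simpa using hdf) (by simpa using hfb) hab hbc.symm hcd hde.symm
        hef hfa.symm
    · rintro (c | c)
      · exact fun _ _ _ _ _ _ _ _ _ _ hbc => (Gam_not_adj_inl _ _ _ _ hbc).elim
      rintro (d | d)
      swap
      · exact fun _ _ _ _ _ _ _ _ _ _ hcd => (Gam_not_adj_inr _ _ _ _ hcd).elim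
      rintro (e | e)
      · exact fun _ _ _ _ _ _ _ _ _ _ hde => (Gam_not_adj_inl _ _ _ _ hde).elim
      rintro (f | f)
      swap
      · exact fun _ _ _ _ _ _ _ _ _ _ hef => (Gam_not_adj_inr _ _ _ _ hef).elim
      intro hac hce hea hbd hdf hfb hab hbc hcd hde hef hfa
      exact h6 b c d e f a (by simpa using hbd) (by simpa using hdf) (by simpa using hfb)
        (by simpa using hce) (by simpa using hea) (by simpa using hac) hbc hcd.symm hde hef.symm
        hfa hab.symm
    · exact fun _ _ _ _ _ _ _ _ _ _ hab => (Gam_not_adj_inr _ _ _ _ hab).elim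

/-- Coordinate changes give isomorphisms of algebraically defined graphs. -/
def isoOfEquiv {f₂ f₃ f₂' f₃' : K[X][Y]} (φ ψ : K ≃ K) (T : K × K ≃+ K × K)
    (h : ∀ x y, T (f₂.evalEval x y, f₃.evalEval x y) =
      (f₂'.evalEval (φ x) (ψ y), f₃'.evalEval (φ x) (ψ y))) :
    Gam f₂ f₃ ≃g Gam f₂' f₃' where
  toEquiv := Equiv.sumCongr (Equiv.prodCongr φ T.toEquiv) (Equiv.prodCongr ψ T.toEquiv)
  map_rel_iff' := by
    have key : ∀ p l : K × K × K, (Gam f₂' f₃').Adj (.inl (φ p.1, T p.2)) (.inr (ψ l.1, T l.2)) ↔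
        (Gam f₂ f₃).Adj (.inl p) (.inr l) := by
      intro p l
      rw [Gam_adj_inl_inr, Gam_adj_inl_inr]
      simp only
      have h1 : ((T p.2).1 + (T l.2).1 = f₂'.evalEval (φ p.1) (ψ l.1) ∧
          (T p.2).2 + (T l.2).2 = f₃'.evalEval (φ p.1) (ψ l.1)) ↔
          T (p.2 + l.2) = T (f₂.evalEval p.1 l.1, f₃.evalEval p.1 l.1) := by
        rw [h, map_add, Prod.ext_iff]; rfl
      rw [h1, T.injective.eq_iff, Prod.ext_iff]; rfl
    rintro (a | a) (b | b)
    · exact Iff.rfl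
    · exact key a b
    · exact (SimpleGraph.adj_comm _ _ _).trans ((key b a).trans (SimpleGraph.adj_comm _ _ _))
    · exact Iff.rfl

/-- Interchanging points and lines. -/
def isoSwap {f₂ f₃ f₂' f₃' : K[X][Y]} (h₂ : ∀ x y, f₂.evalEval x y = f₂'.evalEval y x)
    (h₃ : ∀ x y, f₃.evalEval x y = f₃'.evalEval y x) : Gam f₂ f₃ ≃g Gam f₂' f₃' where
  toEquiv := Equiv.sumComm _ _
  map_rel_iff' := by
    have key : ∀ p l : K × K × K, (Gam f₂' f₃').Adj (.inl l) (.inr p) ↔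
        (Gam f₂ f₃).Adj (.inl p) (.inr l) := by
      intro p l
      rw [Gam_adj_inl_inr, Gam_adj_inl_inr, h₂, h₃, add_comm, add_comm l.2.2]
    rintro (a | a) (b | b)
    · exact Iff.rfl
    · exact (SimpleGraph.adj_comm _ _ _).trans (key a b)
    · exact (key b a).trans (SimpleGraph.adj_comm _ _ _)
    · exact Iff.rfl

end Graphs

end AlgGraph

namespace AlgGraph

/-! ### Fibres of the two factors and the possible shapes of f and g. -/

section Fibres

variable {K : Type*} [Field K]

/-- In a graph of girth at least eight the function `f` takes each value at most twice. -/
theorem Girth8.not_three [Finite K] {f g : K → K} {H : K → K → K} (h : Girth8 f g H)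
    (hH : ∀ x, H x 0 = 0) {x₁ x₂ x₃ : K} (h12 : x₁ ≠ x₂) (h23 : x₂ ≠ x₃) (h31 : x₃ ≠ x₁)
    (e12 : f x₁ = f x₂) (e23 : f x₂ = f x₃) : False := by
  have hinj : ∀ {a b : K}, a ≠ b → f a = f b → Function.Injective fun y => H a y - H b y :=
    fun hab e _ _ he => h.no4x hab e he
  -- On a common fibre of f the condition on f g is void. Injectivity of the differences of H is
  -- surjectivity, by finiteness, so y can be chosen to close the hexagon with y₁ = 0, y₂ = 1, y₃ =
  -- y.
  obtain ⟨y, hy⟩ := Finite.surjective_of_injective (hinj h31 (e23.symm.trans e12.symm))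
    (-(H x₂ 1 - H x₃ 1))
  simp only at hy
  have hy0 : y ≠ 0 := by
    rintro rfl
    refine one_ne_zero (hinj h23 e23 (a₁ := (1 : K)) (a₂ := 0) ?_)
    simp only [hH] at hy ⊢
    linear_combination hy
  have hy1 : y ≠ 1 := by
    rintro rfl
    refine one_ne_zero (hinj h12 e12 (a₁ := (1 : K)) (a₂ := 0) ?_)
    simp only [hH]
    linear_combination -hy
  refine h.no6 (y₁ := 0) (y₂ := 1) (y₃ := y) h12 h23 h31 zero_ne_one hy1.symm hy0 ?_ ?_
  · rw [← e23, ← e12]; ring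
  · simp only [hH]
    linear_combination hy

end Fibres

section Classification

variable {F K : Type*} [Field F] [Field K] [Algebra F K]

theorem rho_monic (a : F) : (rho a).Monic := monic_X.mul (monic_X_sub_C a)

theorem natDegree_rho (a : F) : (rho a).natDegree = 2 := by
  rw [rho, monic_X.natDegree_mul (monic_X_sub_C a), natDegree_X, natDegree_X_sub_C]

theorem eval_rho (a x : F) : (rho a).eval x = x * (x - a) := by simp [rho]

theorem aeval_rho (a : F) (x : K) : aeval x (rho a) = x * (x - algebraMap F K a) := by simp [rho]

variable {p : ℕ} [Fact p.Prime] [CharP F p]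

/-- Over a finite field every nonconstant polynomial is a Frobenius power of a polynomial with
nonzero derivative. -/
theorem exists_eq_pow_derivative_ne_zero [Finite F] (f : F[X]) (hf : f.Monic)
    (h0 : f.eval 0 = 0) : ∃ u ∈ Kp p, ∃ f₀ : F[X], f₀.Monic ∧ f₀.eval 0 = 0 ∧
      derivative f₀ ≠ 0 ∧ f = f₀ ^ u := by
  have : ∀ d, ∀ f : F[X], f.natDegree = d → f.Monic → f.eval 0 = 0 →
      ∃ u ∈ Kp p, ∃ f₀ : F[X], f₀.Monic ∧ f₀.eval 0 = 0 ∧ derivative f₀ ≠ 0 ∧ f = f₀ ^ u := by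
    intro d
    induction d using Nat.strong_induction_on with
    | _ d ih =>
      intro f hd hf h0
      by_cases hder : derivative f = 0
      · have hp : p.Prime := Fact.out
        have h1 := expand_contract p hder hp.ne_zero
        have hd0 : f.natDegree ≠ 0 := by
          intro h
          rw [hf.natDegree_eq_zero.1 h, eval_one] at h0
          exact one_ne_zero h0
        -- A polynomial with zero derivative is a polynomial in X^p; taking p-th roots of its
        -- coefficients makes it a p-th power.
        set f₁ := (contract p f).map (frobeniusEquiv F p).symm.toRingHom with hf₁
        have h2 : f = f₁ ^ p := by
          rw [← h1, polynomial_expand_eq]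
          rfl
        have hdeg : f₁.natDegree * p = f.natDegree := by
          rw [h2, natDegree_pow, mul_comm]
        have hmon : f₁.Monic := by
          have h3 : f₁.leadingCoeff ^ p = 1 ^ p := by
            rw [← leadingCoeff_pow, ← h2, hf.leadingCoeff, one_pow]
          exact pow_Kp_inj (p := p) ⟨1, by simp⟩ h3
        have hz : f₁.eval 0 = 0 := by
          rw [h2, eval_pow] at h0
          exact eq_zero_of_pow_eq_zero h0
        have := hp.two_le
        obtain ⟨u, hu, f₀, h4, h5, h6, h7⟩ := ih f₁.natDegree
          (by
            have : 0 < f₁.natDegree := Nat.pos_of_ne_zero (by rintro h; rw [h] at hdeg; omega)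
            nlinarith) f₁ rfl hmon hz
        exact ⟨u * p, Kp_mul hu ⟨1, by simp⟩, f₀, h4, h5, h6, by rw [pow_mul, ← h7, ← h2]⟩
      · exact ⟨1, one_mem_Kp, f, hf, h0, hder, by simp⟩
  exact this _ f rfl hf h0

/-- The critical values of f on K number fewer than q, so some c in F is not one of them. Then f - c
splits over K with simple roots, and the fibre over c has deg f elements. -/
theorem natDegree_le_two_of_not_three [Fintype F] {N : ℕ} (hS : SplitsUpTo F K N)
    (hN : N < Fintype.card F) {f : F[X]} (hd : f.natDegree ≤ N)
    (hder : derivative f ≠ 0)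
    (h3 : ∀ x₁ x₂ x₃ : K, x₁ ≠ x₂ → x₂ ≠ x₃ → x₃ ≠ x₁ → aeval x₁ f = aeval x₂ f →
      aeval x₂ f = aeval x₃ f → False) : f.natDegree ≤ 2 := by
  classical
  by_contra hlt
  push Not at hlt
  set φ := algebraMap F K
  have hder' : (derivative f).map φ ≠ 0 := (Polynomial.map_ne_zero_iff φ.injective).2 hder
  obtain ⟨c, hc⟩ : ∃ c : F, ∀ z ∈ ((derivative f).map φ).roots, aeval z f ≠ φ c := by
    by_contra hcon
    push Not at hcon
    have hsub : (Finset.univ.image φ) ⊆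
        (((derivative f).map φ).roots.toFinset.image fun z => aeval z f) := by
      intro y hy
      obtain ⟨c, -, rfl⟩ := Finset.mem_image.1 hy
      obtain ⟨z, hz, hz'⟩ := hcon c
      exact Finset.mem_image.2 ⟨z, Multiset.mem_toFinset.2 hz, hz'⟩
    have h1 := Finset.card_le_card hsub
    rw [Finset.card_image_of_injective _ φ.injective, Finset.card_univ] at h1
    have h2 := h1.trans (Finset.card_image_le.trans ((Multiset.toFinset_card_le _).trans
      (card_roots' _)))
    rw [natDegree_map] at h2
    have := natDegree_derivative_le f
    omega
  have hdeg : (f - C c).natDegree = f.natDegree := natDegree_sub_C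
  have hspl := hS (f - C c) (hdeg.trans_le hd)
  have hne : (f - C c).map φ ≠ 0 := by
    rw [Polynomial.map_ne_zero_iff φ.injective]
    intro h; rw [h] at hdeg; simp at hdeg; omega
  have hcard := hspl.natDegree_eq_card_roots
  rw [natDegree_map, hdeg] at hcard
  have hroot : ∀ z ∈ ((f - C c).map φ).roots, aeval z f = φ c := by
    intro z hz
    have := (mem_roots hne).1 hz
    rw [IsRoot, eval_map, ← aeval_def, map_sub, aeval_C] at this
    exact sub_eq_zero.1 this
  have hnd : ((f - C c).map φ).roots.Nodup := by
    rw [Multiset.nodup_iff_count_le_one]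
    intro z
    rw [count_roots]
    by_contra h1
    push Not at h1
    obtain ⟨h4, h2⟩ := (one_lt_rootMultiplicity_iff_isRoot hne).1 h1
    rw [derivative_map, derivative_sub, derivative_C, sub_zero] at h2
    rw [IsRoot, eval_map, ← aeval_def, map_sub, aeval_C] at h4
    exact hc z ((mem_roots hder').2 h2) (sub_eq_zero.1 h4)
  have hcard' : 2 < ((f - C c).map φ).roots.toFinset.card := by
    rw [Multiset.toFinset_card_of_nodup hnd, ← hcard]; exact hlt
  obtain ⟨x, hx, y, hy, z, hz, hxy, hxz, hyz⟩ := Finset.two_lt_card.1 hcard'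
  rw [Multiset.mem_toFinset] at hx hy hz
  exact h3 x y z hxy hyz hxz.symm ((hroot x hx).trans (hroot y hy).symm)
    ((hroot y hy).trans (hroot z hz).symm)

/-- A polynomial over `F` taking each value at most twice on `K`. -/
theorem eq_pow_of_not_three [Fintype F] {N : ℕ} (hS : SplitsUpTo F K N)
    (hN : N < Fintype.card F) {f : F[X]} (hfm : f.Monic) (hd : f.natDegree ≤ N)
    (h0 : f.eval 0 = 0)
    (h3 : ∀ x₁ x₂ x₃ : K, x₁ ≠ x₂ → x₂ ≠ x₃ → x₃ ≠ x₁ → aeval x₁ f = aeval x₂ f →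
      aeval x₂ f = aeval x₃ f → False) :
    ∃ u ∈ Kp p, f = X ^ u ∨ ∃ a : F, ((2 : F) ≠ 0 ∨ a ≠ 0) ∧ f = rho a ^ u := by
  obtain ⟨u, hu, f₀, hm, hz, hder, rfl⟩ := exists_eq_pow_derivative_ne_zero (p := p) f hfm h0
  refine ⟨u, hu, ?_⟩
  have hu0 := Kp_pos hu
  have hd0 : f₀.natDegree ≤ N := by
    rw [natDegree_pow] at hd
    nlinarith
  have h2 := natDegree_le_two_of_not_three hS hN hd0 hder (fun x₁ x₂ x₃ a b c e e' =>
    h3 x₁ x₂ x₃ a b c (by rw [map_pow, map_pow, e]) (by rw [map_pow, map_pow, e']))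
  have hc0 : f₀.coeff 0 = 0 := by rw [coeff_zero_eq_eval_zero, hz]
  have hq := eq_quadratic_of_degree_le_two (natDegree_le_iff_degree_le.1 h2)
  rw [hc0, C_0, add_zero] at hq
  have hd1 : f₀.natDegree ≠ 0 := by
    intro h
    rw [hm.natDegree_eq_zero.1 h, eval_one] at hz
    exact one_ne_zero hz
  have hlc : f₀.coeff f₀.natDegree = 1 := hm.coeff_natDegree
  have : f₀.natDegree = 1 ∨ f₀.natDegree = 2 := by omega
  rcases this with h | h
  · left
    rw [h] at hlc
    rw [hq, hlc, coeff_eq_zero_of_natDegree_lt (n := 2) (by omega)]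
    simp
  · right
    rw [h] at hlc
    have hrho : f₀ = rho (-f₀.coeff 1) := by
      conv_lhs => rw [hq, hlc]
      simp [rho]; ring
    refine ⟨-f₀.coeff 1, ?_, by rw [← hrho]⟩
    -- The excluded combination is ρ_0 = x² in characteristic two, whose derivative vanishes.
    by_contra hcon
    push Not at hcon
    apply hder
    rw [hrho, hcon.2, rho, C_0, sub_zero]
    simp [derivative_mul, ← two_mul]
    rw [← C_ofNat, hcon.1, C_0]

end Classification

end AlgGraph

noncomputable section

namespace AlgGraph

/-! ### Rows of h, and why all but one are powers of the reduced factor. -/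

section Rows

variable {F K : Type*} [Field F] [Field K] [Algebra F K]

/-- The rows `h_j(x)` of a polynomial `∑ h_j(x) y ^ j` whose monomials `x ^ i y ^ j` all satisfy
`1 ≤ i, j ≤ n`. -/
structure IsRows (n : ℕ) (r : ℕ → F[X]) : Prop where
  deg : ∀ j, (r j).natDegree ≤ n
  zero : ∀ j, (r j).eval 0 = 0
  supp : ∀ j, j ∉ Finset.Icc 1 n → r j = 0

/-- The value of `∑ h_j(x) y ^ j`. -/
def rowEval (n : ℕ) (r : ℕ → F[X]) (x y : K) : K :=
  ∑ j ∈ Finset.Icc 1 n, aeval x (r j) * y ^ j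

/-- The rows of `h(y, x)`. -/
def swapRows (n : ℕ) (r : ℕ → F[X]) (i : ℕ) : F[X] :=
  ∑ j ∈ Finset.Icc 1 n, C ((r j).coeff i) * X ^ j

/-- The rows of `h(x + c, y) - h(c, y)`. -/
def trRows (c : F) (r : ℕ → F[X]) (j : ℕ) : F[X] :=
  (r j).comp (X + C c) - C ((r j).eval c)

variable {n : ℕ} {r : ℕ → F[X]}

theorem aeval_zero_of_eval {P : F[X]} (h : P.eval 0 = 0) : aeval (0 : K) P = 0 := by
  rw [← map_zero (algebraMap F K), aeval_algebraMap_apply, coe_aeval_eq_eval, h]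

theorem aeval_algebraMap_eval (P : F[X]) (x : F) :
    aeval (algebraMap F K x) P = algebraMap F K (P.eval x) := by
  rw [aeval_algebraMap_apply, coe_aeval_eq_eval]

theorem rowEval_zero_right (x : K) : rowEval n r x 0 = 0 := by
  refine Finset.sum_eq_zero fun j hj => ?_
  rw [zero_pow (by have := (Finset.mem_Icc.1 hj).1; omega), mul_zero]

theorem IsRows.rowEval_zero_left (hr : IsRows n r) (y : K) : rowEval n r 0 y = 0 :=
  Finset.sum_eq_zero fun j _ => by rw [aeval_zero_of_eval (hr.zero j), zero_mul]

theorem IsRows.coeff_zero (hr : IsRows n r) (j : ℕ) : (r j).coeff 0 = 0 := by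
  rw [coeff_zero_eq_eval_zero, hr.zero]

theorem IsRows.coeff_eq_zero (hr : IsRows n r) (j : ℕ) {i : ℕ} (hi : i ∉ Finset.Icc 1 n) :
    (r j).coeff i = 0 := by
  rcases Nat.eq_zero_or_pos i with rfl | h0
  · exact hr.coeff_zero j
  · refine coeff_eq_zero_of_natDegree_lt ((hr.deg j).trans_lt ?_)
    rw [Finset.mem_Icc] at hi
    omega

theorem IsRows.aeval_eq_sum (hr : IsRows n r) (j : ℕ) (x : K) :
    aeval x (r j) = ∑ i ∈ Finset.Icc 1 n, algebraMap F K ((r j).coeff i) * x ^ i := by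
  rw [aeval_eq_sum_range' (Nat.lt_succ_of_le (hr.deg j)), Finset.range_eq_Ico,
    Finset.sum_eq_sum_Ico_succ_bot (Nat.succ_pos n), hr.coeff_zero, zero_smul, zero_add]
  simp only [Algebra.smul_def]
  rfl

theorem IsRows.coeff_swapRows (hr : IsRows n r) (i j : ℕ) :
    (swapRows n r i).coeff j = (r j).coeff i := by
  rw [swapRows, finsetSum_coeff]
  simp only [coeff_C_mul, coeff_X_pow, mul_ite, mul_one, mul_zero]
  rw [Finset.sum_ite_eq]
  split_ifs with h
  · rfl
  · rw [hr.supp j h, Polynomial.coeff_zero]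

theorem IsRows.swap (hr : IsRows n r) : IsRows n (swapRows n r) := by
  refine ⟨fun i => ?_, fun i => ?_, fun i hi => ?_⟩
  · rw [natDegree_le_iff_coeff_eq_zero]
    intro j hj
    rw [hr.coeff_swapRows, hr.supp j (by rw [Finset.mem_Icc]; omega), Polynomial.coeff_zero]
  · rw [← coeff_zero_eq_eval_zero, hr.coeff_swapRows, hr.supp 0 (by simp), Polynomial.coeff_zero]
  · ext j
    rw [hr.coeff_swapRows, hr.coeff_eq_zero j hi, Polynomial.coeff_zero]

theorem IsRows.rowEval_swap (hr : IsRows n r) (x y : K) :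
    rowEval n (swapRows n r) x y = rowEval n r y x := by
  rw [rowEval, rowEval]
  simp only [hr.swap.aeval_eq_sum, hr.aeval_eq_sum, hr.coeff_swapRows, Finset.sum_mul]
  rw [Finset.sum_comm]
  exact Finset.sum_congr rfl fun j _ => Finset.sum_congr rfl fun i _ => by ring

theorem IsRows.translate (hr : IsRows n r) (c : F) : IsRows n (trRows c r) := by
  refine ⟨fun j => ?_, fun j => ?_, fun j hj => ?_⟩
  · rw [trRows, natDegree_sub_C, natDegree_comp, natDegree_X_add_C, mul_one]
    exact hr.deg j
  · simp [trRows]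
  · rw [trRows, hr.supp j hj]; simp

theorem aeval_trRows (c : F) (j : ℕ) (x : K) :
    aeval x (trRows c r j) = aeval (x + algebraMap F K c) (r j) - aeval (algebraMap F K c) (r j) := by
  rw [trRows, map_sub, aeval_comp, aeval_C, aeval_algebraMap_eval]
  simp

theorem eval_trRows (c : F) (j : ℕ) (x : F) :
    (trRows c r j).eval x = (r j).eval (x + c) - (r j).eval c := by
  simp [trRows]

theorem rowEval_trRows (c : F) (x y : K) : rowEval n (trRows c r) x y =
    rowEval n r (x + algebraMap F K c) y - rowEval n r (algebraMap F K c) y := by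
  simp only [rowEval, aeval_trRows, sub_mul, Finset.sum_sub_distrib]

variable {f g : K → K}

theorem Girth8.trRows (h : Girth8 f g (rowEval n r)) (c : F) :
    Girth8 (fun x => f (x + algebraMap F K c) - f (algebraMap F K c)) g
      (rowEval n (trRows c r)) := by
  have := h.translate (algebraMap F K c)
  simpa only [← rowEval_trRows] using this

theorem Girth8.swapRows (h : Girth8 f g (rowEval n r)) (hr : IsRows n r) :
    Girth8 g f (rowEval n (swapRows n r)) := by
  have := h.swap
  simpa only [← hr.rowEval_swap] using this

variable {p : ℕ} [Fact p.Prime] [CharP F p]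

/-- If `f` takes the same value at two elements of `F`, the corresponding values of `h` differ in
one row only. -/
theorem Girth8.exists_row (h : Girth8 f g (rowEval n r)) (hS : SplitsUpTo F K n)
    {x₁ x₂ : F} (hx : x₁ ≠ x₂) (hf : f (algebraMap F K x₁) = f (algebraMap F K x₂)) :
    ∃ l ∈ Kp p, (1 ≤ l ∧ l ≤ n) ∧ (r l).eval x₁ ≠ (r l).eval x₂ ∧
      ∀ j ∈ Finset.Icc 1 n, j ≠ l → (r j).eval x₁ = (r j).eval x₂ := by
  set S : F[X] := ∑ j ∈ Finset.Icc 1 n, C ((r j).eval x₁ - (r j).eval x₂) * X ^ j with hSdef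
  have hcoeff : ∀ j ∈ Finset.Icc 1 n, S.coeff j = (r j).eval x₁ - (r j).eval x₂ := by
    intro j hj
    rw [hSdef, finsetSum_coeff]
    simp only [coeff_C_mul, coeff_X_pow, mul_ite, mul_one, mul_zero]
    rw [Finset.sum_ite_eq, if_pos hj]
  have hdeg : S.natDegree ≤ n := natDegree_sum_le_of_forall_le _ _ fun j hj =>
    (natDegree_C_mul_X_pow_le _ _).trans (Finset.mem_Icc.1 hj).2
  have hev : ∀ y : K, aeval y S =
      rowEval n r (algebraMap F K x₁) y - rowEval n r (algebraMap F K x₂) y := by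
    intro y
    simp only [hSdef, rowEval, map_sum, map_mul, aeval_C, map_pow, aeval_X, map_sub,
      aeval_algebraMap_eval, ← Finset.sum_sub_distrib, sub_mul]
  have hS0 : S.eval 0 = 0 := by
    rw [hSdef, eval_finsetSum]
    refine Finset.sum_eq_zero fun j hj => ?_
    have := (Finset.mem_Icc.1 hj).1
    simp [show j ≠ 0 by omega]
  -- The absence of 4-cycles says precisely that the difference polynomial S is injective on K, so
  -- it is a single term c y^l with l a power of p.
  obtain ⟨c, l, hc, hl, hSl⟩ := hS.injective (p := p) hdeg hS0 (fun y₁ y₂ he => by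
    simp only [hev] at he
    exact h.no4x ((algebraMap F K).injective.ne hx) hf he)
  have hl0 := Kp_pos hl
  have hln : l ≤ n := by rwa [hSl, natDegree_C_mul_X_pow l c hc] at hdeg
  have hco : ∀ j, S.coeff j = if j = l then c else 0 := by
    intro j
    rw [hSl, coeff_C_mul, coeff_X_pow]
    split_ifs <;> simp
  refine ⟨l, hl, ⟨hl0, hln⟩, ?_, ?_⟩
  · have := hcoeff l (Finset.mem_Icc.2 ⟨hl0, hln⟩)
    rw [hco, if_pos rfl] at this
    intro he
    rw [he, sub_self] at this
    exact hc this
  · intro j hj hjl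
    have := hcoeff j hj
    rw [hco, if_neg hjl] at this
    exact sub_eq_zero.1 this.symm

variable [Fintype F]

theorem exists_eval_ne_zero {P : F[X]} (hP : P ≠ 0) (hd : P.natDegree < Fintype.card F) :
    ∃ x, P.eval x ≠ 0 := by
  exact exists_eval_ne_zero_of_natDegree_lt_card P hP (by simpa using hd)

/-- All rows but one are, up to Frobenius, powers of `f₀`. -/
theorem Girth8.row_pow_eq {m u v : ℕ} {f₀ : F[X]}
    (h : Girth8 (fun x : K => aeval x f₀ ^ u) (fun y => y ^ v) (rowEval n r))
    (hq : 2 * m * n + 3 < Fintype.card F) (hS : SplitsUpTo F K n) (hr : IsRows n r)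
    (hf2 : f₀.natDegree ≤ 2) (hf0 : f₀ ≠ 0) (hfz : f₀.eval 0 = 0) (hu : u ∈ Kp p) (hv : v ∈ Kp p)
    (hum : f₀.natDegree * u ≤ m) (hvm : v ≤ m) {j j' : ℕ} (hjj : j ≠ j') :
    (∃ c, r j ^ v = C c * f₀ ^ (u * j)) ∨ ∃ c, r j' ^ v = C c * f₀ ^ (u * j') := by
  have hu0 := Kp_pos hu
  have hv0 := Kp_pos hv
  by_contra hcon
  push Not at hcon
  obtain ⟨hcj, hcj'⟩ := hcon
  obtain ⟨α, hα⟩ := exists_eval_ne_zero hf0 (by omega)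
  -- Q j vanishes identically if and only if r j ^ v is a constant multiple of f₀^(uj); the constant
  -- can be read off at α.
  set Q : ℕ → F[X] := fun j => C (f₀.eval α ^ (u * j)) * r j ^ v -
    C ((r j).eval α ^ v) * f₀ ^ (u * j) with hQ
  have hQ0 : ∀ j, (∀ c, r j ^ v ≠ C c * f₀ ^ (u * j)) → Q j ≠ 0 := by
    intro j hj h0
    refine hj ((r j).eval α ^ v / f₀.eval α ^ (u * j)) ?_
    have h1 := pow_ne_zero (u * j) hα
    rw [hQ] at h0
    have h2 := sub_eq_zero.1 h0
    rw [div_eq_inv_mul, C_mul, mul_assoc, ← h2, ← mul_assoc, ← C_mul, inv_mul_cancel₀ h1, C_1,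
      one_mul]
  have hmem : ∀ j, (∀ c, r j ^ v ≠ C c * f₀ ^ (u * j)) → j ∈ Finset.Icc 1 n := by
    intro j hj
    by_contra h0
    refine hj 0 ?_
    rw [hr.supp j h0, zero_pow hv0.ne', C_0, zero_mul]
  have hQd : ∀ j ∈ Finset.Icc 1 n, (Q j).natDegree ≤ m * n := by
    intro j hj
    have hjn := (Finset.mem_Icc.1 hj).2
    refine (natDegree_sub_le _ _).trans (max_le ?_ ?_)
    · refine (natDegree_C_mul_le _ _).trans (natDegree_pow_le.trans ?_)
      exact Nat.mul_le_mul hvm (hr.deg j)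
    · refine (natDegree_C_mul_le _ _).trans (natDegree_pow_le.trans ?_)
      calc u * j * f₀.natDegree = f₀.natDegree * u * j := by ring
        _ ≤ m * n := Nat.mul_le_mul hum hjn
  have hj := hmem j hcj
  have hj' := hmem j' hcj'
  have hne : Q j * Q j' * ((X - C α) * f₀) ≠ 0 :=
    mul_ne_zero (mul_ne_zero (hQ0 j hcj) (hQ0 j' hcj')) (mul_ne_zero (X_sub_C_ne_zero α) hf0)
  -- The degree is at most mn + mn + 1 + 2, which is the source of the bound 2mn + 3.
  obtain ⟨x, hx⟩ := exists_eval_ne_zero hne (by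
    refine natDegree_mul_le.trans_lt ?_
    have h1 := (natDegree_mul_le (p := Q j) (q := Q j'))
    have h2 := (natDegree_mul_le (p := X - C α) (q := f₀))
    have h3 := hQd j hj
    have h4 := hQd j' hj'
    rw [natDegree_X_sub_C] at h2
    have h5 : 2 * m * n = m * n + m * n := by ring
    omega)
  simp only [eval_mul, eval_sub, eval_X, eval_C, mul_ne_zero_iff, sub_ne_zero] at hx
  obtain ⟨⟨hx1, hx2⟩, hxα, hfx⟩ := hx
  -- With t^v = f₀(x)/f₀(α), the product f g agrees at (x, y) and (α, t^u y). A nonzero root y of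
  -- S(y) = H(x, y) - H(α, t^u y) would close a hexagon through x₃ = 0 and y₁ = 0, or a 4-cycle if t
  -- = 1. So S is a monomial, and only one index j can have Q j (x) ≠ 0.
  obtain ⟨t, ht⟩ := pow_Kp_surj hv (f₀.eval x / f₀.eval α)
  set S : F[X] := ∑ j ∈ Finset.Icc 1 n, C ((r j).eval x - (r j).eval α * t ^ (u * j)) * X ^ j
    with hSdef
  have hcoeff : ∀ j ∈ Finset.Icc 1 n, S.coeff j = (r j).eval x - (r j).eval α * t ^ (u * j) := by
    intro j hj
    rw [hSdef, finsetSum_coeff]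
    simp only [coeff_C_mul, coeff_X_pow, mul_ite, mul_one, mul_zero]
    rw [Finset.sum_ite_eq, if_pos hj]
  have hdeg : S.natDegree ≤ n := natDegree_sum_le_of_forall_le _ _ fun j hj =>
    (natDegree_C_mul_X_pow_le _ _).trans (Finset.mem_Icc.1 hj).2
  set ι := algebraMap F K
  have hev : ∀ y : K, aeval y S = rowEval n r (ι x) y - rowEval n r (ι α) (ι t ^ u * y) := by
    intro y
    simp only [hSdef, rowEval, map_sum, map_mul, aeval_C, map_pow, aeval_X, map_sub,
      aeval_algebraMap_eval, ← Finset.sum_sub_distrib, sub_mul, ι]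
    refine Finset.sum_congr rfl fun j _ => ?_
    rw [mul_pow, ← pow_mul, mul_assoc]
  have hα0 : α ≠ 0 := by rintro rfl; exact hα hfz
  have hx0 : x ≠ 0 := by rintro rfl; exact hfx hfz
  have hι : Function.Injective ι := ι.injective
  have hSne : ∀ y : K, y ≠ 0 → aeval y S ≠ 0 := by
    intro y hy h0
    rw [hev] at h0
    by_cases ht1 : t = 1
    · refine hy (h.no4x (x₁ := ι x) (x₂ := ι α) (hι.ne hxα) ?_ (y₁ := y) (y₂ := 0) ?_)
      · rw [ht1, one_pow, eq_comm, div_eq_one_iff_eq hα] at ht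
        simp only [aeval_algebraMap_eval, ι, ht]
      · rw [ht1, map_one, one_pow, one_mul] at h0
        rw [h0, rowEval_zero_right, rowEval_zero_right, sub_zero]
    · have ht0 : t ≠ 0 := by
        rintro rfl
        rw [zero_pow hv0.ne', eq_comm, div_eq_zero_iff] at ht
        exact ht.elim hfx hα
      have hty : ι t ^ u * y ≠ 0 :=
        mul_ne_zero (pow_ne_zero _ ((map_ne_zero ι).2 ht0)) hy
      refine h.no6 (x₁ := ι x) (x₂ := ι α) (x₃ := 0) (y₁ := 0) (y₂ := ι t ^ u * y) (y₃ := y)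
        (hι.ne hxα) ((map_ne_zero ι).2 hα0) ((map_ne_zero ι).2 hx0).symm hty.symm ?_ hy ?_ ?_
      · intro he
        have h1 : ι t ^ u = 1 := mul_right_cancel₀ hy (by rw [he, one_mul])
        rw [← map_pow, map_eq_one_iff ι hι] at h1
        exact ht1 (pow_Kp_inj hu (h1.trans (one_pow u).symm))
      · have h1 : ι t ^ v * ι (f₀.eval α) = ι (f₀.eval x) := by
          rw [← map_pow, ht, ← map_mul, div_mul_cancel₀ _ hα]
        simp only [aeval_algebraMap_eval, ι, aeval_zero_of_eval hfz] at h1 ⊢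
        rw [← h1, zero_pow hv0.ne', zero_pow hu0.ne', mul_pow, mul_pow, ← pow_mul, ← pow_mul,
          mul_comm v u]
        ring
      · simp only [rowEval_zero_right, hr.rowEval_zero_left]
        linear_combination -h0
  obtain ⟨c, k, -, hSk⟩ := hS.monomial hdeg hSne
  have hkey : ∀ j ∈ Finset.Icc 1 n, (Q j).eval x ≠ 0 → j = k := by
    intro j hj hQx
    by_contra hjk
    have h1 := hcoeff j hj
    rw [hSk, coeff_C_mul, coeff_X_pow, if_neg hjk, mul_zero, eq_comm, sub_eq_zero] at h1
    apply hQx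
    have h3 : f₀.eval α ^ (u * j) ≠ 0 := pow_ne_zero _ hα
    have h2 : (t ^ (u * j)) ^ v * f₀.eval α ^ (u * j) = f₀.eval x ^ (u * j) := by
      rw [← pow_mul, mul_comm (u * j) v, pow_mul, ht, div_pow, div_mul_cancel₀ _ h3]
    simp only [hQ, eval_sub, eval_mul, eval_C, eval_pow]
    rw [h1, mul_pow, ← h2]
    ring
  exact hjj ((hkey j hj hx1).trans (hkey j' hj' hx2).symm)

end Rows

end AlgGraph

end

noncomputable section

namespace AlgGraph

/-! ### Excluding two quadratic factors. -/

section TwoQuadratic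

variable {F K : Type*} [Field F] [Field K] [Algebra F K]
variable {n : ℕ} {r : ℕ → F[X]} {p : ℕ} [Fact p.Prime]

theorem translate_rho [CharP K p] {u : ℕ} (hu : u ∈ Kp p) (a c : F) (x : K) :
    aeval (x + algebraMap F K c) (rho a) ^ u - aeval (algebraMap F K c) (rho a) ^ u =
      aeval x (rho (a - 2 * c)) ^ u := by
  rw [← sub_pow_Kp hu]
  congr 1
  simp only [aeval_rho, map_sub, map_mul, map_ofNat]
  ring

theorem Girth8.translate_rho [CharP K p] {u : ℕ} (hu : u ∈ Kp p) {a : F} {g : K → K}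
    (h : Girth8 (fun x : K => aeval x (rho a) ^ u) g (rowEval n r)) (c : F) :
    Girth8 (fun x : K => aeval x (rho (a - 2 * c)) ^ u) g (rowEval n (AlgGraph.trRows c r)) := by
  have := h.trRows c
  simpa only [AlgGraph.translate_rho hu] using this

theorem aeval_rho_reflect (a : F) (x : K) :
    aeval (algebraMap F K a - x) (rho a) = aeval x (rho a) := by
  simp only [aeval_rho]
  ring

variable [CharP F p]

/-- If `f` is symmetric about `a / 2`, all rows but one are symmetric. -/
theorem Girth8.exists_row_reflect [Fintype F] {f g : K → K} (h : Girth8 f g (rowEval n r))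
    (hS : SplitsUpTo F K n) (hr : IsRows n r) (hq : 2 * n < Fintype.card F) {a : F} (ha : a ≠ 0)
    (hf : ∀ x : K, f (algebraMap F K a - x) = f x) :
    ∃ l ∈ Kp p, (1 ≤ l ∧ l ≤ n) ∧ ∀ j ∈ Finset.Icc 1 n, j ≠ l →
      ∀ x : K, aeval (algebraMap F K a - x) (r j) = aeval x (r j) := by
  have hf' : ∀ x : F, f (algebraMap F K x) = f (algebraMap F K (a - x)) := by
    intro x
    rw [map_sub, hf]
  obtain ⟨l, hl, hln, hla, -⟩ := h.exists_row (p := p) hS (x₁ := a) (x₂ := 0) ha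
    (by rw [hf' a, sub_self])
  refine ⟨l, hl, hln, fun j hj hjl => ?_⟩
  -- R j measures the asymmetry of row j. If R l and R j were both nonzero, some x would make both
  -- rows differ between x and a - x, whereas only one row can.
  set R : ℕ → F[X] := fun j => r j - (r j).comp (C a - X) with hR
  have hdeg : ∀ j, (R j).natDegree ≤ n := by
    intro j
    refine (natDegree_sub_le _ _).trans (max_le (hr.deg j) ?_)
    have h1 : (C a - X : F[X]).natDegree ≤ 1 :=
      (natDegree_sub_le _ _).trans (max_le (by simp) natDegree_X_le)
    exact natDegree_comp_le.trans ((Nat.mul_le_mul (hr.deg j) h1).trans_eq (mul_one n))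
  have hRl : R l ≠ 0 := by
    intro h0
    have := congrArg (eval a) h0
    simp [hR, eval_comp] at this
    exact hla (sub_eq_zero.1 this)
  have hRj : R j = 0 := by
    by_contra hRj
    obtain ⟨x, hx⟩ := exists_eval_ne_zero (mul_ne_zero hRl hRj) (by
      have h1 := natDegree_mul_le (p := R l) (q := R j)
      have h2 := hdeg l
      have h3 := hdeg j
      omega)
    simp only [hR, eval_mul, eval_sub, eval_comp, eval_C, eval_X, mul_ne_zero_iff,
      sub_ne_zero] at hx
    have hxa : x ≠ a - x := by
      intro he
      exact hx.1 (by rw [← he])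
    obtain ⟨l', -, -, -, h2⟩ := h.exists_row (p := p) hS hxa (hf' x)
    have e1 : l = l' := by
      by_contra hne
      exact hx.1 (h2 l (Finset.mem_Icc.2 hln) hne)
    have e2 : j = l' := by
      by_contra hne
      exact hx.2 (h2 j hj hne)
    exact hjl (e2.trans e1.symm)
  intro x
  have := congrArg (aeval x) hRj
  simp only [hR, map_sub, map_zero, aeval_comp, aeval_C, aeval_X] at this
  exact (sub_eq_zero.1 this).symm

/-- Only row l is asymmetric, so H(x, y) - H(a - x, y) is a function of x times y^l. Eliminating
that function leaves an identity in values of H alone, which can be combined with its counterpart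
for the other variable. -/
theorem Girth8.reflect_identities [Fintype F] {f g : K → K} (h : Girth8 f g (rowEval n r))
    (hS : SplitsUpTo F K n) (hr : IsRows n r) (hq : 2 * n < Fintype.card F) {a : F} (ha : a ≠ 0)
    (hf : ∀ x : K, f (algebraMap F K a - x) = f x) :
    ∃ l ∈ Kp p, (∃ ζ, ∀ y : K, rowEval n r (algebraMap F K a) y = ζ * y ^ l) ∧
      ∀ x y b : K, (rowEval n r x y - rowEval n r (algebraMap F K a - x) y) * b ^ l =
        (rowEval n r x b - rowEval n r (algebraMap F K a - x) b) * y ^ l := by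
  obtain ⟨l, hl, hln, hsymm⟩ := h.exists_row_reflect (p := p) hS hr hq ha hf
  have key : ∀ x y : K, rowEval n r x y - rowEval n r (algebraMap F K a - x) y =
      (aeval x (r l) - aeval (algebraMap F K a - x) (r l)) * y ^ l := by
    intro x y
    rw [rowEval, rowEval, ← Finset.sum_sub_distrib, Finset.sum_eq_single l]
    · ring
    · intro j hj hjl
      rw [hsymm j hj hjl, sub_self]
    · intro h0
      exact absurd (Finset.mem_Icc.2 hln) h0
  refine ⟨l, hl, ⟨aeval (algebraMap F K a) (r l), fun y => ?_⟩, fun x y b => ?_⟩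
  · have := key (algebraMap F K a) y
    rwa [sub_self, hr.rowEval_zero_left, sub_zero, aeval_zero_of_eval (hr.zero l), sub_zero] at this
  · rw [key, key]; ring

/-- The hexagon on x, a - x, 0 and 0, b - y, y satisfies the f g condition by symmetry, and its H
condition is H(x, y) = H(a - x, b - y). By the two reflection identities this follows from x^k / a^k
+ y^l / b^l = 1, which is solvable for y because l is a power of p. -/
theorem Girth8.not_rho_rho_of_ne_zero [Fintype F] [Finite K] [CharP K p] {f g : K → K}
    (h : Girth8 f g (rowEval n r)) (hS : SplitsUpTo F K n) (hr : IsRows n r)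
    (hq : 2 * n + 3 < Fintype.card F) {a b : F} (ha : a ≠ 0) (hb : b ≠ 0)
    (hf : ∀ x : K, f (algebraMap F K a - x) = f x) (hg : ∀ x : K, g (algebraMap F K b - x) = g x)
    (hf0 : f 0 = 0) (hg0 : g 0 = 0) : False := by
  obtain ⟨l, hl, ⟨ζ, hζ⟩, e1⟩ := h.reflect_identities (p := p) hS hr (by omega) ha hf
  obtain ⟨k, hk, ⟨η, hη⟩, e2⟩ :=
    (h.swapRows hr).reflect_identities (p := p) hS hr.swap (by omega) hb hg
  simp only [hr.rowEval_swap] at hη e2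
  set ι := algebraMap F K
  have hA : ι a ≠ 0 := (map_ne_zero ι).2 ha
  have hB : ι b ≠ 0 := (map_ne_zero ι).2 hb
  have hAk := pow_ne_zero k hA
  have hBl := pow_ne_zero l hB
  -- Avoiding 0, a and the fixed point of x ↦ a - x keeps the points distinct; the equation for y
  -- transfers these exclusions to the lines.
  obtain ⟨x, hx⟩ : ∃ x : F, (X * (X - C a) * (X + X - C a) : F[X]).eval x ≠ 0 := by
    refine exists_eval_ne_zero ?_ ?_
    · refine mul_ne_zero (mul_ne_zero X_ne_zero (X_sub_C_ne_zero a)) ?_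
      intro h0
      have := congrArg (eval 0) h0
      simp at this
      exact ha this
    · have h0 : (X + X - C a : F[X]).natDegree ≤ 1 :=
        (natDegree_sub_le _ _).trans (max_le ((natDegree_add_le _ _).trans (by simp)) (by simp))
      have h1 := natDegree_mul_le (p := (X * (X - C a) : F[X])) (q := X + X - C a)
      have h2 := natDegree_mul_le (p := (X : F[X])) (q := X - C a)
      rw [natDegree_X, natDegree_X_sub_C] at h2
      omega
  simp only [eval_mul, eval_sub, eval_add, eval_X, eval_C, mul_ne_zero_iff, sub_ne_zero] at hx
  obtain ⟨⟨hx0, hxa⟩, hxx⟩ := hx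
  have hX0 : ι x ≠ 0 := (map_ne_zero ι).2 hx0
  have hXA : ι x ≠ ι a := ι.injective.ne hxa
  have hXX : ι x + ι x ≠ ι a := by rw [← map_add]; exact ι.injective.ne hxx
  generalize ι x = x at hX0 hXA hXX
  obtain ⟨y, hy⟩ := pow_Kp_surj hl (ι b ^ l * (1 - x ^ k / ι a ^ k))
  have hy' : y ^ l * ι a ^ k = ι b ^ l * (ι a ^ k - x ^ k) := by
    rw [hy]; field_simp
  have hl0 := (Kp_pos hl).ne'
  have hk0 := (Kp_pos hk).ne'
  have hy0 : y ≠ 0 := by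
    rintro rfl
    rw [zero_pow hl0, zero_mul, eq_comm, mul_eq_zero, sub_eq_zero] at hy'
    exact hXA (pow_Kp_inj hk (hy'.resolve_left hBl)).symm
  have hyb : y ≠ ι b := by
    rintro rfl
    have := mul_left_cancel₀ hBl hy'
    have h0 : x ^ k = 0 := by linear_combination this
    exact hX0 (eq_zero_of_pow_eq_zero h0)
  have hyy : y + y ≠ ι b := by
    intro he
    have h1 : y ^ l + y ^ l = ι b ^ l := by rw [← add_pow_Kp hl, he]
    have h2 : ι b ^ l * ι a ^ k = ι b ^ l * (ι a ^ k - x ^ k + (ι a ^ k - x ^ k)) := by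
      rw [← h1]
      linear_combination 2 * hy' - 2 * (ι a ^ k - x ^ k) * h1
    have h3 := mul_left_cancel₀ hBl h2
    have h4 : (x + x) ^ k = ι a ^ k := by
      rw [add_pow_Kp hk]
      linear_combination h3
    exact hXX (pow_Kp_inj hk h4)
  have hsum : rowEval n r x y = rowEval n r (ι a - x) (ι b - y) := by
    have h1 := e1 x y (ι b)
    rw [hη, hη, sub_pow_Kp hk] at h1
    have h2 := e2 y (ι a - x) (ι a)
    rw [hζ, hζ, sub_pow_Kp hl, sub_pow_Kp hk] at h2
    have h3 : ζ * ι b ^ l = η * ι a ^ k := by rw [← hζ, ← hη]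
    have h4 : (rowEval n r x y - rowEval n r (ι a - x) (ι b - y)) * (ι a ^ k * ι b ^ l) = 0 := by
      linear_combination ι a ^ k * h1 + ι b ^ l * h2 + ι a ^ k * η * hy' +
        (2 * y ^ l - ι b ^ l) * (ι a ^ k - x ^ k) * h3
    exact sub_eq_zero.1 ((mul_eq_zero.1 h4).resolve_right (mul_ne_zero hAk hBl))
  refine h.no6 (x₁ := x) (x₂ := ι a - x) (x₃ := 0) (y₁ := 0) (y₂ := ι b - y) (y₃ := y)
    (fun h => hXX (by linear_combination h)) (sub_ne_zero.2 hXA.symm) hX0.symm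
    (sub_ne_zero.2 hyb.symm).symm (fun h => hyy (by linear_combination -h)) hy0 ?_ ?_
  · rw [hf, hg, hf0, hg0]; ring
  · rw [hsum, rowEval_zero_right, rowEval_zero_right, hr.rowEval_zero_left, hr.rowEval_zero_left]
    ring

/-- The two factors cannot both be of the form `ρ_a ^ u`. -/
theorem Girth8.not_rho_rho [Fintype F] [Finite K] [CharP K p] {a b : F} {u v : ℕ}
    (hu : u ∈ Kp p) (hv : v ∈ Kp p)
    (h : Girth8 (fun x : K => aeval x (rho a) ^ u) (fun y => aeval y (rho b) ^ v) (rowEval n r))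
    (hS : SplitsUpTo F K n) (hr : IsRows n r) (hq : 2 * n + 3 < Fintype.card F)
    (ha : (2 : F) ≠ 0 ∨ a ≠ 0) (hb : (2 : F) ≠ 0 ∨ b ≠ 0) : False := by
  -- Translation by c replaces a by a - 2c, so a can be made nonzero: if a = 0, then 2 ≠ 0 and c = 1
  -- works.
  have hc : ∀ a : F, ((2 : F) ≠ 0 ∨ a ≠ 0) → ∃ c, a - 2 * c ≠ 0 := by
    intro a ha
    by_cases h0 : a = 0
    · refine ⟨1, ?_⟩
      subst h0
      simpa using ha
    · exact ⟨0, by simpa using h0⟩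
  obtain ⟨c, hc1⟩ := hc a ha
  obtain ⟨d, hd1⟩ := hc b hb
  have h1 := ((h.translate_rho hu c).swapRows (hr.translate c)).translate_rho hv d
  have hu0 := (Kp_pos hu).ne'
  have hv0 := (Kp_pos hv).ne'
  exact h1.not_rho_rho_of_ne_zero (p := p) hS ((hr.translate c).swap.translate d) hq hd1 hc1
    (fun x => by simp only [aeval_rho_reflect]) (fun x => by simp only [aeval_rho_reflect])
    (by simp [aeval_rho, hv0]) (by simp [aeval_rho, hu0])

end TwoQuadratic

end AlgGraph

end

noncomputable section

namespace AlgGraph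

/-! ### The coefficient off the line, compared across translates. -/

section OffDiagonal

variable {F : Type*} [Field F] {p : ℕ} [Fact p.Prime] [CharP F p]

/-- The pair `(k, l)` is the only index of a nonzero entry of `c` off the line `v i = u j`. -/
def OffDiag (u v : ℕ) (c : ℕ → ℕ → F) (k l : ℕ) : Prop :=
  c k l ≠ 0 ∧ v * k ≠ u * l ∧ ∀ i j, c i j ≠ 0 → v * i ≠ u * j → i = k ∧ j = l

theorem OffDiag.swap {u v : ℕ} {c : ℕ → ℕ → F} {k l : ℕ} (h : OffDiag u v c k l) :
    OffDiag v u (fun i j => c j i) l k :=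
  ⟨h.1, h.2.1.symm, fun i j hc hij => (h.2.2 j i hc hij.symm).symm⟩

/-- Here c₁ and c₂ are the coefficients after translating x or y by 1. The hypothesis u l < v k
keeps the entry at (k, l) nonzero in both translates: competing entries on the line have i < k in
column sums, or j > l with j a power of p in row sums, so their binomial coefficients vanish. Thus
(k, l) is the off-line position of all three arrays, and every binomial term landing at another
off-line position must vanish. -/
theorem OffDiag.of_translates {u v n : ℕ} (hu : u ∈ Kp p) (hv : v ∈ Kp p) {c c₁ c₂ : ℕ → ℕ → F}
    {k l k₁ l₁ k₂ l₂ : ℕ} (h : OffDiag u v c k l) (h₁ : OffDiag u v c₁ k₁ l₁)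
    (h₂ : OffDiag u v c₂ k₂ l₂)
    (hc : ∀ i j, c i j ≠ 0 → i ∈ Finset.Icc 1 n ∧ j ∈ Finset.Icc 1 n)
    (hc₁ : ∀ a j, 0 < a → c₁ a j = ∑ i ∈ Finset.Icc 1 n, (i.choose a : F) * c i j)
    (hc₂ : ∀ i b, 0 < b → c₂ i b = ∑ j ∈ Finset.Icc 1 n, (j.choose b : F) * c i j)
    (hkl : u * l < v * k) :
    l ∈ Kp p ∧ (∀ i j, c i j ≠ 0 → v * i = u * j → i ∈ Kp p ∧ j ∈ Kp p) ∧
      ∀ a, 0 < a → a < k → v * a ≠ u * l → ((k.choose a : ℕ) : F) = 0 := by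
  have hu0 := Kp_pos hu
  have hv0 := Kp_pos hv
  obtain ⟨hkl0, -, huniq⟩ := h
  obtain ⟨hkn, hln⟩ := hc k l hkl0
  have hk0 : 0 < k := (Finset.mem_Icc.1 hkn).1
  have hl0 : 0 < l := (Finset.mem_Icc.1 hln).1
  have hrow : ∀ i, i ≠ k → c i l ≠ 0 → v * i = u * l := by
    intro i hi hil
    by_contra hne
    exact hi (huniq i l hil hne).1
  have hcol : ∀ j, j ≠ l → c k j ≠ 0 → v * k = u * j := by
    intro j hj hkj
    by_contra hne
    exact hj (huniq k j hkj hne).2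
  have e1 : c₁ k l ≠ 0 := by
    rw [hc₁ k l hk0, Finset.sum_eq_single_of_mem k hkn]
    · simpa using hkl0
    · intro i _ hik
      by_cases h0 : c i l = 0
      · rw [h0, mul_zero]
      · have h1 := hrow i hik h0
        rw [Nat.choose_eq_zero_of_lt (by nlinarith), Nat.cast_zero, zero_mul]
  have hone : ∀ a j, c₁ a j ≠ 0 → v * a ≠ u * j → a = k ∧ j = l := by
    obtain ⟨rfl, rfl⟩ := h₁.2.2 k l e1 (by omega)
    exact h₁.2.2
  have hdiag : ∀ i j, j ≠ l → c i j ≠ 0 → i ∈ Kp p ∧ j ∈ Kp p := by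
    intro i j hj hij
    have hd : ∀ i', c i' j ≠ 0 → v * i' = u * j := by
      intro i' h0
      by_contra hne
      exact hj (huniq i' j h0 hne).2
    obtain ⟨hin, hjn⟩ := hc i j hij
    have hi0 : 0 < i := (Finset.mem_Icc.1 hin).1
    have hi : i ∈ Kp p := by
      refine Kp_of_choose (R := F) hi0.ne' fun a ha hai => ?_
      by_contra hch
      have h1 : c₁ a j ≠ 0 := by
        rw [hc₁ a j ha, Finset.sum_eq_single_of_mem i hin]
        · exact mul_ne_zero hch hij
        · intro i' _ hne
          by_cases h0 : c i' j = 0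
          · rw [h0, mul_zero]
          · exact absurd (Nat.eq_of_mul_eq_mul_left hv0 ((hd i' h0).trans (hd i hij).symm)) hne
      have := (hone a j h1 (by
        rw [← hd i hij]
        exact (Nat.mul_lt_mul_of_pos_left hai hv0).ne)).2
      exact hj this
    exact ⟨hi, Kp_of_dvd (Kp_mul hv hi) (hd i hij ▸ dvd_mul_left j u)⟩
  have hcolj : ∀ j, j ≠ l → c k j ≠ 0 → j ∈ Kp p ∧ l < j := by
    intro j hj hkj
    have h1 := hcol j hj hkj
    exact ⟨(hdiag k j hj hkj).2, by nlinarith⟩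
  have e2 : c₂ k l ≠ 0 := by
    rw [hc₂ k l hl0, Finset.sum_eq_single_of_mem l hln]
    · simpa using hkl0
    · intro j _ hjl
      by_cases h0 : c k j = 0
      · rw [h0, mul_zero]
      · obtain ⟨h1, h2⟩ := hcolj j hjl h0
        rw [choose_Kp h1 hl0 h2, zero_mul]
  have htwo : ∀ a j, c₂ a j ≠ 0 → v * a ≠ u * j → a = k ∧ j = l := by
    obtain ⟨rfl, rfl⟩ := h₂.2.2 k l e2 (by omega)
    exact h₂.2.2
  have hl : l ∈ Kp p := by
    refine Kp_of_choose (R := F) hl0.ne' fun b hb hbl => ?_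
    by_contra hch
    have h1 : c₂ k b ≠ 0 := by
      rw [hc₂ k b hb, Finset.sum_eq_single_of_mem l hln]
      · exact mul_ne_zero hch hkl0
      · intro j _ hjl
        by_cases h0 : c k j = 0
        · rw [h0, mul_zero]
        · obtain ⟨h1, h2⟩ := hcolj j hjl h0
          rw [choose_Kp h1 hb (hbl.trans h2), zero_mul]
    have := (htwo k b h1 (by nlinarith)).2
    omega
  refine ⟨hl, fun i j hij hd => ?_, fun a ha hak hal => ?_⟩
  · by_cases hj : j = l
    · subst hj
      exact ⟨Kp_of_dvd (Kp_mul hu hl) (hd ▸ dvd_mul_left i v), hl⟩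
    · exact hdiag i j hj hij
  · by_contra hch
    have h1 : c₁ a l ≠ 0 := by
      rw [hc₁ a l ha, Finset.sum_eq_single_of_mem k hkn]
      · exact mul_ne_zero hch hkl0
      · intro i _ hik
        by_cases h0 : c i l = 0
        · rw [h0, mul_zero]
        · have h2 := hrow i hik h0
          have h3 : i ∈ Kp p := Kp_of_dvd (Kp_mul hu hl) (h2 ▸ dvd_mul_left i v)
          rcases lt_trichotomy a i with h4 | rfl | h4
          · rw [choose_Kp h3 ha h4, zero_mul]
          · exact absurd h2 hal
          · rw [Nat.choose_eq_zero_of_lt h4, Nat.cast_zero, zero_mul]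
    have := (hone a l h1 hal).1
    omega

/-- If v divides u l, then k = l' + e' is a sum of two powers of p; were they distinct, the binomial
coefficient at e' would be 1, against the hypothesis. Otherwise the exception v a = u l never
occurs, so k is a power of p, and v k, u l and their difference e all are; then v k = 2 u l. -/
theorem exponent_eq {u v k l e : ℕ} (hu : u ∈ Kp p) (hv : v ∈ Kp p) (hl : l ∈ Kp p) (hk : k ≠ 0)
    (he : e ∈ Kp p) (hkl : v * k = u * l + e)
    (h : ∀ a, 0 < a → a < k → v * a ≠ u * l → ((k.choose a : ℕ) : F) = 0) :
    v * k = 2 * (u * l) := by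
  have hul := Kp_mul hu hl
  have hv0 := Kp_pos hv
  by_cases hdvd : v ∣ u * l
  · obtain ⟨l', hl'⟩ := hdvd
    have hl'K : l' ∈ Kp p := Kp_of_dvd hul (hl' ▸ dvd_mul_left l' v)
    obtain ⟨e', rfl⟩ : v ∣ e := (Nat.dvd_add_right (hl' ▸ dvd_mul_right v l')).1 (hkl ▸ dvd_mul_right v k)
    have he' : e' ∈ Kp p := Kp_of_dvd he (dvd_mul_left e' v)
    have hk' : k = l' + e' := Nat.eq_of_mul_eq_mul_left hv0 (by rw [hkl, hl']; ring)
    by_cases hle : l' = e'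
    · subst hle
      rw [hkl, hl']; ring
    · have h1 := h e' (Kp_pos he') (by have := Kp_pos hl'K; omega) (by
        rw [hl']
        exact fun h2 => hle (Nat.eq_of_mul_eq_mul_left hv0 h2).symm)
      rw [hk', choose_add_Kp hl'K he' hle] at h1
      exact absurd h1 one_ne_zero
  · have hkK : k ∈ Kp p := Kp_of_choose (R := F) hk fun a ha hak =>
      h a ha hak fun h2 => hdvd (h2 ▸ dvd_mul_right v a)
    exact Kp_sub (Kp_mul hv hkK) hul he hkl

end OffDiagonal

/-! ### Both factors are Frobenius powers. -/

section MonomialCase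

variable {F K : Type*} [Field F] [Field K] [Algebra F K]
variable {n : ℕ} {r : ℕ → F[X]} {p : ℕ} [Fact p.Prime]

theorem IsRows.coeff_trRows_one (hr : IsRows n r) (j : ℕ) {a : ℕ} (ha : 0 < a) :
    (trRows 1 r j).coeff a = ∑ i ∈ Finset.Icc 1 n, (i.choose a : F) * (r j).coeff i := by
  rw [trRows, coeff_sub, coeff_C, if_neg ha.ne', sub_zero, ← taylor_apply, taylor_coeff,
    hasseDeriv_apply, sum_over_range' _ _ (n + 1) (Nat.lt_succ_of_le (hr.deg j)), eval_finsetSum,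
    Finset.range_eq_Ico, Finset.sum_eq_sum_Ico_succ_bot (Nat.succ_pos n), hr.coeff_zero]
  · simp
    rfl
  · simp

/-- P divides a power of X, so it is a monomial, and degrees can be compared. -/
theorem coeff_ne_zero_of_pow_eq {P : F[X]} {u v j : ℕ} {c : F} (hv : v ≠ 0)
    (h : P ^ v = C c * X ^ (u * j)) {i : ℕ} (hi : P.coeff i ≠ 0) : v * i = u * j := by
  have hP : P ≠ 0 := by rintro rfl; simp at hi
  have hc : c ≠ 0 := by
    rintro rfl
    rw [C_0, zero_mul] at h
    exact hP (eq_zero_of_pow_eq_zero h)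
  have hdvd : P ∣ X ^ (u * j) := by
    refine (dvd_pow_self P hv).trans ?_
    rw [h]
    exact ⟨C c⁻¹, by rw [mul_right_comm, ← C_mul, mul_inv_cancel₀ hc, C_1, one_mul]⟩
  obtain ⟨k, -, hk⟩ := (dvd_prime_pow prime_X _).1 hdvd
  obtain ⟨w, hw⟩ := hk.symm
  obtain ⟨d, hd, hdw⟩ := isUnit_iff.1 w.isUnit
  rw [← hdw] at hw
  have hik : i = k := by
    by_contra hne
    rw [← hw, coeff_mul_C, coeff_X_pow, if_neg hne, zero_mul] at hi
    exact hi rfl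
  have h1 := congrArg natDegree h
  rw [natDegree_C_mul_X_pow _ _ hc, natDegree_pow, ← hw, natDegree_mul_C hd.ne_zero,
    natDegree_X_pow] at h1
  rw [hik, h1]

variable [CharP F p] [Fintype F]

/-- `Girth8.row_pow_eq` in both variables confines the off-line coefficients to one row and one
column. The hexagon on 1, z^v, 0 and 0, 1, z^u closes when H(z^v, 1) = H(1, z^u). On-line
coefficients cancel there, so an off-line one exists and z^(vk) ≠ z^(ul) for z ≠ 0, 1; hence |vk -
ul| is a power of p. -/
theorem Girth8.exists_offDiag [CharP K p] {m u v : ℕ}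
    (h : Girth8 (fun x : K => x ^ u) (fun y => y ^ v) (rowEval n r))
    (hq : 2 * m * n + 3 < Fintype.card F) (hm : 0 < m) (hS : SplitsUpTo F K (m * n))
    (hr : IsRows n r) (hu : u ∈ Kp p) (hv : v ∈ Kp p) (hum : u ≤ m) (hvm : v ≤ m) :
    ∃ k l, OffDiag u v (fun i j => (r j).coeff i) k l ∧
      ∃ e ∈ Kp p, v * k = u * l + e ∨ u * l = v * k + e := by
  have hu0 := Kp_pos hu
  have hv0 := Kp_pos hv
  have hS' : SplitsUpTo F K n := hS.mono (Nat.le_mul_of_pos_left n hm)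
  have hrow : ∀ {i j i' j'}, (r j).coeff i ≠ 0 → v * i ≠ u * j → (r j').coeff i' ≠ 0 →
      v * i' ≠ u * j' → j = j' := by
    intro i j i' j' h1 h2 h3 h4
    by_contra hjj
    rcases Girth8.row_pow_eq (f₀ := X) (m := m) (by simpa using h) hq hS' hr (by simp) X_ne_zero
      (by simp) hu hv (by simpa using hum) hvm hjj with ⟨c, hc⟩ | ⟨c, hc⟩
    · exact h2 (coeff_ne_zero_of_pow_eq hv0.ne' hc h1)
    · exact h4 (coeff_ne_zero_of_pow_eq hv0.ne' hc h3)
  have hcol : ∀ {i j i' j'}, (r j).coeff i ≠ 0 → v * i ≠ u * j → (r j').coeff i' ≠ 0 →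
      v * i' ≠ u * j' → i = i' := by
    intro i j i' j' h1 h2 h3 h4
    by_contra hii
    rcases Girth8.row_pow_eq (f₀ := X) (m := m) (by simpa using h.swapRows hr) hq hS' hr.swap
      (by simp) X_ne_zero (by simp) hv hu (by simpa using hvm) hum hii with ⟨c, hc⟩ | ⟨c, hc⟩
    · exact h2 (coeff_ne_zero_of_pow_eq (i := j) hu0.ne' hc (by rwa [hr.coeff_swapRows])).symm
    · exact h4 (coeff_ne_zero_of_pow_eq (i := j') hu0.ne' hc (by rwa [hr.coeff_swapRows])).symm
  set ι := algebraMap F K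
  have hdiff : ∀ z : K, rowEval n r (z ^ v) 1 - rowEval n r 1 (z ^ u) =
      ∑ j ∈ Finset.Icc 1 n, ∑ i ∈ Finset.Icc 1 n,
        ι ((r j).coeff i) * (z ^ (v * i) - z ^ (u * j)) := by
    intro z
    simp only [rowEval, hr.aeval_eq_sum, Finset.sum_mul, ← Finset.sum_sub_distrib]
    refine Finset.sum_congr rfl fun j _ => Finset.sum_congr rfl fun i _ => ?_
    rw [← pow_mul, ← pow_mul]
    ring
  have hne : ∀ z : K, z ≠ 0 → z ≠ 1 → rowEval n r (z ^ v) 1 - rowEval n r 1 (z ^ u) ≠ 0 := by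
    intro z hz0 hz1 h0
    have hzu : z ^ u ≠ 1 := fun h1 => hz1 (pow_Kp_inj hu (h1.trans (one_pow u).symm))
    have hzv : z ^ v ≠ 1 := fun h1 => hz1 (pow_Kp_inj hv (h1.trans (one_pow v).symm))
    refine h.no6 (x₁ := 1) (x₂ := z ^ v) (x₃ := 0) (y₁ := 0) (y₂ := 1) (y₃ := z ^ u)
      hzv.symm (pow_ne_zero _ hz0) zero_ne_one zero_ne_one hzu.symm (pow_ne_zero _ hz0) ?_ ?_
    · simp only [zero_pow hu0.ne', zero_pow hv0.ne', one_pow, ← pow_mul, mul_comm v u]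
      ring
    · simp only [rowEval_zero_right, hr.rowEval_zero_left]
      linear_combination h0
  obtain ⟨z, hz⟩ : ∃ z : F, (X * (X - C 1) : F[X]).eval z ≠ 0 := by
    refine exists_eval_ne_zero (mul_ne_zero X_ne_zero (X_sub_C_ne_zero 1)) ?_
    have h2 := natDegree_mul_le (p := (X : F[X])) (q := X - C 1)
    rw [natDegree_X, natDegree_X_sub_C] at h2
    omega
  simp only [eval_mul, eval_sub, eval_X, eval_C, mul_ne_zero_iff, sub_ne_zero] at hz
  obtain ⟨k, l, hkl, hvu⟩ : ∃ k l, (r l).coeff k ≠ 0 ∧ v * k ≠ u * l := by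
    by_contra hcon
    push Not at hcon
    refine hne (ι z) ((map_ne_zero ι).2 hz.1) (fun h1 => hz.2 (ι.injective (h1.trans (map_one ι).symm))) ?_
    rw [hdiff]
    refine Finset.sum_eq_zero fun j _ => Finset.sum_eq_zero fun i _ => ?_
    by_cases h0 : (r j).coeff i = 0
    · rw [h0, map_zero, zero_mul]
    · rw [hcon i j h0, sub_self, mul_zero]
  have huniq : ∀ i j, (r j).coeff i ≠ 0 → v * i ≠ u * j → i = k ∧ j = l := fun i j h1 h2 =>
    ⟨hcol h1 h2 hkl hvu, hrow h1 h2 hkl hvu⟩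
  refine ⟨k, l, ⟨hkl, hvu, huniq⟩, ?_⟩
  have hkn : k ∈ Finset.Icc 1 n := by
    by_contra h0
    exact hkl (hr.coeff_eq_zero l h0)
  have hln : l ∈ Finset.Icc 1 n := by
    by_contra h0
    rw [hr.supp l h0] at hkl
    exact hkl (Polynomial.coeff_zero k)
  have hpow : ∀ z : K, z ≠ 0 → z ≠ 1 → z ^ (v * k) ≠ z ^ (u * l) := by
    intro z hz0 hz1 he
    refine hne z hz0 hz1 ?_
    rw [hdiff]
    refine Finset.sum_eq_zero fun j _ => Finset.sum_eq_zero fun i _ => ?_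
    by_cases h0 : (r j).coeff i = 0
    · rw [h0, map_zero, zero_mul]
    · by_cases h1 : v * i = u * j
      · rw [h1, sub_self, mul_zero]
      · obtain ⟨rfl, rfl⟩ := huniq i j h0 h1
        rw [he, sub_self, mul_zero]
  have hvk : v * k ≤ m * n := Nat.mul_le_mul hvm (Finset.mem_Icc.1 hkn).2
  have hul : u * l ≤ m * n := Nat.mul_le_mul hum (Finset.mem_Icc.1 hln).2
  have hKp : ∀ s t e, s = t + e → s ≤ m * n → e ≠ 0 →
      (∀ z : K, z ≠ 0 → z ≠ 1 → z ^ s ≠ z ^ t) → e ∈ Kp p := by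
    intro s t e hst hs he hz
    refine hS.mem_Kp he (by omega) fun z hz0 hz1 => ?_
    by_contra h1
    exact hz z hz0 h1 (by rw [hst, pow_add, hz1, mul_one])
  rcases lt_or_gt_of_ne hvu with hlt | hlt
  · exact ⟨u * l - v * k, hKp (u * l) (v * k) _ (by omega) hul (by omega)
      (fun z h0 h1 => (hpow z h0 h1).symm), Or.inr (by omega)⟩
  · exact ⟨v * k - u * l, hKp (v * k) (u * l) _ (by omega) hvk (by omega)
      (fun z h0 h1 => hpow z h0 h1), Or.inl (by omega)⟩

/-- The classification of `h` when both factors are powers of the Frobenius. -/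
theorem Girth8.monomial_case [CharP K p] {m u v : ℕ}
    (h : Girth8 (fun x : K => x ^ u) (fun y => y ^ v) (rowEval n r))
    (hq : 2 * m * n + 3 < Fintype.card F) (hm : 0 < m) (hS : SplitsUpTo F K (m * n))
    (hr : IsRows n r) (hu : u ∈ Kp p) (hv : v ∈ Kp p) (hum : u ≤ m) (hvm : v ≤ m) :
    ∃ k l, OffDiag u v (fun i j => (r j).coeff i) k l ∧
      ((l ∈ Kp p ∧ v * k = 2 * (u * l)) ∨ (k ∈ Kp p ∧ u * l = 2 * (v * k))) ∧
      ∀ i j, (r j).coeff i ≠ 0 → v * i = u * j → i ∈ Kp p ∧ j ∈ Kp p := by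
  obtain ⟨k, l, hoff, e, he, hkl⟩ := h.exists_offDiag hq hm hS hr hu hv hum hvm
  -- Frobenius powers are additive, so translation by 1 preserves both factors and the preceding
  -- analysis applies to the translated h.
  have htr : ∀ {w : ℕ}, w ∈ Kp p → ∀ x : K,
      (x + algebraMap F K 1) ^ w - algebraMap F K 1 ^ w = x ^ w := by
    intro w hw x
    rw [map_one, add_pow_Kp hw, add_sub_cancel_right]
  have hg₁ := h.trRows (1 : F)
  simp only [htr hu] at hg₁
  have hg₂ := (h.swapRows hr).trRows (1 : F)
  simp only [htr hv] at hg₂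
  obtain ⟨k₁, l₁, hoff₁, -⟩ := hg₁.exists_offDiag hq hm hS (hr.translate 1) hu hv hum hvm
  obtain ⟨l₂, k₂, hoff₂, -⟩ := hg₂.exists_offDiag hq hm hS (hr.swap.translate 1) hv hu hvm hum
  have hsupp : ∀ i j, (r j).coeff i ≠ 0 → i ∈ Finset.Icc 1 n ∧ j ∈ Finset.Icc 1 n := by
    intro i j hij
    constructor
    · by_contra h0
      exact hij (hr.coeff_eq_zero j h0)
    · by_contra h0
      rw [hr.supp j h0] at hij
      exact hij (Polynomial.coeff_zero i)
  obtain ⟨hkn, hln⟩ := hsupp k l hoff.1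
  refine ⟨k, l, hoff, ?_⟩
  rcases hkl with hkl | hkl
  · obtain ⟨h1, h2, h3⟩ := OffDiag.of_translates (n := n) hu hv hoff hoff₁ hoff₂.swap hsupp
      (fun a j ha => hr.coeff_trRows_one j ha)
      (fun i b hb => by
        simp only [hr.swap.coeff_trRows_one i hb, hr.coeff_swapRows])
      (by have := Kp_pos he; omega)
    exact ⟨Or.inl ⟨h1, exponent_eq hu hv h1 (by have := Finset.mem_Icc.1 hkn; omega) he hkl h3⟩, h2⟩
  · obtain ⟨h1, h2, h3⟩ := OffDiag.of_translates (n := n) hv hu hoff.swap hoff₂ hoff₁.swap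
      (fun i j hij => (hsupp j i hij).symm)
      (fun i b hb => by
        simp only [hr.swap.coeff_trRows_one _ hb, hr.coeff_swapRows])
      (fun a j ha => hr.coeff_trRows_one _ ha)
      (by have := Kp_pos he; omega)
    exact ⟨Or.inr ⟨h1, exponent_eq hv hu h1 (by have := Finset.mem_Icc.1 hln; omega) he hkl h3⟩,
      fun i j h4 h5 => (h2 j i h4 h5.symm).symm⟩

end MonomialCase

end AlgGraph

end

noncomputable section

namespace AlgGraph

/-! ### Pencils of polynomials with prescribed zeros. -/

section Pencil

variable {F K : Type*} [Field F] [Field K] [Algebra F K]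

/-- The member of the pencil spanned by `A` and `B` that vanishes at `e`. -/
def pencil (A B : F[X]) (e : F) : F[X] := C (B.eval e) * A - C (A.eval e) * B

variable {A B : F[X]}

theorem eval_pencil (e x : F) :
    (pencil A B e).eval x = B.eval e * A.eval x - A.eval e * B.eval x := by
  simp [pencil]

theorem pencil_relation (e e₁ e₂ : F) :
    C ((pencil A B e₁).eval e₂) * pencil A B e =
      C ((pencil A B e).eval e₂) * pencil A B e₁ + C ((pencil A B e₁).eval e) * pencil A B e₂ := by
  simp only [eval_pencil]
  simp only [pencil, C_sub, C_mul]
  ring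

theorem pencil_left (e₁ e₂ : F) : C ((pencil A B e₁).eval e₂) * A =
    C (A.eval e₂) * pencil A B e₁ - C (A.eval e₁) * pencil A B e₂ := by
  simp only [eval_pencil]
  simp only [pencil, C_sub, C_mul]
  ring

theorem pencil_right (e₁ e₂ : F) : C ((pencil A B e₁).eval e₂) * B =
    C (B.eval e₂) * pencil A B e₁ - C (B.eval e₁) * pencil A B e₂ := by
  simp only [eval_pencil]
  simp only [pencil, C_sub, C_mul]
  ring

/-- A coefficient vanishing at two members of the pencil vanishes at all members. -/
theorem coeff_pencil_eq_zero {e₁ e₂ : F} (h : (pencil A B e₁).eval e₂ ≠ 0) {k : ℕ}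
    (h₁ : (pencil A B e₁).coeff k = 0) (h₂ : (pencil A B e₂).coeff k = 0) (e : F) :
    (pencil A B e).coeff k = 0 := by
  have := congrArg (fun P => coeff P k) (pencil_relation (A := A) (B := B) e e₁ e₂)
  simp only [coeff_C_mul, coeff_add, h₁, h₂, mul_zero, add_zero] at this
  exact (mul_eq_zero.1 this).resolve_left h

/-- The coefficients of X^J, X^(J-1) and X^0 show that k (1, t, t^J) is a combination of (1, t₁,
t₁^J) and (1, t₂, t₂^J); J ≠ 0 in F is needed to use the middle one. The conclusion is the
collinearity of (t, t^J) with the two other points. -/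
theorem affine_of_relation {J : ℕ} (hJ : 2 ≤ J) (hJ0 : (J : F) ≠ 0) {k k₁ k₂ t t₁ t₂ : F}
    (hk : k ≠ 0)
    (h : C k * (X - C t) ^ J = C k₁ * (X - C t₁) ^ J + C k₂ * (X - C t₂) ^ J) :
    (t₁ - t₂) * t ^ J = (t - t₂) * t₁ ^ J + (t₁ - t) * t₂ ^ J := by
  have hco : ∀ i, k * ((-t) ^ (J - i) * (J.choose i : F)) =
      k₁ * ((-t₁) ^ (J - i) * (J.choose i : F)) + k₂ * ((-t₂) ^ (J - i) * (J.choose i : F)) := by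
    intro i
    have := congrArg (fun P => coeff P i) h
    simpa only [coeff_C_mul, coeff_add, sub_eq_add_neg, ← C_neg, coeff_X_add_C_pow] using this
  have h0 := hco J
  have h1 := hco (J - 1)
  have h2 := hco 0
  simp only [Nat.choose_self, Nat.sub_self, pow_zero, Nat.cast_one, mul_one] at h0
  rw [show J - (J - 1) = 1 by omega, Nat.choose_symm (by omega : 1 ≤ J), Nat.choose_one_right] at h1
  simp only [Nat.sub_zero, Nat.choose_zero_right, Nat.cast_one, mul_one, neg_pow t, neg_pow t₁,
    neg_pow t₂, pow_one] at h1 h2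
  have h1' : k * t = k₁ * t₁ + k₂ * t₂ := mul_right_cancel₀ hJ0 (by linear_combination -h1)
  have hs : ((-1 : F)) ^ J ≠ 0 := pow_ne_zero _ (by simp)
  have h2' : k * t ^ J = k₁ * t₁ ^ J + k₂ * t₂ ^ J :=
    mul_right_cancel₀ hs (by linear_combination h2)
  apply mul_left_cancel₀ hk
  linear_combination (t₁ - t₂) * h2' + (t₁ ^ J * t₂ - t₂ ^ J * t₁) * h0 -
    (t₁ ^ J - t₂ ^ J) * h1'

variable {p : ℕ} [Fact p.Prime] [CharP F p] [Fintype F]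

theorem exists_avoid {G : F[X]} (hG : G ≠ 0) {d : ℕ} (hd : G.natDegree ≤ d)
    (hq : d + 4 < Fintype.card F) (a b c : F) :
    ∃ e, G.eval e ≠ 0 ∧ e ≠ 0 ∧ e ≠ a ∧ e ≠ b ∧ e ≠ c := by
  obtain ⟨e, he⟩ := exists_eval_ne_zero (P := G * (X * ((X - C a) * ((X - C b) * (X - C c)))))
    (mul_ne_zero hG (mul_ne_zero X_ne_zero (mul_ne_zero (X_sub_C_ne_zero a)
      (mul_ne_zero (X_sub_C_ne_zero b) (X_sub_C_ne_zero c))))) (by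
      have h1 := natDegree_mul_le (p := G) (q := X * ((X - C a) * ((X - C b) * (X - C c))))
      have h2 := natDegree_mul_le (p := X) (q := ((X - C a) * ((X - C b) * (X - C c))))
      have h3 := natDegree_mul_le (p := X - C a) (q := ((X - C b) * (X - C c)))
      have h4 := natDegree_mul_le (p := X - C b) (q := X - C c)
      rw [natDegree_X] at h2
      rw [natDegree_X_sub_C] at h3
      rw [natDegree_X_sub_C, natDegree_X_sub_C] at h4
      omega)
  simp only [eval_mul, eval_sub, eval_X, eval_C, mul_ne_zero_iff, sub_ne_zero] at he
  exact ⟨e, he⟩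

/-- A pencil all of whose members vanish at `0` and one further point only. -/
theorem pencil_eq {N w : ℕ} (hS : SplitsUpTo F K N) (hq : N + 4 < Fintype.card F)
    (hw : w ∈ Kp p) {a : F} (ha : a ≠ 0) (hA : A = rho a ^ w) (hAd : A.natDegree ≤ N)
    (hBd : B.natDegree ≤ N)
    (h : ∀ e : F, e ≠ 0 → ∀ x : K, x ≠ 0 → x ≠ algebraMap F K e → aeval x (pencil A B e) ≠ 0) :
    ∃ ζ κ : F, B = C ζ * X ^ w + C κ * rho a ^ w := by
  classical
  have hne' : ∀ e e' : F, e ≠ 0 → e' ≠ 0 → e ≠ e' → (pencil A B e).eval e' ≠ 0 := by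
    intro e e' he he' hee h0
    refine h e he (algebraMap F K e') ((_root_.map_ne_zero _).2 he')
      ((algebraMap F K).injective.ne hee.symm) ?_
    rw [aeval_algebraMap_eval, h0, map_zero]
  have hdeg : ∀ e, (pencil A B e).natDegree ≤ N := fun e =>
    (natDegree_sub_le _ _).trans (max_le ((natDegree_C_mul_le _ _).trans hAd)
      ((natDegree_C_mul_le _ _).trans hBd))
  have hform : ∀ e : F, ∃ c i j, e ≠ 0 → c ≠ 0 ∧
      pencil A B e = C c * X ^ i * (X - C e) ^ j := by
    intro e
    by_cases he : e = 0
    · exact ⟨0, 0, 0, fun h => absurd he h⟩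
    · obtain ⟨e', -, he'0, he', -⟩ := exists_avoid (F := F) one_ne_zero (d := 0) (by simp)
        (by omega) e e e
      obtain ⟨c, i, j, h1, h2⟩ := hS.two_root (hdeg e)
        (by
          intro h0
          apply hne' e e' he he'0 he'.symm
          rw [h0, eval_zero])
        (e := e) (fun z hz => by
          by_contra hcon
          push Not at hcon
          exact h e he z hcon.1 hcon.2 hz)
      exact ⟨c, i, j, fun _ => ⟨h1, h2⟩⟩
  choose c i j hcij using hform
  have hci : ∀ e, e ≠ 0 → ∀ k, k < i e → (pencil A B e).coeff k = 0 := by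
    intro e he k hk
    rw [(hcij e he).2, mul_assoc, mul_left_comm, coeff_X_pow_mul', if_neg (by omega)]
  have hci' : ∀ e, e ≠ 0 → (pencil A B e).coeff (i e) ≠ 0 := by
    intro e he
    rw [(hcij e he).2, mul_assoc, mul_left_comm, coeff_X_pow_mul', if_pos le_rfl, Nat.sub_self,
      coeff_C_mul, coeff_zero_eq_eval_zero]
    simp [(hcij e he).1, he]
  have hnd : ∀ e, e ≠ 0 → (pencil A B e).natDegree = i e + j e := by
    intro e he
    have h1 : C (c e) * X ^ (i e) ≠ 0 :=
      mul_ne_zero (C_ne_zero.2 (hcij e he).1) (pow_ne_zero _ X_ne_zero)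
    rw [(hcij e he).2, natDegree_mul h1 (pow_ne_zero _ (X_sub_C_ne_zero e)),
      natDegree_C_mul_X_pow _ _ (hcij e he).1, natDegree_pow, natDegree_X_sub_C, mul_one]
  have hne0 : ∀ e, e ≠ 0 → pencil A B e ≠ 0 := by
    intro e he h0
    apply hci' e he
    rw [h0, Polynomial.coeff_zero]
  have hs : (Finset.univ.filter fun e : F => e ≠ 0).Nonempty := ⟨1, by simp⟩
  obtain ⟨e₀, he₀, hmin⟩ := Finset.exists_min_image _ i hs
  obtain ⟨e₀', he₀', hmax⟩ := Finset.exists_max_image _ (fun e => i e + j e) hs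
  simp only [Finset.mem_filter, Finset.mem_univ, true_and] at he₀ hmin he₀' hmax
  -- At most one member has order at 0 above the minimum: two such members would lack the lowest
  -- coefficient, and they span the pencil. The same argument applies to the degree below.
  obtain ⟨b, hb⟩ : ∃ b, ∀ e, e ≠ 0 → e ≠ b → i e = i e₀ := by
    by_contra hcon
    push Not at hcon
    obtain ⟨e₁, he₁, -, h1⟩ := hcon 0
    obtain ⟨e₂, he₂, h12, h2⟩ := hcon e₁
    have h1' := hmin e₁ he₁
    have h2' := hmin e₂ he₂
    exact hci' e₀ he₀ (coeff_pencil_eq_zero (hne' e₁ e₂ he₁ he₂ h12.symm)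
      (hci e₁ he₁ _ (by omega)) (hci e₂ he₂ _ (by omega)) e₀)
  obtain ⟨b', hb'⟩ : ∃ b', ∀ e, e ≠ 0 → e ≠ b' → i e + j e = i e₀' + j e₀' := by
    by_contra hcon
    push Not at hcon
    obtain ⟨e₁, he₁, -, h1⟩ := hcon 0
    obtain ⟨e₂, he₂, h12, h2⟩ := hcon e₁
    have h1' := hmax e₁ he₁
    have h2' := hmax e₂ he₂
    have h3 := coeff_pencil_eq_zero (hne' e₁ e₂ he₁ he₂ h12.symm) (k := i e₀' + j e₀')
      (coeff_eq_zero_of_natDegree_lt (by rw [hnd e₁ he₁]; omega))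
      (coeff_eq_zero_of_natDegree_lt (by rw [hnd e₂ he₂]; omega)) e₀'
    rw [← hnd e₀' he₀', coeff_natDegree, leadingCoeff_eq_zero] at h3
    exact hne0 e₀' he₀' h3
  obtain ⟨e₁, -, he₁, h1b, h1b', -⟩ := exists_avoid (F := F) one_ne_zero (d := 0) (by simp)
    (by omega) b b' b'
  obtain ⟨e₂, -, he₂, h2b, h2b', h21⟩ := exists_avoid (F := F) one_ne_zero (d := 0) (by simp)
    (by omega) b b' e₁
  set I := i e₀ with hI
  set J := j e₁ with hJ
  have hgood : ∀ e, e ≠ 0 → e ≠ b → e ≠ b' → pencil A B e = C (c e) * X ^ I * (X - C e) ^ J := by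
    intro e he h1 h2
    have h3 := hb e he h1
    have h4 := hb' e he h2
    have h5 := hb e₁ he₁ h1b
    have h6 := hb' e₁ he₁ h1b'
    have h7 : j e = J := by omega
    rw [(hcij e he).2, h3, h7]
  have hJ0 : J ≠ 0 := by
    intro h0
    have h1 := hgood e₁ he₁ h1b h1b'
    rw [h0, pow_zero, mul_one] at h1
    have h2 := congrArg (eval e₁) h1
    rw [eval_pencil] at h2
    simp only [eval_mul, eval_C, eval_pow, eval_X] at h2
    refine mul_ne_zero (hcij e₁ he₁).1 (pow_ne_zero I he₁) (h2.symm.trans ?_)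
    ring
  have hJN : J ≤ N := by
    have h1 := hdeg e₁
    rw [hnd e₁ he₁] at h1
    omega
  obtain ⟨s, J', hs, hJ', hsJ⟩ := exists_Kp_mul (p := p) hJ0
  have hs0 := Kp_pos hs
  have hJ'0 : (J' : F) ≠ 0 := fun h0 => hJ' ((CharP.cast_eq_zero_iff F p J').1 h0)
  have hpw : ∀ e : F, (X - C e) ^ J = expand F s ((X - C (e ^ s)) ^ J') := by
    intro e
    rw [hsJ, pow_mul, sub_pow_Kp hs, ← C_pow]
    simp
  have hD := hne' e₁ e₂ he₁ he₂ h21.symm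
  have hT : e₁ ^ s - e₂ ^ s ≠ 0 := sub_ne_zero.2 fun h0 => h21 (pow_Kp_inj hs h0).symm
  have hJ'1 : J' = 1 := by
    by_contra hne1
    have hJ'2 : 2 ≤ J' := by
      have : J' ≠ 0 := by rintro rfl; simp at hJ'0
      omega
    -- For generic e, three members give a relation among J-th powers, which is the image of one
    -- among J'-th powers under X ↦ X^s. By `affine_of_relation`, G then vanishes at e^s. But G has
    -- leading term of degree J' ≥ 2, so G(X^s), of degree at most J ≤ N, is nonzero at some generic
    -- e.
    set G : F[X] := C (e₁ ^ s - e₂ ^ s) * X ^ J' - ((X - C (e₂ ^ s)) * C ((e₁ ^ s) ^ J') +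
      (C (e₁ ^ s) - X) * C ((e₂ ^ s) ^ J')) with hG
    have hG0 : G ≠ 0 := by
      intro h0
      have h1 := congrArg (fun P => coeff P J') h0
      have h2 : ((X - C (e₂ ^ s)) * C ((e₁ ^ s) ^ J') +
          (C (e₁ ^ s) - X) * C ((e₂ ^ s) ^ J') : F[X]).coeff J' = 0 := by
        simp only [coeff_add, coeff_mul_C, coeff_sub, coeff_X, coeff_C]
        rw [if_neg (by omega), if_neg (by omega), if_neg (by omega)]
        ring
      simp only [hG, Polynomial.coeff_zero] at h1
      rw [coeff_sub, h2, coeff_C_mul, coeff_X_pow, if_pos rfl] at h1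
      simp only [mul_one, sub_zero] at h1
      exact hT h1
    have hGd : G.natDegree ≤ J' := by
      refine (natDegree_sub_le _ _).trans (max_le (natDegree_C_mul_X_pow_le _ _) ?_)
      refine (natDegree_add_le _ _).trans (max_le ?_ ?_)
      · refine (natDegree_mul_C_le _ _).trans ?_
        rw [natDegree_X_sub_C]; omega
      · refine (natDegree_mul_C_le _ _).trans ((natDegree_sub_le _ _).trans ?_)
        rw [natDegree_C, natDegree_X]; omega
    obtain ⟨e, heG, he, heb, heb', -⟩ := exists_avoid (G := expand F s G)
      (fun h0 => hG0 ((expand_eq_zero hs0).1 h0)) (d := N) (by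
        rw [natDegree_expand]
        nlinarith) hq b b' b'
    apply heG
    have h1 := pencil_relation (A := A) (B := B) e e₁ e₂
    generalize (pencil A B e₁).eval e₂ = d at h1 hD
    generalize (pencil A B e).eval e₂ = d₁ at h1
    generalize (pencil A B e₁).eval e = d₂ at h1
    rw [hgood e he heb heb', hgood e₁ he₁ h1b h1b', hgood e₂ he₂ h2b h2b'] at h1
    have h2 : C (d * c e) * (X - C e) ^ J =
        C (d₁ * c e₁) * (X - C e₁) ^ J + C (d₂ * c e₂) * (X - C e₂) ^ J := by
      apply mul_left_cancel₀ (pow_ne_zero I (X_ne_zero (R := F)))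
      simp only [C_mul]
      linear_combination h1
    rw [hpw, hpw, hpw] at h2
    have h3 : expand F s (C (d * c e) * (X - C (e ^ s)) ^ J') =
        expand F s (C (d₁ * c e₁) * (X - C (e₁ ^ s)) ^ J' +
          C (d₂ * c e₂) * (X - C (e₂ ^ s)) ^ J') := by
      simpa only [map_mul, map_add, expand_C] using h2
    have h4 := affine_of_relation hJ'2 hJ'0 (mul_ne_zero hD (hcij e he).1) (expand_injective hs0 h3)
    rw [expand_eval]
    simp only [hG, eval_sub, eval_mul, eval_C, eval_pow, eval_X, eval_add]
    linear_combination h4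
  have hJs : J = s := by rw [hsJ, hJ'1, mul_one]
  have hgood' : ∀ e, e ≠ 0 → e ≠ b → e ≠ b' →
      pencil A B e = C (c e) * (X ^ (I + s) - C (e ^ s) * X ^ I) := by
    intro e h1 h2 h3
    rw [hgood e h1 h2 h3, hJs, sub_pow_Kp hs, ← C_pow]
    ring
  have hspan : ∀ P : F[X], (∃ s₁ s₂ : F, C ((pencil A B e₁).eval e₂) * P =
      C s₁ * pencil A B e₁ - C s₂ * pencil A B e₂) →
      ∃ α β : F, P = C α * X ^ (I + s) + C β * X ^ I := by
    rintro P ⟨s₁, s₂, hP⟩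
    refine ⟨((pencil A B e₁).eval e₂)⁻¹ * (s₁ * c e₁ - s₂ * c e₂),
      ((pencil A B e₁).eval e₂)⁻¹ * (s₂ * c e₂ * e₂ ^ s - s₁ * c e₁ * e₁ ^ s), ?_⟩
    have h1 : P = C ((pencil A B e₁).eval e₂)⁻¹ * (C ((pencil A B e₁).eval e₂) * P) := by
      rw [← mul_assoc, ← C_mul, inv_mul_cancel₀ hD, C_1, one_mul]
    rw [h1, hP, hgood' e₁ he₁ h1b h1b', hgood' e₂ he₂ h2b h2b']
    simp only [C_mul, C_sub]
    ring
  obtain ⟨α, β, hAα⟩ := hspan A ⟨_, _, pencil_left e₁ e₂⟩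
  obtain ⟨α', β', hBα⟩ := hspan B ⟨_, _, pencil_right e₁ e₂⟩
  have hw0 := Kp_pos hw
  have hA' : A = X ^ (2 * w) - C (a ^ w) * X ^ w := by
    rw [hA, rho, mul_pow, sub_pow_Kp hw, ← C_pow]
    ring
  -- A has exactly the exponents 2w and w, since a ≠ 0, and lies in the span of X^(I+s) and X^I;
  -- this matches the exponents.
  have hIw : w = I ∧ 2 * w = I + s := by
    have h1 := congrArg (fun P => coeff P (2 * w)) (hA'.symm.trans hAα)
    have h2 := congrArg (fun P => coeff P w) (hA'.symm.trans hAα)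
    simp only [coeff_sub, coeff_add, coeff_C_mul, coeff_X_pow, if_true] at h1 h2
    rw [if_neg (show ¬ 2 * w = w by omega)] at h1
    rw [if_neg (show ¬ w = 2 * w by omega)] at h2
    have h3 : 2 * w = I + s ∨ 2 * w = I := by
      by_contra hcon
      push Not at hcon
      rw [if_neg hcon.1, if_neg hcon.2] at h1
      simp at h1
    have h4 : w = I + s ∨ w = I := by
      by_contra hcon
      push Not at hcon
      rw [if_neg hcon.1, if_neg hcon.2] at h2
      simp [ha] at h2
    omega
  refine ⟨β' + α' * a ^ w, α', ?_⟩
  rw [hBα, ← hA, hA', ← hIw.2, ← hIw.1]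
  simp only [C_add, C_mul]
  ring

end Pencil

end AlgGraph

end

noncomputable section

namespace AlgGraph

/-! ### One quadratic factor and one Frobenius power. -/

section QuadraticCase

variable {F K : Type*} [Field F] [Field K] [Algebra F K]
variable {n : ℕ} {r : ℕ → F[X]} {p : ℕ} [Fact p.Prime]

/-- The points `(A(x), B(x))` with `A = ρ_a ^ (u l)` and `B = h_l ^ v` form an arc. -/
theorem Girth8.arc [CharP K p] [Finite K] {u v l : ℕ} {a : F}
    (h : Girth8 (fun x : K => aeval x (rho a) ^ u) (fun y => y ^ v) (rowEval n r))
    (hr : IsRows n r) (hu : u ∈ Kp p) (hv : v ∈ Kp p) (hln : l ∈ Finset.Icc 1 n)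
    (hrow : ∀ j, j ≠ l → r j ≠ 0 → ∃ k ∈ Kp p, ∃ d, v * k = u * j ∧ r j = C d * rho a ^ k)
    {e : F} (he : e ≠ 0) {x : K} (hx0 : x ≠ 0) (hxe : x ≠ algebraMap F K e) :
    aeval x (pencil (rho a ^ (u * l)) (r l ^ v) e) ≠ 0 := by
  have hu0 := (Kp_pos hu).ne'
  have hv0 := (Kp_pos hv).ne'
  have hl0 : l ≠ 0 := by have := (Finset.mem_Icc.1 hln).1; omega
  set ι := algebraMap F K
  have he0 : ι e ≠ 0 := (_root_.map_ne_zero ι).2 he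
  -- Every row other than l contributes a function of f(x)g(y) alone, so it cancels whenever the
  -- products f g agree.
  have hsame : ∀ {x₁ x₂ y₁ y₂ : K},
      (aeval x₁ (rho a) ^ u) * y₁ ^ v = (aeval x₂ (rho a) ^ u) * y₂ ^ v →
      rowEval n r x₁ y₁ - rowEval n r x₂ y₂ =
        aeval x₁ (r l) * y₁ ^ l - aeval x₂ (r l) * y₂ ^ l := by
    intro x₁ x₂ y₁ y₂ hxy
    rw [rowEval, rowEval, ← Finset.sum_sub_distrib, Finset.sum_eq_single_of_mem l hln]
    intro j _ hj
    by_cases h0 : r j = 0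
    · rw [h0]; simp
    · obtain ⟨k, -, d, hvk, hrk⟩ := hrow j hj h0
      have key : aeval x₁ (rho a) ^ k * y₁ ^ j = aeval x₂ (rho a) ^ k * y₂ ^ j := by
        apply pow_Kp_inj hv
        rw [mul_pow, mul_pow, ← pow_mul, ← pow_mul, ← pow_mul, ← pow_mul, mul_comm k v, hvk,
          mul_comm j v, pow_mul, pow_mul, pow_mul, pow_mul, ← mul_pow, ← mul_pow, hxy]
      rw [hrk]
      simp only [map_mul, map_pow, aeval_C]
      linear_combination algebraMap F K d * key
  have hpen : aeval x (pencil (rho a ^ (u * l)) (r l ^ v) e) =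
      aeval (ι e) (r l) ^ v * aeval x (rho a) ^ (u * l) -
        aeval (ι e) (rho a) ^ (u * l) * aeval x (r l) ^ v := by
    simp only [pencil, map_sub, map_mul, map_pow, aeval_C, eval_pow, aeval_algebraMap_eval, ι]
  rw [hpen]
  -- On a fibre of ρ_a only row l can separate points, and it must, to avoid a 4-cycle.
  have hdiff : ∀ {x₁ x₂ : K}, x₁ ≠ x₂ → aeval x₁ (rho a) = aeval x₂ (rho a) →
      aeval x₁ (r l) ≠ aeval x₂ (r l) := by
    intro x₁ x₂ h12 hrho heq
    refine one_ne_zero (h.no4x h12 (by simp only [hrho]) (y₁ := 1) (y₂ := 0) ?_)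
    rw [hsame (by rw [hrho]), rowEval_zero_right, rowEval_zero_right, heq]
    ring
  have hz : aeval (0 : K) (rho a) = 0 := by simp [aeval_rho]
  have hlz : aeval (0 : K) (r l) = 0 := aeval_zero_of_eval (hr.zero l)
  by_cases hρ : aeval x (rho a) = aeval (ι e) (rho a)
  · by_cases hρ0 : aeval x (rho a) = 0
    · exfalso
      have h1 := hρ0
      have h2 := hρ ▸ hρ0
      rw [aeval_rho, mul_eq_zero] at h1 h2
      exact hxe ((sub_eq_zero.1 (h1.resolve_left hx0)).trans
        (sub_eq_zero.1 (h2.resolve_left he0)).symm)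
    · rw [← hρ]
      intro h0
      have h1 : aeval (ι e) (r l) ^ v = aeval x (r l) ^ v :=
        mul_left_cancel₀ (pow_ne_zero (u * l) hρ0) (by linear_combination h0)
      exact hdiff hxe hρ (pow_Kp_inj hv h1).symm
  · by_cases hx : aeval x (rho a) = 0
    · rw [hx, zero_pow (mul_ne_zero hu0 hl0), mul_zero, zero_sub, neg_ne_zero]
      have h1 := hdiff hx0 (hx.trans hz.symm)
      rw [hlz] at h1
      exact mul_ne_zero (pow_ne_zero _ fun h2 => hρ (hx.trans h2.symm)) (pow_ne_zero _ h1)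
    by_cases hE : aeval (ι e) (rho a) = 0
    · rw [hE, zero_pow (mul_ne_zero hu0 hl0), zero_mul, sub_zero]
      have h1 := hdiff he0 (hE.trans hz.symm)
      rw [hlz] at h1
      exact mul_ne_zero (pow_ne_zero _ h1) (pow_ne_zero _ hx)
    have hxu := pow_ne_zero u hx
    -- With this w, f g agrees at (x, w) and (e, 1). A zero of the pencil member at x would make H
    -- agree as well, closing the hexagon on x, e, 0 and 0, 1, w.
    obtain ⟨w, hw⟩ := pow_Kp_surj hv (aeval (ι e) (rho a) ^ u / aeval x (rho a) ^ u)
    have hw' : aeval x (rho a) ^ u * w ^ v = aeval (ι e) (rho a) ^ u := by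
      rw [hw, mul_div_cancel₀ _ hxu]
    have hw0 : w ≠ 0 := by
      rintro rfl
      rw [zero_pow hv0, mul_zero] at hw'
      exact hE (eq_zero_of_pow_eq_zero hw'.symm)
    have hw1 : w ≠ 1 := by
      rintro rfl
      rw [one_pow, mul_one] at hw'
      exact hρ (pow_Kp_inj hu hw')
    intro h0
    have hH : aeval x (r l) * w ^ l = aeval (ι e) (r l) := by
      apply pow_Kp_inj hv
      apply mul_left_cancel₀ (pow_ne_zero (u * l) hx)
      have h1 : aeval x (rho a) ^ (u * l) * (w ^ l) ^ v = aeval (ι e) (rho a) ^ (u * l) := by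
        rw [pow_mul, pow_mul, ← hw', mul_pow, ← pow_mul w l, mul_comm l v, pow_mul w]
      rw [mul_pow]
      linear_combination -h0 + aeval x (r l) ^ v * h1
    refine h.no6 (x₁ := x) (x₂ := ι e) (x₃ := 0) (y₁ := 0) (y₂ := 1) (y₃ := w) hxe he0 hx0.symm
      zero_ne_one hw1.symm hw0 ?_ ?_
    · simp only [hz, zero_pow hu0, zero_pow hv0, one_pow]
      linear_combination -hw'
    · have h1 := hsame (x₁ := x) (x₂ := ι e) (y₁ := w) (y₂ := 1) (by rw [hw', one_pow, mul_one])
      rw [hH] at h1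
      simp only [rowEval_zero_right, hr.rowEval_zero_left]
      linear_combination -h1

variable [CharP F p]

theorem rho_comp (a c : F) :
    (rho a).comp (X + C c) = rho (a - 2 * c) + C ((rho a).eval c) := by
  simp only [rho, mul_comp, sub_comp, X_comp, C_comp, eval_mul, eval_sub, eval_X, eval_C, C_mul,
    C_sub, C_ofNat]
  ring

theorem two_eq_zero_iff : (2 : F) = 0 ↔ p = 2 := by
  have hp : p.Prime := Fact.out
  have := CharP.cast_eq_zero_iff F p 2
  rw [Nat.cast_ofNat] at this
  rw [this, Nat.prime_dvd_prime_iff_eq hp Nat.prime_two]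

/-- A polynomial with a Frobenius power that is a power of `ρ_a` is itself a power of `ρ_a`. -/
theorem eq_rho_pow [Finite F] {a : F} (ha : (2 : F) ≠ 0 ∨ a ≠ 0) {P : F[X]} (hP : P ≠ 0) {v N : ℕ}
    (hv : v ∈ Kp p) {c : F} (h : P ^ v = C c * rho a ^ N) :
    ∃ k d, v * k = N ∧ P = C d * rho a ^ k := by
  have hp : p.Prime := Fact.out
  have hrho : rho a ≠ 0 := (rho_monic a).ne_zero
  have hc : c ≠ 0 := by
    rintro rfl
    rw [C_0, zero_mul] at h
    exact hP (eq_zero_of_pow_eq_zero h)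
  have hdvd : v ∣ N := by
    -- In characteristic two, 0 is a simple root of ρ_a, so its multiplicity N in the right side is
    -- divisible by v. Otherwise v divides the degree 2N and is odd.
    by_cases h2 : (2 : F) = 0
    · have ha0 : a ≠ 0 := ha.resolve_left (not_not.2 h2)
      classical
      have h1 := congrArg (fun Q => Q.roots.count 0) h
      simp only [roots_pow, roots_C_mul _ hc, Multiset.count_nsmul] at h1
      rw [rho, roots_mul (by simpa [rho] using hrho), roots_X, roots_X_sub_C] at h1
      simp [ha0.symm] at h1
      exact ⟨_, h1.symm⟩
    · have h1 := congrArg natDegree h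
      rw [natDegree_pow, natDegree_C_mul hc, natDegree_pow, natDegree_rho] at h1
      have h3 : v ∣ N * 2 := ⟨_, h1.symm⟩
      refine Nat.Coprime.dvd_of_dvd_mul_right ?_ h3
      obtain ⟨e, rfl⟩ := hv
      refine Nat.Coprime.pow_left e ((Nat.coprime_primes hp Nat.prime_two).2 ?_)
      rwa [Ne, ← two_eq_zero_iff (F := F)]
  obtain ⟨k, rfl⟩ := hdvd
  obtain ⟨d, hd⟩ := pow_Kp_surj hv c
  refine ⟨k, d, rfl, pow_Kp_inj hv ?_⟩
  rw [h, mul_pow, ← pow_mul, ← C_pow, hd, mul_comm k v]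

/-- Composition with the nonconstant ρ_b is injective, so the identity holds with X in place of ρ_b,
and the middle binomial coefficients of (X + t)^k vanish. -/
theorem Kp_of_translate_pow {b t d d' : F} {k : ℕ} (hk : k ≠ 0) (ht : t ≠ 0) (hd : d ≠ 0)
    (h : C d * (rho b + C t) ^ k - C (d * t ^ k) = C d' * rho b ^ k) : k ∈ Kp p := by
  have h1 : (C d * (X + C t) ^ k - C (d * t ^ k) - C d' * X ^ k).comp (rho b) = 0 := by
    simp only [sub_comp, mul_comp, C_comp, pow_comp, add_comp, X_comp]
    rw [h, sub_self]
  rw [comp_eq_zero_iff] at h1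
  have h2 : C d * (X + C t) ^ k - C (d * t ^ k) - C d' * X ^ k = 0 := by
    rcases h1 with h1 | h1
    · exact h1
    · have h3 := congrArg natDegree h1.2
      rw [natDegree_rho, natDegree_C] at h3
      omega
  refine Kp_of_choose (R := F) hk fun i h0 hik => ?_
  have h3 := congrArg (fun P => coeff P i) h2
  simp only [coeff_sub, coeff_C_mul, coeff_X_add_C_pow, coeff_C, coeff_X_pow,
    Polynomial.coeff_zero] at h3
  rw [if_neg h0.ne', if_neg hik.ne, mul_zero, sub_zero, sub_zero] at h3
  exact (mul_eq_zero.1 ((mul_eq_zero.1 h3).resolve_left hd)).resolve_left (pow_ne_zero _ ht)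

variable [Fintype F]

/-- Row l separates two points of the same ρ_a-fibre, so its v-th power is not a multiple of a power
of ρ_a. It is therefore the exceptional row, and every other row is regular. -/
theorem Girth8.row_rho {m u v : ℕ} {a : F}
    (h : Girth8 (fun x : K => aeval x (rho a) ^ u) (fun y => y ^ v) (rowEval n r))
    (ha : (2 : F) ≠ 0 ∨ a ≠ 0)
    (hq : 2 * m * n + 3 < Fintype.card F) (hS : SplitsUpTo F K n) (hr : IsRows n r)
    (hu : u ∈ Kp p) (hv : v ∈ Kp p) (hum : 2 * u ≤ m) (hvm : v ≤ m) {l : ℕ} {x₁ x₂ : F}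
    (hx : x₁ + x₂ = a) (hl : (r l).eval x₁ ≠ (r l).eval x₂) {j : ℕ} (hj : j ≠ l)
    (hrj : r j ≠ 0) : ∃ k d, v * k = u * j ∧ r j = C d * rho a ^ k := by
  have hrho : (rho a).eval x₁ = (rho a).eval x₂ := by
    subst hx
    simp only [eval_rho]
    ring
  rcases h.row_pow_eq hq hS hr (natDegree_rho a).le (rho_monic a).ne_zero (by simp [eval_rho]) hu hv
    (by rw [natDegree_rho]; exact hum) hvm hj with ⟨c, hc⟩ | ⟨c, hc⟩
  · exact eq_rho_pow ha hrj hv hc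
  · exfalso
    apply hl
    apply pow_Kp_inj hv
    rw [← eval_pow, ← eval_pow, hc]
    simp only [eval_mul, eval_C, eval_pow, hrho]

/-- The form d ρ_a^k of the regular rows must survive translation by some c with ρ_a(c) ≠ 0. Since
ρ_a(x + c) = ρ_{a-2c}(x) + ρ_a(c), this forces k to be a power of p. -/
theorem Girth8.rows_rho [CharP K p] {m u v : ℕ} {a : F}
    (h : Girth8 (fun x : K => aeval x (rho a) ^ u) (fun y => y ^ v) (rowEval n r))
    (ha : (2 : F) ≠ 0 ∨ a ≠ 0)
    (hq : 2 * m * n + 3 < Fintype.card F) (hS : SplitsUpTo F K n) (hr : IsRows n r)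
    (hu : u ∈ Kp p) (hv : v ∈ Kp p) (hum : 2 * u ≤ m) (hvm : v ≤ m) :
    ∃ l ∈ Kp p, (1 ≤ l ∧ l ≤ n) ∧ (∃ x₁ x₂ : F, x₁ + x₂ = a ∧ (r l).eval x₁ ≠ (r l).eval x₂) ∧
      ∀ j, j ≠ l → r j ≠ 0 → ∃ k ∈ Kp p, ∃ d, v * k = u * j ∧ r j = C d * rho a ^ k := by
  obtain ⟨x₁, x₂, hx, hx12⟩ : ∃ x₁ x₂ : F, x₁ + x₂ = a ∧ x₁ ≠ x₂ := by
    by_cases h0 : a = 0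
    · subst h0
      refine ⟨1, -1, by ring, fun h1 => ?_⟩
      have h2 : (2 : F) = 0 := by linear_combination h1
      exact ha.elim (fun h => h h2) (fun h => h rfl)
    · exact ⟨a, 0, by ring, h0⟩
  obtain ⟨l, hl, hln, hl12, -⟩ := h.exists_row (p := p) hS hx12 (by
    subst hx
    simp only [aeval_rho, map_add]
    ring)
  refine ⟨l, hl, hln, ⟨x₁, x₂, hx, hl12⟩, fun j hj hrj => ?_⟩
  obtain ⟨k, d, hvk, hrk⟩ := h.row_rho ha hq hS hr hu hv hum hvm hx hl12 hj hrj
  refine ⟨k, ?_, d, hvk, hrk⟩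
  obtain ⟨c, hc⟩ := exists_eval_ne_zero (rho_monic a).ne_zero
    (by rw [natDegree_rho]; omega)
  have hj0 : j ≠ 0 := by
    rintro rfl
    exact hrj (hr.supp 0 (by simp))
  have hu0 := Kp_pos hu
  have hk0 : k ≠ 0 := by
    rintro rfl
    have : 0 < u * j := Nat.mul_pos hu0 (Nat.pos_of_ne_zero hj0)
    omega
  have hd : d ≠ 0 := by
    rintro rfl
    rw [C_0, zero_mul] at hrk
    exact hrj hrk
  set b := a - 2 * c with hb
  have hb0 : (2 : F) ≠ 0 ∨ b ≠ 0 := by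
    rcases ha with h0 | h0
    · exact Or.inl h0
    · by_cases h2 : (2 : F) = 0
      · right; rwa [hb, h2, zero_mul, sub_zero]
      · exact Or.inl h2
  have htr : AlgGraph.trRows c r j = C d * (rho b + C ((rho a).eval c)) ^ k - C (d * (rho a).eval c ^ k) := by
    rw [AlgGraph.trRows, hrk]
    simp only [mul_comp, C_comp, pow_comp, eval_mul, eval_C, eval_pow]
    rw [rho_comp]
  have htr0 : AlgGraph.trRows c r j ≠ 0 := by
    intro h0
    have h1 : (r j).comp (X + C c) = C ((r j).eval c) := sub_eq_zero.1 h0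
    have h2 := congrArg natDegree h1
    rw [natDegree_comp, natDegree_X_add_C, natDegree_C, mul_one, hrk, natDegree_C_mul hd,
      natDegree_pow, natDegree_rho] at h2
    omega
  obtain ⟨k', d', hvk', hrk'⟩ := (h.translate_rho hu c).row_rho hb0 hq hS (hr.translate c) hu hv hum
    hvm (l := l) (x₁ := x₁ - c) (x₂ := x₂ - c) (by rw [← hx]; ring)
    (by
      rw [eval_trRows, eval_trRows, sub_add_cancel, sub_add_cancel]
      exact fun h1 => hl12 (sub_left_injective h1)) hj htr0
  have hkk : k' = k := Nat.eq_of_mul_eq_mul_left (Kp_pos hv) (hvk'.trans hvk.symm)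
  rw [htr, hkk] at hrk'
  exact Kp_of_translate_pow hk0 hc hd hrk'

/-- The classification of `h` when `f = ρ_a ^ u` and `g = y ^ v`. -/
theorem Girth8.quadratic_case [CharP K p] [Finite K] {m u v : ℕ} {a : F}
    (h : Girth8 (fun x : K => aeval x (rho a) ^ u) (fun y => y ^ v) (rowEval n r))
    (ha : (2 : F) ≠ 0 ∨ a ≠ 0)
    (hq : 2 * m * n + 3 < Fintype.card F) (hn : 0 < n) (hS : SplitsUpTo F K (m * n))
    (hr : IsRows n r) (hu : u ∈ Kp p) (hv : v ∈ Kp p) (hum : 2 * u ≤ m) (hvm : v ≤ m) :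
    ∃ l ∈ Kp p, (1 ≤ l ∧ l ≤ n) ∧
      (∀ j, j ≠ l → r j ≠ 0 → ∃ k ∈ Kp p, ∃ d, v * k = u * j ∧ r j = C d * rho a ^ k) ∧
      ((∃ k ζ κ, v * k = u * l ∧ ζ ≠ 0 ∧ r l = C ζ * X ^ k + C κ * rho a ^ k) ∨
        (p = 2 ∧ a ≠ 0 ∧ v = 2 * l * u ∧ ∃ ζ, ζ ≠ 0 ∧ r l = C ζ * X)) := by
  have hp : p.Prime := Fact.out
  have hu0 := Kp_pos hu
  have hv0 := Kp_pos hv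
  have hm : 0 < m := by omega
  have hmn : 0 < m * n := Nat.mul_pos hm hn
  have hS' : SplitsUpTo F K n := hS.mono (Nat.le_mul_of_pos_left n hm)
  have hqN : m * n + 4 < Fintype.card F := by
    have : 2 * m * n = m * n + m * n := by ring
    omega
  obtain ⟨l, hl, hln, ⟨x₁, x₂, hx, hl12⟩, hrow⟩ := h.rows_rho ha hq hS' hr hu hv hum hvm
  have hl0 := Kp_pos hl
  have hul := Kp_mul hu hl
  refine ⟨l, hl, hln, hrow, ?_⟩
  have hrho12 : (rho a).eval x₁ = (rho a).eval x₂ := by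
    subst hx
    simp only [eval_rho]
    ring
  -- The pencil argument needs a ≠ 0, reached by a translation. Translating back changes the
  -- Frobenius powers only by constants, whose total is zero because row l vanishes at 0.
  obtain ⟨ζ, κ, hB⟩ : ∃ ζ κ : F, r l ^ v = C ζ * X ^ (u * l) + C κ * rho a ^ (u * l) := by
    obtain ⟨c, hc⟩ : ∃ c, a - 2 * c ≠ 0 := by
      by_cases h0 : a = 0
      · refine ⟨1, ?_⟩
        subst h0
        simpa using ha
      · exact ⟨0, by simpa using h0⟩
    have hrow' : ∀ j, j ≠ l → AlgGraph.trRows c r j ≠ 0 → ∃ k ∈ Kp p, ∃ d, v * k = u * j ∧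
        AlgGraph.trRows c r j = C d * rho (a - 2 * c) ^ k := by
      intro j hj h0
      obtain ⟨k, hk, d, hvk, hrk⟩ := hrow j hj (by
        intro h1
        apply h0
        rw [AlgGraph.trRows, h1]; simp)
      refine ⟨k, hk, d, hvk, ?_⟩
      rw [AlgGraph.trRows, hrk]
      simp only [mul_comp, C_comp, pow_comp, eval_mul, eval_C, eval_pow]
      rw [rho_comp, add_pow_Kp hk, ← C_pow, C_mul]
      ring
    have harc := fun (e : F) (he : e ≠ 0) (x : K) (hx0 : x ≠ 0) hxe =>
      (h.translate_rho hu c).arc (hr.translate c) hu hv (Finset.mem_Icc.2 hln) hrow' he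
        (x := x) hx0 hxe
    obtain ⟨ζ, κ, hB⟩ := pencil_eq hS hqN hul hc rfl (by
        rw [natDegree_pow, natDegree_rho]
        calc u * l * 2 = 2 * u * l := by ring
          _ ≤ m * n := Nat.mul_le_mul hum hln.2)
      (natDegree_pow_le.trans (Nat.mul_le_mul hvm ((hr.translate c).deg l))) harc
    refine ⟨ζ, κ, ?_⟩
    have hsub : (AlgGraph.trRows c r l).comp (X - C c) = r l - C ((r l).eval c) := by
      rw [AlgGraph.trRows, sub_comp, comp_assoc, C_comp]
      simp
    have hrsub : (rho (a - 2 * c)).comp (X - C c) = rho a - C ((rho a).eval c) := by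
      simp only [rho, mul_comp, sub_comp, X_comp, C_comp, eval_mul, eval_sub, eval_X, eval_C,
        C_mul, C_sub]
      simp only [C_ofNat]
      ring
    have h1 := congrArg (fun P => P.comp (X - C c)) hB
    simp only [pow_comp, add_comp, mul_comp, C_comp, X_comp] at h1
    rw [hsub, hrsub, sub_pow_Kp hv, sub_pow_Kp hul, sub_pow_Kp hul, ← C_pow, ← C_pow, ← C_pow] at h1
    set s := (r l).eval c ^ v - ζ * c ^ (u * l) - κ * (rho a).eval c ^ (u * l) with hs
    have h2 : r l ^ v = C ζ * X ^ (u * l) + C κ * rho a ^ (u * l) + C s := by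
      rw [hs]
      simp only [C_sub, C_mul]
      linear_combination h1
    have h3 := congrArg (eval 0) h2
    simp only [eval_pow, hr.zero, eval_add, eval_mul, eval_C, eval_X, eval_rho, zero_mul,
      zero_pow hv0.ne', zero_pow (Kp_pos hul).ne', mul_zero, zero_add] at h3
    rw [h2, ← h3, C_0, add_zero]
  have hζ : ζ ≠ 0 := by
    rintro rfl
    apply hl12
    apply pow_Kp_inj hv
    rw [← eval_pow, ← eval_pow, hB]
    simp only [eval_mul, eval_add, eval_C, eval_pow, hrho12, zero_mul, zero_add]
  have hcase1 : v ∣ u * l →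
      ∃ k ζ κ, v * k = u * l ∧ ζ ≠ 0 ∧ r l = C ζ * X ^ k + C κ * rho a ^ k := by
    rintro ⟨k, hk⟩
    obtain ⟨ζ', rfl⟩ := pow_Kp_surj hv ζ
    obtain ⟨κ', rfl⟩ := pow_Kp_surj hv κ
    refine ⟨k, ζ', κ', hk.symm, fun h0 => hζ (by rw [h0, zero_pow hv0.ne']), ?_⟩
    apply pow_Kp_inj hv
    rw [hB, hk, add_pow_Kp hv, mul_pow, mul_pow, ← pow_mul, ← pow_mul, C_pow, C_pow, mul_comm k v]
  -- If v divides u l, v-th roots can be taken termwise. Otherwise v = u l e with e > 1, and r l ^ e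
  -- = ζ' X + κ' ρ_a has degree at most two; a nonconstant r l is then linear, e = 2 and p = 2.
  rcases Kp_dvd_total hv hul with hdvd | ⟨e, he⟩
  · exact Or.inl (hcase1 hdvd)
  · by_cases he1 : e = 1
    · exact Or.inl (hcase1 (by rw [he, he1, mul_one]))
    · right
      have heK : e ∈ Kp p := Kp_of_dvd hv (he ▸ dvd_mul_left e _)
      have he0 := Kp_pos heK
      obtain ⟨ζ', rfl⟩ := pow_Kp_surj hul ζ
      obtain ⟨κ', rfl⟩ := pow_Kp_surj hul κ
      have hζ' : ζ' ≠ 0 := fun h0 => hζ (by rw [h0, zero_pow (Kp_pos hul).ne'])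
      have hre : r l ^ e = C ζ' * X + C κ' * rho a := by
        apply pow_Kp_inj hul
        rw [← pow_mul, mul_comm e, ← he, hB, add_pow_Kp hul, mul_pow, mul_pow, C_pow, C_pow]
      have hdeg : e * (r l).natDegree ≤ 2 := by
        rw [← natDegree_pow, hre]
        refine (natDegree_add_le _ _).trans (max_le ?_ ?_)
        · exact (natDegree_C_mul_le _ _).trans (by simp)
        · exact (natDegree_C_mul_le _ _).trans (natDegree_rho a).le
      have hd0 : (r l).natDegree ≠ 0 := by
        intro h0
        rw [eq_C_of_natDegree_eq_zero h0] at hl12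
        simp at hl12
      have hd1 : (r l).natDegree = 1 ∧ e = 2 := by
        have h1 : 2 ≤ e := by omega
        have h2 : 1 ≤ (r l).natDegree := by omega
        constructor <;> nlinarith
      have hp2 : p = 2 := by
        obtain ⟨i, hi⟩ := heK
        rw [hd1.2] at hi
        have hi0 : i ≠ 0 := by rintro rfl; simp at hi
        exact (Nat.prime_dvd_prime_iff_eq hp Nat.prime_two).1 (hi ▸ dvd_pow_self p hi0)
      refine ⟨hp2, ha.resolve_left (not_not.2 (two_eq_zero_iff.2 hp2)), ?_, (r l).coeff 1, ?_, ?_⟩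
      · rw [he, hd1.2]; ring
      · rw [← hd1.1, coeff_natDegree, Ne, leadingCoeff_eq_zero]
        intro h0
        rw [h0] at hd0
        simp at hd0
      · have h1 := eq_X_add_C_of_natDegree_le_one hd1.1.le
        rwa [hr.coeff_zero, C_0, add_zero] at h1

end QuadraticCase

end AlgGraph

end

noncomputable section

namespace AlgGraph

/-! ### Coefficients of μ and π, behaviour under swapping, and evaluation. -/

section Coefficients

variable {F : Type*} [Field F] {p : ℕ}

theorem inX_mul_inY_X_pow (P : F[X]) (j : ℕ) : inX P * inY (X ^ j) = C P * X ^ j := by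
  simp [inX, inY]

theorem coeff_inX_mul_inY (P : F[X]) (i j : ℕ) :
    (inX P * inY (X ^ j)).coeff i = if i = j then P else 0 := by
  rw [inX_mul_inY_X_pow, coeff_C_mul, coeff_X_pow]
  split_ifs <;> simp

theorem coeff_mono (c : F) (i j k : ℕ) :
    (mono c i j).coeff k = if k = j then C c * X ^ i else 0 := coeff_inX_mul_inY _ _ _

theorem cf_mono (c : F) (i j k l : ℕ) :
    cf (mono c i j) k l = if k = i ∧ l = j then c else 0 := by
  rw [cf, coeff_mono]
  by_cases h : l = j
  · rw [if_pos h, coeff_C_mul, coeff_X_pow]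
    by_cases h' : k = i <;> simp [h, h']
  · simp [h]

theorem ext_cf {h h' : F[X][Y]} (H : ∀ i j, cf h i j = cf h' i j) : h = h' := by
  ext j i
  exact H i j

theorem Phi_fst_unique [Fact p.Prime] {u v i i' j : ℕ} (hv : v ∈ Kp p) (h : (i, j) ∈ Phi p u v)
    (h' : (i', j) ∈ Phi p u v) : i = i' := by
  have h1 : i * v = i' * v := h.2.2.trans h'.2.2.symm
  exact Nat.eq_of_mul_eq_mul_right (Kp_pos hv) h1

/-- The sums over `Φ_p(u, v)` are finite sums. -/
theorem exists_finset_sum {M : Type*} [AddCommMonoid M] (S : Set (ℕ × ℕ)) (t : ℕ × ℕ → M)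
    (hfin : {ij | t ij ≠ 0}.Finite) :
    ∃ T : Finset (ℕ × ℕ), (∀ ij, ij ∈ T ↔ ij ∈ S ∧ t ij ≠ 0) ∧
      ∑ᶠ ij ∈ S, t ij = ∑ ij ∈ T, t ij := by
  have hT := hfin.subset (Set.inter_subset_right (s := S))
  refine ⟨hT.toFinset, fun ij => by simp, finsum_mem_eq_sum_of_inter_support_eq _ ?_⟩
  ext ij
  simp

theorem finite_mu_support (h : F[X][Y]) (Q : ℕ × ℕ → F[X][Y]) {c d : ℕ} (hc : c ≠ 0) (hd : d ≠ 0)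
    (hQ : ∀ ij, cf h (c * ij.1) (d * ij.2) = 0 → Q ij = 0) : {ij | Q ij ≠ 0}.Finite :=
  (finite_cf_ne_zero h hc hd).subset fun ij hij h0 => hij (hQ ij h0)

/-- For given j the equation i v = j u has at most one solution i, so each power of y receives at
most one term. -/
theorem coeff_finsum_Phi [Fact p.Prime] {u v : ℕ} (hv : v ∈ Kp p) (t : ℕ × ℕ → F[X])
    (hfin : {ij : ℕ × ℕ | inX (t ij) * inY (X ^ ij.2) ≠ 0}.Finite) (j : ℕ) :
    (∀ i, (i, j) ∈ Phi p u v →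
      (∑ᶠ ij ∈ Phi p u v, inX (t ij) * inY (X ^ ij.2)).coeff j = t (i, j)) ∧
    ((∀ i, (i, j) ∉ Phi p u v) →
      (∑ᶠ ij ∈ Phi p u v, inX (t ij) * inY (X ^ ij.2)).coeff j = 0) := by
  obtain ⟨T, hT, hsum⟩ := exists_finset_sum (Phi p u v) _ hfin
  rw [hsum, finsetSum_coeff]
  simp only [coeff_inX_mul_inY]
  constructor
  · intro i hi
    rw [Finset.sum_eq_single (i, j)]
    · simp
    · rintro ⟨i', j'⟩ hij hne
      by_cases hj : j = j'
      · subst hj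
        exact absurd (by rw [Phi_fst_unique hv ((hT _).1 hij).1 hi]) hne
      · rw [if_neg hj]
    · intro h0
      rw [if_pos rfl]
      by_contra h1
      refine h0 ((hT _).2 ⟨hi, fun h2 => h1 ?_⟩)
      have := congrArg (fun P => coeff P j) h2
      simpa [coeff_inX_mul_inY] using this
  · intro hno
    refine Finset.sum_eq_zero fun ij hij => ?_
    rw [if_neg]
    rintro rfl
    exact hno ij.1 ((hT _).1 hij).1

theorem coeff_mu [Fact p.Prime] {u v : ℕ} (hv : v ∈ Kp p) (a : F) (h : F[X][Y]) (j : ℕ) :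
    (∀ i, (i, j) ∈ Phi p u v →
      (mu p a u v h).coeff j = h.coeff j - C (cf h (2 * i) j) * rho a ^ i) ∧
    ((∀ i, (i, j) ∉ Phi p u v) → (mu p a u v h).coeff j = h.coeff j) := by
  have hfin := finite_mu_support h
    (fun ij => inX (C (cf h (2 * ij.1) ij.2) * rho a ^ ij.1) * inY (X ^ ij.2)) two_ne_zero
    one_ne_zero (fun ij h0 => by
      rw [one_mul] at h0
      simp [h0, inX])
  obtain ⟨h1, h2⟩ := coeff_finsum_Phi (u := u) hv
    (fun ij => C (cf h (2 * ij.1) ij.2) * rho a ^ ij.1) hfin j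
  refine ⟨fun i hi => ?_, fun hno => ?_⟩
  · rw [mu, coeff_sub, h1 i hi]
  · rw [mu, coeff_sub, h2 hno, sub_zero]

theorem cf_pi [Fact p.Prime] {u v : ℕ} (hv : v ∈ Kp p) (h : F[X][Y]) (i j : ℕ) :
    ((i, j) ∈ Phi p u v → cf (pi p u v h) i j = 0) ∧
    ((i, j) ∉ Phi p u v → cf (pi p u v h) i j = cf h i j) := by
  have hfin := finite_mu_support h (fun ij => mono (cf h ij.1 ij.2) ij.1 ij.2) one_ne_zero
    one_ne_zero (fun ij h0 => by
      rw [one_mul, one_mul] at h0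
      simp [h0, mono, inX])
  obtain ⟨h1, h2⟩ := coeff_finsum_Phi (u := u) hv
    (fun ij => C (cf h ij.1 ij.2) * X ^ ij.1) hfin j
  refine ⟨fun hi => ?_, fun hno => ?_⟩
  · rw [cf, pi, coeff_sub]
    simp only [mono]
    rw [h1 i hi, coeff_sub, coeff_C_mul, coeff_X_pow, if_pos rfl, mul_one, cf, sub_self]
  · rw [cf, pi, coeff_sub]
    simp only [mono]
    by_cases hex : ∃ i', (i', j) ∈ Phi p u v
    · obtain ⟨i', hi'⟩ := hex
      have hne : i ≠ i' := by rintro rfl; exact hno hi'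
      rw [h1 i' hi', coeff_sub, coeff_C_mul, coeff_X_pow, if_neg hne, mul_zero, sub_zero, cf]
    · push Not at hex
      rw [h2 hex, sub_zero, cf]

end Coefficients

section Swap

variable {F : Type*} [Field F] {p : ℕ}

theorem cf_swap (h : F[X][Y]) (i j : ℕ) : cf (Bivariate.swap h) i j = cf h j i := by
  unfold cf
  induction h using Polynomial.induction_on' with
  | add f g hf hg => simp only [map_add, coeff_add, hf, hg]
  | monomial n f =>
    induction f using Polynomial.induction_on' with
    | add f g hf hg => simp only [map_add, coeff_add, hf, hg]
    | monomial k c =>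
      rw [Bivariate.swap_monomial_monomial]
      simp only [coeff_monomial]
      split_ifs <;> simp [coeff_monomial, *]

theorem swap_inX (P : F[X]) : Bivariate.swap (inX P) = inY P := Bivariate.swap_C P

theorem swap_inY (P : F[X]) : Bivariate.swap (inY P) = inX P := Bivariate.swap_map_C P

theorem swap_mono (c : F) (i j : ℕ) : Bivariate.swap (mono c i j) = mono c j i := by
  apply ext_cf
  intro k l
  rw [cf_swap, cf_mono, cf_mono]
  simp only [and_comm]

theorem mem_Phi_swap {u v i j : ℕ} : (i, j) ∈ Phi p u v ↔ (j, i) ∈ Phi p v u :=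
  ⟨fun h => ⟨h.2.1, h.1, h.2.2.symm⟩, fun h => ⟨h.2.1, h.1, h.2.2.symm⟩⟩

/-- This reduces the cases with the quadratic factor in y to those with it in x. -/
theorem nu_eq_swap (a : F) (u v : ℕ) (h : F[X][Y]) :
    nu p a u v h = Bivariate.swap (mu p a u v (Bivariate.swap h)) := by
  have hfin := finite_mu_support (Bivariate.swap h)
    (fun ij => inX (C (cf (Bivariate.swap h) (2 * ij.1) ij.2) * rho a ^ ij.1) * inY (X ^ ij.2))
    two_ne_zero one_ne_zero (fun ij h0 => by
      rw [one_mul] at h0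
      simp [h0, inX])
  rw [nu, mu, map_sub, Bivariate.swap_swap_apply]
  congr 1
  have hmap := (AddMonoidHom.map_finsum_mem' (f := fun ij : ℕ × ℕ =>
      inX (C (cf (Bivariate.swap h) (2 * ij.1) ij.2) * rho a ^ ij.1) * inY (X ^ ij.2))
    (s := Phi p u v) (Bivariate.swap (R := F)).toAddEquiv.toAddMonoidHom
    (hfin.subset Set.inter_subset_right))
  refine Eq.trans ?_ hmap.symm
  refine finsum_mem_eq_of_bijOn Prod.swap ⟨?_, Prod.swap_injective.injOn, ?_⟩ ?_
  · rintro ⟨i, j⟩ hij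
    exact mem_Phi_swap.2 hij
  · rintro ⟨i, j⟩ hij
    exact ⟨(j, i), mem_Phi_swap.1 hij, rfl⟩
  · rintro ⟨i, j⟩ -
    change _ = Bivariate.swap (inX _ * inY _)
    rw [map_mul, swap_inX, swap_inY, cf_swap]
    simp [inX, inY]
    ring

theorem pi_swap [Fact p.Prime] {u v : ℕ} (hu : u ∈ Kp p) (hv : v ∈ Kp p) (h : F[X][Y]) :
    pi p v u (Bivariate.swap h) = Bivariate.swap (pi p u v h) := by
  apply ext_cf
  intro i j
  rw [cf_swap]
  by_cases hij : (i, j) ∈ Phi p v u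
  · rw [(cf_pi hu _ i j).1 hij, (cf_pi hv _ j i).1 (mem_Phi_swap.1 hij)]
  · rw [(cf_pi hu _ i j).2 hij, (cf_pi hv _ j i).2 (fun h => hij (mem_Phi_swap.1 h)), cf_swap]

end Swap

section Evaluation

variable {F K : Type*} [Field F] [Field K] [Algebra F K]

theorem evalEval_baseChange (h : F[X][Y]) (x y : K) :
    (baseChange K h).evalEval x y = aevalAeval x y h := by
  rw [baseChange]
  induction h using Polynomial.induction_on' with
  | add f g hf hg => rw [Polynomial.map_add, evalEval_add, hf, hg, map_add]
  | monomial n f =>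
    rw [← C_mul_X_pow_eq_monomial, Polynomial.map_mul, Polynomial.map_pow, map_C, map_X,
      evalEval_mul, evalEval_pow, evalEval_X, evalEval_C, map_mul, map_pow, aevalAeval_C,
      aevalAeval_Y, coe_mapRingHom, eval_map_algebraMap]

theorem aevalAeval_inX (P : F[X]) (x y : K) : aevalAeval x y (inX P) = aeval x P :=
  aevalAeval_C x y P

theorem aevalAeval_inY (P : F[X]) (x y : K) : aevalAeval x y (inY P) = aeval y P := by
  rw [← swap_inX, Bivariate.aevalAeval_swap, aevalAeval_inX]

theorem aevalAeval_mono (c : F) (i j : ℕ) (x y : K) :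
    aevalAeval x y (mono c i j) = algebraMap F K c * x ^ i * y ^ j := by
  rw [mono, map_mul, aevalAeval_inX, aevalAeval_inY]
  simp

theorem isRows_coeff {n : ℕ} {h : F[X][Y]}
    (hh : ∀ i j : ℕ, cf h i j ≠ 0 → (1 ≤ i ∧ i ≤ n) ∧ (1 ≤ j ∧ j ≤ n)) :
    IsRows n h.coeff := by
  refine ⟨fun j => ?_, fun j => ?_, fun j hj => ?_⟩
  · rw [natDegree_le_iff_coeff_eq_zero]
    intro i hi
    by_contra h0
    have := (hh i j h0).1.2
    omega
  · rw [← coeff_zero_eq_eval_zero]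
    by_contra h0
    have := (hh 0 j h0).1.1
    omega
  · ext i
    by_contra h0
    exact hj (Finset.mem_Icc.2 (hh i j h0).2)

theorem rowEval_coeff {n : ℕ} {h : F[X][Y]} (hr : IsRows n h.coeff) (x y : K) :
    rowEval n h.coeff x y = aevalAeval x y h := by
  have hsum : h = ∑ j ∈ Finset.Icc 1 n, inX (h.coeff j) * inY (X ^ j) := by
    ext1 j
    rw [finsetSum_coeff]
    simp only [coeff_inX_mul_inY]
    rw [Finset.sum_ite_eq]
    split_ifs with hj
    · rfl
    · exact hr.supp j hj
  conv_rhs => rw [hsum]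
  rw [map_sum, rowEval]
  refine Finset.sum_congr rfl fun j _ => ?_
  rw [map_mul, aevalAeval_inX, aevalAeval_inY]
  simp

end Evaluation

end AlgGraph

end

noncomputable section

namespace AlgGraph

/-! ### Coordinate changes to Γ_3. -/

section Isomorphisms

variable {K : Type*} [Field K]

/-- Removing S of the first component from the second and undoing θ leaves two combinations of X²Y
and XY with nonzero determinant. All operations are additive and invertible, so they act on the last
two coordinates of points and lines alike. -/
theorem nonempty_iso_Gam3 {f₂ f₃ : K[X][Y]} (φ ψ : K ≃ K) (α β γ δ : K)
    (hdet : α * δ - β * γ ≠ 0) (S : K →+ K) (θ : K ≃+* K)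
    (h₂ : ∀ x y, f₂.evalEval x y = α * (φ x ^ 2 * ψ y) + β * (φ x * ψ y))
    (h₃ : ∀ x y, f₃.evalEval x y =
      S (f₂.evalEval x y) + θ (γ * (φ x ^ 2 * ψ y) + δ * (φ x * ψ y))) :
    Nonempty (Gam f₂ f₃ ≃g Gam3 K) := by
  obtain ⟨D, hD⟩ : ∃ D, α * δ - β * γ = D := ⟨_, rfl⟩
  rw [hD] at hdet
  let T : K × K ≃+ K × K :=
    { toFun := fun z => ((α * θ.symm (z.2 - S z.1) - γ * z.1) / D,
        (δ * z.1 - β * θ.symm (z.2 - S z.1)) / D)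
      invFun := fun z => (α * z.2 + β * z.1, S (α * z.2 + β * z.1) + θ (γ * z.2 + δ * z.1))
      left_inv := by
        rintro ⟨P, Q⟩
        have e1 : α * ((δ * P - β * θ.symm (Q - S P)) / D) +
            β * ((α * θ.symm (Q - S P) - γ * P) / D) = P := by
          field_simp
          rw [← hD]
          ring
        have e2 : γ * ((δ * P - β * θ.symm (Q - S P)) / D) +
            δ * ((α * θ.symm (Q - S P) - γ * P) / D) = θ.symm (Q - S P) := by
          field_simp
          rw [← hD]
          ring
        simp only [e1, e2, θ.apply_symm_apply, add_sub_cancel]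
      right_inv := by
        rintro ⟨B, A⟩
        simp only [add_sub_cancel_left, θ.symm_apply_apply]
        ext
        · field_simp
          rw [← hD]
          ring
        · field_simp
          rw [← hD]
          ring
      map_add' := by
        rintro ⟨P, Q⟩ ⟨P', Q'⟩
        have e : θ.symm (Q + Q' - S (P + P')) = θ.symm (Q - S P) + θ.symm (Q' - S P') := by
          rw [← map_add, map_add S]
          congr 1
          ring
        ext
        · simp only [Prod.mk_add_mk, e]
          ring
        · simp only [Prod.mk_add_mk, e]
          ring }
  refine ⟨isoOfEquiv φ ψ T fun x y => ?_⟩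
  change ((α * θ.symm (f₃.evalEval x y - S (f₂.evalEval x y)) - γ * f₂.evalEval x y) /
    D, (δ * f₂.evalEval x y - β * θ.symm (f₃.evalEval x y -
      S (f₂.evalEval x y))) / D) = _
  rw [h₃, add_sub_cancel_left, θ.symm_apply_apply, h₂, evalEval_mono, evalEval_mono]
  ext
  · change _ / _ = _
    field_simp
    rw [← hD]
    ring
  · change _ / _ = _
    field_simp
    rw [← hD]
    ring

variable {p : ℕ} [Fact p.Prime] [CharP K p] [Finite K]

/-- The map z ↦ z^(i/u) makes sense on a finite field and is an automorphism, being a Frobenius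
power composed with the inverse of another. -/
theorem exists_frobenius_root {u i : ℕ} (hu : u ∈ Kp p) (hi : i ∈ Kp p) :
    ∃ θ : K ≃+* K, ∀ z, θ z ^ u = z ^ i := by
  obtain ⟨d, rfl⟩ := hu
  obtain ⟨e, rfl⟩ := hi
  refine ⟨(iterateFrobeniusEquiv K p e).trans (iterateFrobeniusEquiv K p d).symm, fun z => ?_⟩
  have := (iterateFrobeniusEquiv K p d).apply_symm_apply (iterateFrobeniusEquiv K p e z)
  rw [iterateFrobeniusEquiv_apply, iterateFrobeniusEquiv_apply] at this
  exact this

theorem frobenius_root_apply {u i j v : ℕ} (hu : u ∈ Kp p) {θ : K ≃+* K}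
    (hθ : ∀ z, θ z ^ u = z ^ i) (hij : i * v = j * u) (z : K) : θ (z ^ v) = z ^ j := by
  apply pow_Kp_inj hu
  rw [hθ, ← pow_mul, ← pow_mul, mul_comm v, hij]

/-- For (i, j) in Φ_p(u, v) the automorphism z ↦ z^(i/u) sends x^u y^v to x^i y^j. This is why such
terms of h are invisible to the graph up to isomorphism. -/
theorem exists_additive_sum {u v : ℕ} (hu : u ∈ Kp p) (T : Finset (ℕ × ℕ))
    (hT : ∀ ij ∈ T, ij ∈ Phi p u v) (c : ℕ × ℕ → K) :
    ∃ S : K →+ K, ∀ x y, ∑ ij ∈ T, c ij * x ^ ij.1 * y ^ ij.2 = S (x ^ u * y ^ v) := by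
  classical
  have hθ : ∀ ij : ℕ × ℕ, ∃ θ : K ≃+* K, ij ∈ Phi p u v → ∀ z, θ z ^ u = z ^ ij.1 := by
    intro ij
    by_cases h : ij ∈ Phi p u v
    · obtain ⟨θ, hθ⟩ := exists_frobenius_root (K := K) hu h.1
      exact ⟨θ, fun _ => hθ⟩
    · exact ⟨RingEquiv.refl K, fun h' => absurd h' h⟩
  choose θ hθ using hθ
  refine ⟨∑ ij ∈ T, (AddMonoidHom.mulLeft (c ij)).comp (θ ij).toAddEquiv.toAddMonoidHom,
    fun x y => ?_⟩
  rw [AddMonoidHom.finsetSum_apply]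
  refine Finset.sum_congr rfl fun ij hij => ?_
  change _ = c ij * θ ij (x ^ u * y ^ v)
  rw [map_mul, frobenius_root_apply hu (hθ ij (hT ij hij)) rfl,
    frobenius_root_apply hu (hθ ij (hT ij hij)) (hT ij hij).2.2, mul_assoc]

/-- The bijection `x ↦ x ^ u` for a power `u` of the characteristic. -/
def powEquiv {u : ℕ} (hu : u ∈ Kp p) : K ≃ K :=
  Equiv.ofBijective (fun x => x ^ u) ⟨fun _ _ h => pow_Kp_inj hu h, fun x => pow_Kp_surj hu x⟩

theorem powEquiv_apply {u : ℕ} (hu : u ∈ Kp p) (x : K) : powEquiv hu x = x ^ u := rfl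

end Isomorphisms

section SpecialGraphs

variable {F K : Type*} [Field F] [Field K] [Algebra F K]
variable {p : ℕ} [Fact p.Prime] [CharP K p] [Finite K]

theorem exists_eq_additive_add_of_mu {a : F} {u v : ℕ} (hu : u ∈ Kp p) (h : F[X][Y]) :
    ∃ S : K →+ K, ∀ x y : K, aevalAeval x y h =
      S ((x * (x - algebraMap F K a)) ^ u * y ^ v) + aevalAeval x y (mu p a u v h) := by
  have hfin := finite_mu_support h
    (fun ij => inX (C (cf h (2 * ij.1) ij.2) * rho a ^ ij.1) * inY (X ^ ij.2)) two_ne_zero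
    one_ne_zero (fun ij h0 => by
      rw [one_mul] at h0
      simp [h0, inX])
  obtain ⟨T, hT, hsum⟩ := exists_finset_sum (Phi p u v) _ hfin
  obtain ⟨S, hS⟩ := exists_additive_sum (K := K) hu T (fun ij hij => ((hT ij).1 hij).1)
    (fun ij => algebraMap F K (cf h (2 * ij.1) ij.2))
  refine ⟨S, fun x y => ?_⟩
  rw [mu, hsum, map_sub, map_sum, ← hS, ← sub_eq_iff_eq_add', sub_right_inj]
  refine Finset.sum_congr rfl fun ij _ => ?_
  rw [map_mul, aevalAeval_inX, aevalAeval_inY, map_mul, map_pow, map_pow, aeval_C, aeval_X,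
    aeval_rho]

theorem exists_eq_additive_add_of_pi {u v : ℕ} (hu : u ∈ Kp p) (h : F[X][Y]) :
    ∃ S : K →+ K, ∀ x y : K, aevalAeval x y h =
      S (x ^ u * y ^ v) + aevalAeval x y (pi p u v h) := by
  have hfin := finite_mu_support h (fun ij => mono (cf h ij.1 ij.2) ij.1 ij.2) one_ne_zero
    one_ne_zero (fun ij h0 => by
      rw [one_mul, one_mul] at h0
      simp [h0, mono, inX])
  obtain ⟨T, hT, hsum⟩ := exists_finset_sum (Phi p u v) _ hfin
  obtain ⟨S, hS⟩ := exists_additive_sum (K := K) hu T (fun ij hij => ((hT ij).1 hij).1)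
    (fun ij => algebraMap F K (cf h ij.1 ij.2))
  refine ⟨S, fun x y => ?_⟩
  rw [pi, hsum, map_sub, map_sum, ← hS, ← sub_eq_iff_eq_add', sub_right_inj]
  exact Finset.sum_congr rfl fun ij _ => (aevalAeval_mono _ _ _ _ _).symm

/-- With X = x^u and Y = y^v, the product f g is X²Y - a^u XY, and the monomial left by μ is an
automorphism applied to a multiple of X^c Y. Case (i) is c = 1. Case (iv) is c = 2, where
independence requires a ≠ 0. -/
theorem nonempty_iso_of_mu {f₂ f₃ : K[X][Y]} {h : F[X][Y]} {a ζ : F} {u v w s c : ℕ} (hζ : ζ ≠ 0)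
    (hu : u ∈ Kp p) (hv : v ∈ Kp p) (hs : s ∈ Kp p) (hw : s * (u * c) = w * v)
    (hc : c = 1 ∨ c = 2 ∧ a ≠ 0)
    (h₂ : ∀ x y, f₂.evalEval x y = (x * (x - algebraMap F K a)) ^ u * y ^ v)
    (h₃ : ∀ x y, f₃.evalEval x y = aevalAeval x y h)
    (hmu : mu p a u v h = mono ζ w s) : Nonempty (Gam f₂ f₃ ≃g Gam3 K) := by
  obtain ⟨S, hS⟩ := exists_eq_additive_add_of_mu (K := K) (a := a) (v := v) hu h
  obtain ⟨θ, hθ⟩ := exists_frobenius_root (K := K) hv hs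
  have hζ' : θ.symm (algebraMap F K ζ) ≠ 0 := by simpa using hζ
  have hf : ∀ x y : K, (x * (x - algebraMap F K a)) ^ u * y ^ v =
      1 * ((x ^ u) ^ 2 * y ^ v) + -(algebraMap F K a) ^ u * (x ^ u * y ^ v) := by
    intro x y
    rw [mul_pow, sub_pow_Kp hu]
    ring
  have hh : ∀ x y : K, aevalAeval x y h = S ((x * (x - algebraMap F K a)) ^ u * y ^ v) +
      θ (θ.symm (algebraMap F K ζ) * ((x ^ u) ^ c * y ^ v)) := by
    intro x y
    rw [hS, hmu, aevalAeval_mono, map_mul θ, map_mul θ, θ.apply_symm_apply, ← pow_mul,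
      frobenius_root_apply hv hθ hw, frobenius_root_apply hv hθ rfl, mul_assoc]
  rcases hc with rfl | ⟨rfl, ha⟩
  · refine nonempty_iso_Gam3 (powEquiv hu) (powEquiv hv) 1 (-(algebraMap F K a) ^ u) 0
      (θ.symm (algebraMap F K ζ)) (by simpa using hζ) S θ (fun x y => ?_) fun x y => ?_
    · rw [h₂, hf, powEquiv_apply, powEquiv_apply]
    · rw [h₃, h₂, hh, powEquiv_apply, powEquiv_apply, pow_one, zero_mul, zero_add]
  · refine nonempty_iso_Gam3 (powEquiv hu) (powEquiv hv) 1 (-(algebraMap F K a) ^ u)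
      (θ.symm (algebraMap F K ζ)) 0 (by simp [hζ, ha]) S θ (fun x y => ?_) fun x y => ?_
    · rw [h₂, hf, powEquiv_apply, powEquiv_apply]
    · rw [h₃, h₂, hh, powEquiv_apply, powEquiv_apply, zero_mul, add_zero]

theorem nonempty_iso_of_pi {f₂ f₃ : K[X][Y]} {h : F[X][Y]} {ζ : F} {u v w s : ℕ} (hζ : ζ ≠ 0)
    (hu : u ∈ Kp p) (hv : v ∈ Kp p) (hs : s ∈ Kp p) (hw : s * (u * 2) = w * v)
    (h₂ : ∀ x y, f₂.evalEval x y = x ^ u * y ^ v)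
    (h₃ : ∀ x y, f₃.evalEval x y = aevalAeval x y h)
    (hpi : pi p u v h = mono ζ w s) : Nonempty (Gam f₂ f₃ ≃g Gam3 K) := by
  obtain ⟨S, hS⟩ := exists_eq_additive_add_of_pi (K := K) (v := v) hu h
  obtain ⟨θ, hθ⟩ := exists_frobenius_root (K := K) hv hs
  refine nonempty_iso_Gam3 (powEquiv hu) (powEquiv hv) 0 1
    (θ.symm (algebraMap F K ζ)) 0 (by simp [hζ]) S θ (fun x y => ?_) fun x y => ?_
  · rw [h₂, powEquiv_apply, powEquiv_apply]
    ring
  · rw [h₃, h₂, powEquiv_apply, powEquiv_apply, zero_mul, add_zero, hS, hpi, aevalAeval_mono,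
      map_mul θ, map_mul θ, θ.apply_symm_apply, ← pow_mul, frobenius_root_apply hv hθ hw,
      frobenius_root_apply hv hθ rfl, mul_assoc]

theorem evalEval_baseChange_mul (f g : F[X]) (x y : K) :
    (baseChange K (inX f * inY g)).evalEval x y = aeval x f * aeval y g := by
  rw [evalEval_baseChange, map_mul, aevalAeval_inX, aevalAeval_inY]

variable (K) in
/-- The isomorphism that exchanges points and lines. -/
def isoSwapBaseChange (f g : F[X]) (h : F[X][Y]) :
    Gam (baseChange K (inX f * inY g)) (baseChange K h) ≃g
      Gam (baseChange K (inX g * inY f)) (baseChange K (Bivariate.swap h)) :=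
  isoSwap (fun x y => by rw [evalEval_baseChange_mul, evalEval_baseChange_mul, mul_comm])
    (fun x y => by rw [evalEval_baseChange, evalEval_baseChange, Bivariate.aevalAeval_swap])

end SpecialGraphs

end AlgGraph

end

noncomputable section

namespace AlgGraph

/-! ### From the classification to the stated normal forms, and the main theorem. -/

section NormalForms

variable {F K : Type*} [Field F] [Field K] [Algebra F K] [Fintype F] [Finite K]
variable {p m n u v : ℕ} [Fact p.Prime] [CharP F p] [CharP K p] {h : F[X][Y]}

theorem Girth8.mu_eq_mono {a : F}
    (hG : Girth8 (fun x : K => aeval x (rho a) ^ u) (fun y => y ^ v) (rowEval n h.coeff))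
    (ha : (2 : F) ≠ 0 ∨ a ≠ 0) (hq : 2 * m * n + 3 < Fintype.card F) (hn : 0 < n)
    (hS : SplitsUpTo F K (m * n)) (hr : IsRows n h.coeff) (hu : u ∈ Kp p) (hv : v ∈ Kp p)
    (hum : 2 * u ≤ m) (hvm : v ≤ m) :
    ∃ (ζ : F) (s : ℕ), ζ ≠ 0 ∧ (s ∈ Kp p ∧ 1 ≤ s ∧ s ≤ n) ∧
      ((v ∣ s * u ∧ mu p a u v h = mono ζ (s * u / v) s) ∨
        (p = 2 ∧ a ≠ 0 ∧ v = 2 * s * u ∧ mu p a u v h = mono ζ 1 s)) := by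
  have hu0 := Kp_pos hu
  have hv0 := Kp_pos hv
  obtain ⟨l, hl, hln, hrest, hrow⟩ := hG.quadratic_case ha hq hn hS hr hu hv hum hvm
  have hother : ∀ j, j ≠ l → (mu p a u v h).coeff j = 0 := by
    intro j hj
    obtain ⟨h1, h2⟩ := coeff_mu (u := u) hv a h j
    by_cases h0 : h.coeff j = 0
    · by_cases hex : ∃ i, (i, j) ∈ Phi p u v
      · obtain ⟨i, hi⟩ := hex
        rw [h1 i hi, cf, h0]
        simp
      · push Not at hex
        rw [h2 hex, h0]
    · obtain ⟨k, hk, d, hkj, hd⟩ := hrest j hj h0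
      have hjK : j ∈ Kp p := Kp_of_dvd (Kp_mul hv hk) (hkj ▸ Dvd.intro_left u rfl)
      -- Since ρ_a is monic quadratic, the coefficient of X^(2k) recovers d, and μ subtracts exactly
      -- this row.
      have hcf : cf h (2 * k) j = d := by
        have := ((rho_monic a).pow k).coeff_natDegree
        rw [natDegree_pow, natDegree_rho, mul_comm] at this
        rw [cf, hd, coeff_C_mul, this, mul_one]
      rw [h1 k ⟨hk, hjK, by rw [mul_comm, hkj, mul_comm]⟩, hcf, hd, sub_self]
  have hmono : ∀ (ζ : F) (w : ℕ), (mu p a u v h).coeff l = C ζ * X ^ w →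
      mu p a u v h = mono ζ w l := by
    intro ζ w hw
    ext1 j
    rw [coeff_mono]
    split_ifs with hj
    · rw [hj, hw]
    · exact hother j hj
  obtain ⟨h1, h2⟩ := coeff_mu (u := u) hv a h l
  rcases hrow with ⟨k, ζ, κ, hkl, hζ, hrl⟩ | ⟨hp, ha0, hvl, ζ, hζ, hrl⟩
  · have hk : k ∈ Kp p := Kp_of_dvd (Kp_mul hu hl) (hkl ▸ Dvd.intro_left v rfl)
    have hk0 := Kp_pos hk
    have hcf : cf h (2 * k) l = κ := by
      have := ((rho_monic a).pow k).coeff_natDegree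
      rw [natDegree_pow, natDegree_rho, mul_comm] at this
      rw [cf, hrl, coeff_add, coeff_C_mul, coeff_C_mul, this, coeff_X_pow, if_neg (by omega)]
      ring
    have hdiv : l * u = v * k := by rw [hkl, mul_comm]
    refine ⟨ζ, l, hζ, ⟨hl, hln⟩, Or.inl ⟨⟨k, hdiv⟩, hmono ζ _ ?_⟩⟩
    rw [h1 k ⟨hk, hl, (mul_comm k v).trans hdiv.symm⟩, hcf, hrl, hdiv, Nat.mul_div_cancel_left _ hv0, add_sub_cancel_right]
  · refine ⟨ζ, l, hζ, ⟨hl, hln⟩, Or.inr ⟨hp, ha0, hvl, hmono ζ _ ?_⟩⟩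
    -- Here v = 2 l u, and i v = l u has no positive solution, so μ leaves row l untouched.
    rw [h2 fun i hi => ?_, hrl, pow_one]
    have hi0 := Kp_pos hi.1
    have hlu : 0 < l * u := Nat.mul_pos hln.1 hu0
    have e : i * v = l * u := hi.2.2
    rw [hvl] at e
    have : i * (2 * l * u) = 2 * i * (l * u) := by ring
    nlinarith

theorem Girth8.pi_eq_mono
    (hG : Girth8 (fun x : K => x ^ u) (fun y => y ^ v) (rowEval n h.coeff))
    (hq : 2 * m * n + 3 < Fintype.card F) (hm : 0 < m)
    (hS : SplitsUpTo F K (m * n)) (hr : IsRows n h.coeff) (hu : u ∈ Kp p) (hv : v ∈ Kp p)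
    (hum : u ≤ m) (hvm : v ≤ m)
    (hh : ∀ i j : ℕ, cf h i j ≠ 0 → (1 ≤ i ∧ i ≤ n) ∧ (1 ≤ j ∧ j ≤ n)) :
    ∃ (ζ : F) (s : ℕ), ζ ≠ 0 ∧ (s ∈ Kp p ∧ 1 ≤ s ∧ s ≤ n) ∧
      ((v ∣ 2 * s * u ∧ pi p u v h = mono ζ (2 * s * u / v) s) ∨
        (u ∣ 2 * s * v ∧ pi p u v h = mono ζ s (2 * s * v / u))) := by
  obtain ⟨k, l, ⟨hc, hne, hoff⟩, hkl, hdiag⟩ := hG.monomial_case hq hm hS hr hu hv hum hvm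
  have hpi : pi p u v h = mono (cf h k l) k l := by
    apply ext_cf
    intro i j
    rw [cf_mono]
    by_cases hij : (i, j) ∈ Phi p u v
    · rw [(cf_pi hv h i j).1 hij, if_neg]
      rintro ⟨rfl, rfl⟩
      exact hne (by rw [mul_comm, hij.2.2, mul_comm])
    · rw [(cf_pi hv h i j).2 hij]
      split_ifs with hkl
      · rw [hkl.1, hkl.2]
      · by_contra h0
        by_cases e : v * i = u * j
        · obtain ⟨hi, hj⟩ := hdiag i j h0 e
          exact hij ⟨hi, hj, by rw [mul_comm, e, mul_comm]⟩
        · exact hkl (hoff i j h0 e)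
  change cf h k l ≠ 0 at hc
  obtain ⟨hk, hl⟩ := hh k l hc
  rcases hkl with ⟨hlK, e⟩ | ⟨hkK, e⟩
  · have e' : 2 * l * u = v * k := by rw [e]; ring
    refine ⟨_, l, hc, ⟨hlK, hl⟩, Or.inl ⟨⟨k, e'⟩, ?_⟩⟩
    rw [e', Nat.mul_div_cancel_left _ (Kp_pos hv), hpi]
  · have e' : 2 * k * v = u * l := by rw [e]; ring
    refine ⟨_, k, hc, ⟨hkK, hk⟩, Or.inr ⟨⟨l, e'⟩, ?_⟩⟩
    rw [e', Nat.mul_div_cancel_left _ (Kp_pos hu), hpi]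

/-- The special cases of the classification. -/
def IsSpecial (p m n : ℕ) (f g : F[X]) (h : F[X][Y]) : Prop :=
  ∃ (a ζ : F) (u v s : ℕ), ζ ≠ 0 ∧ (u ∈ Kp p ∧ 1 ≤ u ∧ u ≤ m) ∧ (v ∈ Kp p ∧ 1 ≤ v ∧ v ≤ m) ∧
    (s ∈ Kp p ∧ 1 ≤ s ∧ s ≤ n) ∧
    ((f = rho a ^ u ∧ g = X ^ v ∧ v ∣ s * u ∧ mu p a u v h = mono ζ (s * u / v) s) ∨
      (f = X ^ v ∧ g = rho a ^ u ∧ v ∣ s * u ∧ nu p a u v h = mono ζ s (s * u / v)) ∨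
      (f = X ^ u ∧ g = X ^ v ∧
        ((v ∣ 2 * s * u ∧ pi p u v h = mono ζ (2 * s * u / v) s) ∨
          (u ∣ 2 * s * v ∧ pi p u v h = mono ζ s (2 * s * v / u)))) ∨
      (p = 2 ∧ a ≠ 0 ∧
        ((f = rho a ^ u ∧ g = X ^ (2 * s * u) ∧ mu p a u (2 * s * u) h = mono ζ 1 s) ∨
          (f = X ^ (2 * s * u) ∧ g = rho a ^ u ∧ nu p a u (2 * s * u) h = mono ζ s 1))))

theorem IsSpecial.nonempty_iso {f g : F[X]} (hsp : IsSpecial p m n f g h) :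
    Nonempty (Gam (baseChange K (inX f * inY g)) (baseChange K h) ≃g Gam3 K) := by
  obtain ⟨a, ζ, u, v, s, hζ, ⟨hu, -, -⟩, ⟨hv, -, -⟩, ⟨hs, -, -⟩, hcase⟩ := hsp
  have hdiv : ∀ {b c d : ℕ}, d ∣ b → c = b → c = b / d * d := by
    rintro b c d hd rfl
    exact (Nat.div_mul_cancel hd).symm
  have hquad : ∀ (g : F[X]) (h : F[X][Y]) (v w c : ℕ), v ∈ Kp p → g = X ^ v →
      s * (u * c) = w * v → (c = 1 ∨ c = 2 ∧ a ≠ 0) → mu p a u v h = mono ζ w s →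
      Nonempty (Gam (baseChange K (inX (rho a ^ u) * inY g)) (baseChange K h) ≃g Gam3 K) := by
    rintro g h v w c hv rfl hw hc hmu
    exact nonempty_iso_of_mu hζ hu hv hs hw hc
      (fun x y => by rw [evalEval_baseChange_mul, map_pow, map_pow, aeval_X, aeval_rho])
      (fun x y => evalEval_baseChange (K := K) h x y) hmu
  have hmon : ∀ (h : F[X][Y]) (u v w : ℕ), u ∈ Kp p → v ∈ Kp p →
      s * (u * 2) = w * v → pi p u v h = mono ζ w s →
      Nonempty (Gam (baseChange K (inX (X ^ u) * inY (X ^ v))) (baseChange K h) ≃g Gam3 K) :=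
    fun h u v w hu hv hw hpi => nonempty_iso_of_pi hζ hu hv hs hw
      (fun x y => by rw [evalEval_baseChange_mul (F := F), map_pow, map_pow, aeval_X, aeval_X])
      (fun x y => evalEval_baseChange (F := F) h x y) hpi
  have hnu : ∀ {v i j : ℕ}, nu p a u v h = mono ζ i j →
      mu p a u v (Bivariate.swap h) = mono ζ j i := by
    intro v i j e
    rw [nu_eq_swap] at e
    rw [← swap_mono, ← e, Bivariate.swap_swap_apply]
  rcases hcase with ⟨rfl, hg, hd, e⟩ | ⟨hf, rfl, hd, e⟩ | ⟨rfl, rfl, ⟨hd, e⟩ | ⟨hd, e⟩⟩ |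
    ⟨hp, ha, ⟨rfl, hg, e⟩ | ⟨hf, rfl, e⟩⟩
  · exact hquad g h v _ 1 hv hg (hdiv hd (by ring)) (Or.inl rfl) e
  · exact (hquad f _ v _ 1 hv hf (hdiv hd (by ring)) (Or.inl rfl) (hnu e)).map
      (isoSwapBaseChange K _ _ _).trans
  · exact hmon h u v _ hu hv (hdiv hd (by ring)) e
  · exact (hmon _ v u _ hv hu (hdiv hd (by ring)) (by rw [pi_swap hu hv, e, swap_mono])).map
      (isoSwapBaseChange K _ _ _).trans
  · have hv' : 2 * s * u ∈ Kp p := Kp_mul (Kp_mul ⟨1, by rw [hp, pow_one]⟩ hs) hu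
    exact hquad g h _ 1 2 hv' hg (by ring) (Or.inr ⟨rfl, ha⟩) e
  · have hv' : 2 * s * u ∈ Kp p := Kp_mul (Kp_mul ⟨1, by rw [hp, pow_one]⟩ hs) hu
    exact (hquad f _ _ 1 2 hv' hf (by ring) (Or.inr ⟨rfl, ha⟩) (hnu e)).map
      (isoSwapBaseChange K _ _ _).trans

theorem Girth8.isSpecial {f g : F[X]}
    (hG : Girth8 (fun x : K => aeval x f) (fun y => aeval y g) (rowEval n h.coeff))
    (hq : 2 * m * n + 3 < Fintype.card F) (hm : 0 < m) (hn : 0 < n)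
    (hS : SplitsUpTo F K (m * n))
    (hh : ∀ i j : ℕ, cf h i j ≠ 0 → (1 ≤ i ∧ i ≤ n) ∧ (1 ≤ j ∧ j ≤ n))
    (hf : f.Monic) (hg : g.Monic) (hfm : f.natDegree ≤ m) (hgm : g.natDegree ≤ m)
    (hf0 : f.eval 0 = 0) (hg0 : g.eval 0 = 0) : IsSpecial p m n f g h := by
  have hr := isRows_coeff hh
  have hmn : m ≤ m * n := Nat.le_mul_of_pos_right m hn
  have hmul : 2 * m * n = m * n + m * n := by ring
  have hnn : n ≤ m * n := Nat.le_mul_of_pos_left n hm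
  have hX : ∀ u, (X ^ u : F[X]).natDegree = u := natDegree_X_pow
  have hR : ∀ (a : F) (u : ℕ), (rho a ^ u).natDegree = 2 * u := fun a u => by
    rw [natDegree_pow, natDegree_rho, mul_comm]
  have hswap : ∀ i, (Bivariate.swap h).coeff i = AlgGraph.swapRows n h.coeff i := by
    intro i
    ext j
    rw [hr.coeff_swapRows]
    exact cf_swap h j i
  obtain ⟨u, hu, hfu⟩ := eq_pow_of_not_three (p := p) hS (by omega) hf (hfm.trans hmn) hf0
    fun x₁ x₂ x₃ h12 h23 h31 e12 e23 => hG.not_three rowEval_zero_right h12 h23 h31 e12 e23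
  obtain ⟨v, hv, hgv⟩ := eq_pow_of_not_three (p := p) hS (by omega) hg (hgm.trans hmn) hg0
    fun x₁ x₂ x₃ h12 h23 h31 e12 e23 => (hG.swapRows hr).not_three rowEval_zero_right
      h12 h23 h31 e12 e23
  have hu0 := Kp_pos hu
  have hv0 := Kp_pos hv
  rcases hfu with rfl | ⟨a, ha, rfl⟩ <;> rcases hgv with rfl | ⟨b, hb, rfl⟩ <;>
    simp only [hX, hR] at hfm hgm <;> simp only [map_pow, aeval_X] at hG
  · obtain ⟨ζ, s, hζ, hs, e⟩ := hG.pi_eq_mono hq hm hS hr hu hv hfm hgm hh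
    exact ⟨0, ζ, u, v, s, hζ, ⟨hu, hu0, hfm⟩, ⟨hv, hv0, hgm⟩, hs, Or.inr (Or.inr (Or.inl
      ⟨rfl, rfl, e⟩))⟩
  · have hG' := hG.swapRows hr
    have hr' := hr.swap
    rw [← funext hswap] at hG' hr'
    obtain ⟨ζ, s, hζ, hs, ⟨hd, e⟩ | ⟨hp, hb0, rfl, e⟩⟩ :=
      Girth8.mu_eq_mono (h := Bivariate.swap h) hG' hb hq hn hS hr' hv hu hgm hfm
    · exact ⟨b, ζ, v, u, s, hζ, ⟨hv, hv0, by omega⟩, ⟨hu, hu0, hfm⟩, hs, Or.inr (Or.inl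
        ⟨rfl, rfl, hd, by rw [nu_eq_swap, e, swap_mono]⟩)⟩
    · exact ⟨b, ζ, v, _, s, hζ, ⟨hv, hv0, by omega⟩, ⟨hu, hu0, hfm⟩, hs, Or.inr (Or.inr (Or.inr
        ⟨hp, hb0, Or.inr ⟨rfl, rfl, by rw [nu_eq_swap, e, swap_mono]⟩⟩))⟩
  · obtain ⟨ζ, s, hζ, hs, ⟨hd, e⟩ | ⟨hp, ha0, rfl, e⟩⟩ :=
      hG.mu_eq_mono ha hq hn hS hr hu hv hfm hgm
    · exact ⟨a, ζ, u, v, s, hζ, ⟨hu, hu0, by omega⟩, ⟨hv, hv0, hgm⟩, hs, Or.inl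
        ⟨rfl, rfl, hd, e⟩⟩
    · exact ⟨a, ζ, u, _, s, hζ, ⟨hu, hu0, by omega⟩, ⟨hv, hv0, hgm⟩, hs, Or.inr (Or.inr (Or.inr
        ⟨hp, ha0, Or.inl ⟨rfl, rfl, e⟩⟩))⟩
  · exact (hG.not_rho_rho hu hv (hS.mono hnn) hr (by nlinarith) ha hb).elim

end NormalForms

theorem finrank_eq_of_card {F K : Type*} [Field F] [Field K] [Algebra F K] [Fintype F] [Fintype K]
    {M : ℕ} (h : Fintype.card K = Fintype.card F ^ M) : Module.finrank F K = M := by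
  rw [Module.card_eq_pow_finrank (K := F) (V := K)] at h
  exact Nat.pow_right_injective Fintype.one_lt_card h

end AlgGraph

end

open AlgGraph in
theorem theorem1 (p q m n M : ℕ) (hp : p.Prime) (hm : 0 < m) (hn : 0 < n)
    (hq : max (2 * m * n + 3) (max (m * n + 3 * n + 1) (n * (n + 1) + 2)) < q)
    (hM : M = (Finset.Icc 2 (m * n)).lcm id)
    {F K : Type*} [Field F] [Fintype F] [CharP F p] (hF : Fintype.card F = q)
    [Field K] [Fintype K] [Algebra F K] (hK : Fintype.card K = q ^ M)
    (f g : F[X]) (hf : f.Monic) (hg : g.Monic) (hfm : f.natDegree ≤ m) (hgm : g.natDegree ≤ m)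
    (hf0 : f.eval 0 = 0) (hg0 : g.eval 0 = 0)
    (h : F[X][Y]) (hh0 : h ≠ 0)
    (hh : ∀ i j : ℕ, AlgGraph.cf h i j ≠ 0 → (1 ≤ i ∧ i ≤ n) ∧ (1 ≤ j ∧ j ≤ n))
    (G : SimpleGraph ((K × K × K) ⊕ (K × K × K)))
    (hG : G = AlgGraph.Gam (AlgGraph.baseChange K (AlgGraph.inX f * AlgGraph.inY g))
      (AlgGraph.baseChange K h)) :
    (8 ≤ G.egirth → Nonempty (G ≃g AlgGraph.Gam3 K)) ∧
    (8 ≤ G.egirth ↔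
      ∃ (a ζ : F) (u v s : ℕ), ζ ≠ 0 ∧
        (u ∈ AlgGraph.Kp p ∧ 1 ≤ u ∧ u ≤ m) ∧
        (v ∈ AlgGraph.Kp p ∧ 1 ≤ v ∧ v ≤ m) ∧
        (s ∈ AlgGraph.Kp p ∧ 1 ≤ s ∧ s ≤ n) ∧
        ((f = AlgGraph.rho a ^ u ∧ g = X ^ v ∧
            v ∣ s * u ∧ AlgGraph.mu p a u v h = AlgGraph.mono ζ (s * u / v) s) ∨
         (f = X ^ v ∧ g = AlgGraph.rho a ^ u ∧
            v ∣ s * u ∧ AlgGraph.nu p a u v h = AlgGraph.mono ζ s (s * u / v)) ∨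
         (f = X ^ u ∧ g = X ^ v ∧
            ((v ∣ 2 * s * u ∧ AlgGraph.pi p u v h = AlgGraph.mono ζ (2 * s * u / v) s) ∨
             (u ∣ 2 * s * v ∧ AlgGraph.pi p u v h = AlgGraph.mono ζ s (2 * s * v / u)))) ∨
         (p = 2 ∧ a ≠ 0 ∧
            ((f = AlgGraph.rho a ^ u ∧ g = X ^ (2 * s * u) ∧
                AlgGraph.mu p a u (2 * s * u) h = AlgGraph.mono ζ 1 s) ∨
             (f = X ^ (2 * s * u) ∧ g = AlgGraph.rho a ^ u ∧
                AlgGraph.nu p a u (2 * s * u) h = AlgGraph.mono ζ s 1))))) := by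
  have : Fact p.Prime := ⟨hp⟩
  have : CharP K p := charP_of_injective_algebraMap (algebraMap F K).injective p
  have hq' : 2 * m * n + 3 < Fintype.card F := hF ▸ (le_max_left _ _).trans_lt hq
  have hS : SplitsUpTo F K (m * n) := by
    refine splitsUpTo_of_finrank fun d hd0 hd => ?_
    -- The degree [K : F] is M, a multiple of every d up to mn.
    rw [finrank_eq_of_card (hF ▸ hK), hM]
    rcases Nat.lt_or_ge d 2 with h1 | h2
    · rw [show d = 1 by omega]
      exact one_dvd _
    · exact Finset.dvd_lcm (f := id) (Finset.mem_Icc.2 ⟨h2, hd⟩)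
  subst hG
  have hforward : 8 ≤ (Gam (baseChange K (inX f * inY g)) (baseChange K h)).egirth →
      IsSpecial p m n f g h := fun h8 =>
    (Girth8.of_egirth (evalEval_baseChange_mul f g)
      (fun x y => (evalEval_baseChange h x y).trans (rowEval_coeff (isRows_coeff hh) x y).symm)
      h8).isSpecial hq' hm hn hS hh hf hg hfm hgm hf0 hg0
  refine ⟨fun h8 => (hforward h8).nonempty_iso, hforward, fun hsp => ?_⟩
  obtain ⟨e⟩ := IsSpecial.nonempty_iso (K := K) hsp
  rw [e.egirth_eq]
  exact egirth_Gam3
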